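/- Let $w=w_0w_1w_2\dots$ be an infinite word over the alphabet $\{0,1\}$ that is recurrent, i.e. each of its factors (finite blocks $w_i\dots w_{i+n-1}$, $n\ge 0$) occurs in $w$ at infinitely many positions. Two finite words are called abelian equivalent if they are permutations of each other. For a factor $u$ of $w$, let $n_1<n_2<n_3<\dots$ be all positions $n$ such that $w_{n}\dots w_{n+|u|-1}$ is abelian equivalent to $u$; the abelian returns to $u$ in $w$ are the abelian equivalence classes of the words $w_{n_i}\dots w_{n_{i+1}-1}$, $i\ge 1$. Then $w$ is Sturmian, i.e. has exactly $n+1$ distinct factors of length $n$ for every $n\ge 0$, if and only if every factor $u$ of $w$ has exactly two or exactly three (distinct) abelian returns in $w$. -/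

import Mathlib

/-- The finite word `w i, w (i + 1), …, w (i + n - 1)` of length `n` occurring in the infinite
word `w` at position `i`. -/
def wordAt {A : Type*} (w : ℕ → A) (i n : ℕ) : List A :=
  (List.range n).map fun k => w (i + k)

/-- The finite word `u` occurs in the infinite word `w` at position `i`. -/
def OccursAt {A : Type*} (w : ℕ → A) (u : List A) (i : ℕ) : Prop :=
  wordAt w i u.length = u

/-- The finite word `u` (possibly empty) is a factor of the infinite word `w`. -/
def IsFactor {A : Type*} (w : ℕ → A) (u : List A) : Prop :=
  ∃ i, OccursAt w u i

/-- An infinite word is recurrent if each of its factors occurs in it infinitely many times. -/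
def Recurrent {A : Type*} (w : ℕ → A) : Prop :=
  ∀ u : List A, IsFactor w u → {i | OccursAt w u i}.Infinite

/-- The factor complexity of `w`: the number of distinct factors of length `n`. -/
noncomputable def factorComplexity {A : Type*} (w : ℕ → A) (n : ℕ) : ℕ∞ :=
  {u : List A | IsFactor w u ∧ u.length = n}.encard

/-- An infinite word is Sturmian if it has exactly `n + 1` factors of length `n`, for all `n`. -/
def Sturmian {A : Type*} (w : ℕ → A) : Prop :=
  ∀ n : ℕ, factorComplexity w n = (n : ℕ∞) + 1

/-- A word abelian equivalent to `u` (a permutation of `u`) occurs in `w` at position `i`. -/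
def AbelianOccursAt {A : Type*} (w : ℕ → A) (u : List A) (i : ℕ) : Prop :=
  (wordAt w i u.length).Perm u

/-- The set of abelian returns to `u` in `w`: the abelian classes of the words
`w i, …, w (j - 1)`, where `i < j` are consecutive positions at which words abelian equivalent
to `u` occur. The abelian class of a finite word is its class modulo permutations,
that is, an element of `Multiset A`. -/
def abelianReturns {A : Type*} (w : ℕ → A) (u : List A) : Set (Multiset A) :=
  {m | ∃ i j : ℕ, i < j ∧ AbelianOccursAt w u i ∧ AbelianOccursAt w u j ∧
    (∀ k, i < k → k < j → ¬ AbelianOccursAt w u k) ∧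
    m = (wordAt w i (j - i) : Multiset A)}

/-! Write h(i) for the number of ones among the first i letters. Over two letters an abelian class
is a pair (length N, number v of ones). It occurs at i exactly when h(i+N) = h(i) + v, and a return
is recorded by its length and its number of ones (`encard_abelianReturns`). The theorem thus
concerns the first returns to the sets `window w N v`.

Sturmian words have two or three returns for the reason behind the three-distance theorem. A
recurrent Sturmian word is balanced (`Sturmian.balanced`), hence has a slope α, and aperiodicity
with recurrence makes α irrational. The deviations h(i) - iα are then pairwise distinct and differ
by less than 1. As h is integer valued, windows are convex in the deviation (`window_transport`). A
first return is therefore the shortest increasing displacement, the shortest decreasing one, or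
their sum (`increasing_return`). Both directions occur because deviations are bounded.

Conversely, a word with two or three returns per class can be desubstituted without end. At each
level a tail of the word is a product of blocks A, B with AB = Vcd and BA = Vdc. Replacing AB by BA
alters a single height, so the heights are those of the infinite power of A, corrected by ± the
number of cells below a lattice path H (`Coded.height_eq`). Comparing the path with its translate
shows that the extremal increments of H are visible as the occurrences of one abelian class
(`Coded.window_max`, `Coded.window_min`). The bound on returns becomes a bound on the distances
between such increments.

This prevents AA and BB from both recurring. If |A| ≠ |B|, one of the blocks would occur only in
groups of a fixed size at least two; that makes the coding eventually periodic and produces a class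
with a single return (`Good.not_blocks`). If |A| = |B|, the blocks are single letters, and a
separate analysis of run lengths applies (`Good.not_both_letters`). So a later tail is coded by A,
AB or by B, BA, and V grows (`Good.exists_longer`). Since V is followed by both letters, the
complexity is strictly increasing; since at most |V|+2 factors have length |V|+1, it equals n+1. -/

/-! ### Heights, windows and returns as numerical data -/

/-- The number of letters `1` among the first `i` letters of `w`. -/
def height (w : ℕ → Fin 2) (i : ℕ) : ℤ := ∑ k ∈ Finset.range i, ((w k : ℕ) : ℤ)

/-- Positions at which a block of length `N` with exactly `v` ones starts. -/
def window (w : ℕ → Fin 2) (N : ℕ) (v : ℤ) : Set ℕ :=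
  {i | height w (i + N) = height w i + v}

/-- `i < j` are consecutive elements of `S`. -/
def Consec (S : Set ℕ) (i j : ℕ) : Prop :=
  i ∈ S ∧ j ∈ S ∧ i < j ∧ ∀ k, i < k → k < j → k ∉ S

/-- The pairs (length, number of ones) of the abelian returns to the class `(N, v)`. -/
def gaps (w : ℕ → Fin 2) (N : ℕ) (v : ℤ) : Set (ℕ × ℤ) :=
  {p | ∃ i j, Consec (window w N v) i j ∧ p = (j - i, height w j - height w i)}

/-- Every block of `w` occurs at arbitrarily late positions. -/
def Recur (w : ℕ → Fin 2) : Prop :=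
  ∀ i n X : ℕ, ∃ i' ≥ X, ∀ k < n, w (i' + k) = w (i + k)

/-- Recurrent words all of whose abelian classes have two or three returns. -/
structure Good (w : ℕ → Fin 2) : Prop where
  recur : Recur w
  card : ∀ N v, (window w N v).Nonempty → (gaps w N v).encard = 2 ∨ (gaps w N v).encard = 3

theorem height_zero (w : ℕ → Fin 2) : height w 0 = 0 := by simp [height]

theorem height_succ (w : ℕ → Fin 2) (i : ℕ) :
    height w (i + 1) = height w i + ((w i : ℕ) : ℤ) := by
  simp [height, Finset.sum_range_succ]

theorem letter_bounds (a : Fin 2) : 0 ≤ ((a : ℕ) : ℤ) ∧ ((a : ℕ) : ℤ) ≤ 1 := by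
  have := a.isLt
  omega

theorem letter_eq_of_val {a b : Fin 2} (h : ((a : ℕ) : ℤ) = ((b : ℕ) : ℤ)) : a = b := by
  apply Fin.ext
  exact_mod_cast h

theorem height_mono (w : ℕ → Fin 2) : Monotone (height w) := by
  apply monotone_nat_of_le_succ
  intro n
  rw [height_succ]
  have := (letter_bounds (w n)).1
  omega

theorem height_congr {w w' : ℕ → Fin 2} {i i' n : ℕ} (h : ∀ k < n, w (i + k) = w' (i' + k)) :
    height w (i + n) - height w i = height w' (i' + n) - height w' i' := by
  induction n with
  | zero => simp
  | succ n ih =>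
    have h1 := ih fun k hk => h k (by omega)
    rw [← add_assoc, ← add_assoc, height_succ, height_succ, h n (by omega)]
    linarith

theorem height_shift (w : ℕ → Fin 2) (k i : ℕ) :
    height (fun j => w (k + j)) i = height w (k + i) - height w k := by
  have := height_congr (w := fun j => w (k + j)) (w' := w) (i := 0) (i' := k) (n := i)
    (by intro j _; simp)
  simpa [height_zero] using this

theorem length_wordAt {A : Type*} (w : ℕ → A) (i n : ℕ) : (wordAt w i n).length = n := by
  simp [wordAt]

theorem wordAt_succ {A : Type*} (w : ℕ → A) (i n : ℕ) :
    wordAt w i (n + 1) = wordAt w i n ++ [w (i + n)] := by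
  simp [wordAt, List.range_succ]

theorem wordAt_add {A : Type*} (w : ℕ → A) (i n m : ℕ) :
    wordAt w i (n + m) = wordAt w i n ++ wordAt w (i + n) m := by
  induction m with
  | zero => simp [wordAt]
  | succ m ih => rw [← add_assoc, wordAt_succ, ih, wordAt_succ, List.append_assoc, add_assoc]

theorem wordAt_eq_iff {A : Type*} {w w' : ℕ → A} {i i' n : ℕ} :
    wordAt w i n = wordAt w' i' n ↔ ∀ k < n, w (i + k) = w' (i' + k) := by
  constructor
  · intro h k hk
    have h1 : (wordAt w i n)[k]? = (wordAt w' i' n)[k]? := by rw [h]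
    simpa [wordAt, hk] using h1
  · intro h
    unfold wordAt
    apply List.map_congr_left
    intro k hk
    exact h k (List.mem_range.1 hk)

theorem count_wordAt (w : ℕ → Fin 2) (i n : ℕ) :
    ((wordAt w i n).count 1 : ℤ) = height w (i + n) - height w i := by
  induction n with
  | zero => simp [wordAt]
  | succ n ih =>
    rw [wordAt_succ, List.count_append, ← add_assoc, height_succ]
    push_cast
    rw [ih]
    have : ∀ a : Fin 2, ((List.count 1 [a] : ℕ) : ℤ) = ((a : ℕ) : ℤ) := by decide
    rw [this]
    ring

theorem count_zero_add_one (l : List (Fin 2)) : l.count 0 + l.count 1 = l.length := by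
  induction l with
  | nil => rfl
  | cons a l ih =>
    fin_cases a <;> simp <;> omega

theorem perm_iff_count {l l' : List (Fin 2)} :
    l.Perm l' ↔ l.length = l'.length ∧ l.count 1 = l'.count 1 := by
  rw [List.perm_iff_count]
  constructor
  · intro h
    refine ⟨?_, h 1⟩
    rw [← count_zero_add_one, ← count_zero_add_one, h 0, h 1]
  · rintro ⟨h1, h2⟩ a
    have := count_zero_add_one l
    have := count_zero_add_one l'
    fin_cases a
    · show l.count 0 = l'.count 0
      omega
    · exact h2

theorem abelianOccursAt_iff (w : ℕ → Fin 2) (u : List (Fin 2)) (i : ℕ) :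
    AbelianOccursAt w u i ↔ i ∈ window w u.length (u.count 1) := by
  unfold AbelianOccursAt window
  rw [perm_iff_count, length_wordAt, Set.mem_ofPred_eq]
  have := count_wordAt w i u.length
  constructor
  · rintro ⟨-, h⟩
    rw [h] at this
    linarith
  · intro h
    refine ⟨rfl, ?_⟩
    zify
    linarith

/-- Over two letters a multiset is determined by its size and its number of ones, so this encoding
of returns is injective. -/
theorem encard_abelianReturns (w : ℕ → Fin 2) (u : List (Fin 2)) :
    (abelianReturns w u).encard = (gaps w u.length (u.count 1)).encard := by
  let f : Multiset (Fin 2) → ℕ × ℤ := fun m => (m.card, (m.count 1 : ℤ))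
  have hf : Function.Injective f := by
    intro m m' h
    induction m using Quotient.inductionOn with
    | h l =>
    induction m' using Quotient.inductionOn with
    | h l' =>
      simp only [f, Multiset.quot_mk_to_coe, Multiset.coe_card, Multiset.coe_count, Prod.mk.injEq,
        Nat.cast_inj] at h
      exact Quotient.sound (perm_iff_count.2 h)
  rw [← hf.encard_image]
  congr 1
  ext p
  constructor
  · rintro ⟨m, ⟨i, j, hij, hi, hj, hk, rfl⟩, rfl⟩
    refine ⟨i, j, ⟨(abelianOccursAt_iff w u i).1 hi, (abelianOccursAt_iff w u j).1 hj, hij,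
      fun k h1 h2 h3 => hk k h1 h2 ((abelianOccursAt_iff w u k).2 h3)⟩, ?_⟩
    have := count_wordAt w i (j - i)
    rw [Nat.add_sub_cancel' hij.le] at this
    simp only [f, Multiset.coe_card, length_wordAt, Multiset.coe_count, this]
  · rintro ⟨i, j, ⟨hi, hj, hij, hk⟩, rfl⟩
    refine ⟨_, ⟨i, j, hij, (abelianOccursAt_iff w u i).2 hi, (abelianOccursAt_iff w u j).2 hj,
      fun k h1 h2 h3 => hk k h1 h2 ((abelianOccursAt_iff w u k).1 h3), rfl⟩, ?_⟩
    have := count_wordAt w i (j - i)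
    rw [Nat.add_sub_cancel' hij.le] at this
    simp only [f, Multiset.coe_card, length_wordAt, Multiset.coe_count, this]

theorem recur_of_recurrent {w : ℕ → Fin 2} (hw : Recurrent w) : Recur w := by
  intro i n X
  have h : OccursAt w (wordAt w i n) i := by simp [OccursAt, length_wordAt]
  obtain ⟨i', hi', hX⟩ := (hw _ ⟨i, h⟩).exists_gt X
  refine ⟨i', hX.le, ?_⟩
  have h2 : wordAt w i' n = wordAt w i n := by
    simpa [OccursAt, length_wordAt] using hi'
  exact wordAt_eq_iff.1 h2

theorem good_of_returns {w : ℕ → Fin 2} (hw : Recurrent w)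
    (h : ∀ u : List (Fin 2), IsFactor w u →
        (abelianReturns w u).encard = 2 ∨ (abelianReturns w u).encard = 3) : Good w := by
  refine ⟨recur_of_recurrent hw, ?_⟩
  rintro N v ⟨i, hi⟩
  have := h (wordAt w i N) ⟨i, by simp [OccursAt, length_wordAt]⟩
  rw [encard_abelianReturns, length_wordAt, count_wordAt] at this
  have hv : height w (i + N) - height w i = v := by
    have : height w (i + N) = height w i + v := hi
    linarith
  rwa [hv] at this

theorem Recur.shift {w : ℕ → Fin 2} (h : Recur w) (s : ℕ) : Recur fun j => w (s + j) := by
  intro i n X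
  obtain ⟨i', hi', hk⟩ := h (s + i) n (s + X)
  refine ⟨i' - s, by omega, fun k hkn => ?_⟩
  have := hk k hkn
  have e1 : s + (i' - s + k) = i' + k := by omega
  have e2 : s + (i + k) = s + i + k := by omega
  simp only [e1, e2, this]

theorem Recur.exists_window {w : ℕ → Fin 2} (h : Recur w) {N : ℕ} {v : ℤ} {i : ℕ}
    (hi : i ∈ window w N v) (X : ℕ) : ∃ j ≥ X, j ∈ window w N v := by
  obtain ⟨j, hj, hk⟩ := h i N X
  refine ⟨j, hj, ?_⟩
  have h1 := height_congr hk
  have h2 : height w (i + N) = height w i + v := hi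
  show height w (j + N) = height w j + v
  linarith

/-- Being consecutive depends only on the finite block from `i` to `j + N`, which recurs. -/
theorem Recur.exists_consec_late {w : ℕ → Fin 2} (h : Recur w) {N : ℕ} {v : ℤ} {i j : ℕ}
    (hij : Consec (window w N v) i j) (X : ℕ) :
    ∃ i' ≥ X, Consec (window w N v) i' (i' + (j - i)) ∧
      height w (i' + (j - i)) - height w i' = height w j - height w i := by
  obtain ⟨hi, hj, hlt, hno⟩ := hij
  obtain ⟨i', hX, hk⟩ := h i (j - i + N) X
  have key : ∀ m ≤ j - i, (i' + m ∈ window w N v ↔ i + m ∈ window w N v) := by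
    intro m hm
    have := height_congr (w := w) (w' := w) (i := i' + m) (i' := i + m) (n := N) (by
      intro k hkN
      have := hk (m + k) (by omega)
      rwa [← add_assoc, ← add_assoc] at this)
    simp only [window, Set.mem_ofPred_eq]
    constructor <;> intro h <;> linarith
  have e : i + (j - i) = j := by omega
  refine ⟨i', hX, ⟨?_, ?_, by omega, ?_⟩, ?_⟩
  · exact (key 0 (by omega)).2 hi
  · rw [key _ le_rfl, e]; exact hj
  · intro k h1 h2 h3
    have := (key (k - i') (by omega)).1 (by rwa [Nat.add_sub_cancel' h1.le])
    exact hno _ (by omega) (by omega) this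
  · have := height_congr (w := w) (w' := w) (i := i') (i' := i) (n := j - i)
      (fun k hkN => hk k (by omega))
    rw [this, e]

theorem mem_window_shift {w : ℕ → Fin 2} {s N : ℕ} {v : ℤ} {i : ℕ} :
    i ∈ window (fun j => w (s + j)) N v ↔ s + i ∈ window w N v := by
  simp only [window, Set.mem_ofPred_eq, height_shift]
  rw [← add_assoc]
  constructor <;> intro h <;> linarith

/-- By recurrence every return is also seen late, so deleting a prefix loses none. This permits
passing to tails freely. -/
theorem gaps_shift {w : ℕ → Fin 2} (h : Recur w) (s N : ℕ) (v : ℤ) :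
    gaps (fun j => w (s + j)) N v = gaps w N v := by
  ext p
  constructor
  · rintro ⟨i, j, ⟨hi, hj, hij, hno⟩, rfl⟩
    refine ⟨s + i, s + j, ⟨mem_window_shift.1 hi, mem_window_shift.1 hj, by omega, ?_⟩, ?_⟩
    · intro k h1 h2 h3
      refine hno (k - s) (by omega) (by omega) (mem_window_shift.2 ?_)
      rwa [Nat.add_sub_cancel' (by omega)]
    · rw [height_shift, height_shift]
      congr 1
      · omega
      · ring
  · rintro ⟨i, j, hij, rfl⟩
    obtain ⟨i', hX, ⟨hi, hj, hlt, hno⟩, hh⟩ := h.exists_consec_late hij s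
    have h1 : s + (i' - s) = i' := by omega
    have h2 : s + (i' + (j - i) - s) = i' + (j - i) := by omega
    refine ⟨i' - s, i' + (j - i) - s, ⟨?_, ?_, by omega, ?_⟩, ?_⟩
    · rw [mem_window_shift, h1]; exact hi
    · rw [mem_window_shift, h2]; exact hj
    · intro k hk1 hk2 hk3
      exact hno _ (by omega) (by omega) (mem_window_shift.1 hk3)
    · rw [height_shift, height_shift, h1, h2]
      congr 1
      · omega
      · linarith

theorem Good.shift {w : ℕ → Fin 2} (h : Good w) (s : ℕ) : Good fun j => w (s + j) := by
  refine ⟨h.recur.shift s, ?_⟩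
  rintro N v ⟨i, hi⟩
  rw [gaps_shift h.recur]
  exact h.card N v ⟨_, mem_window_shift.1 hi⟩

theorem Recur.exists_consec {w : ℕ → Fin 2} (h : Recur w) {N : ℕ} {v : ℤ} {i : ℕ}
    (hi : i ∈ window w N v) : ∃ j, Consec (window w N v) i j := by
  classical
  have hex : ∃ j, i < j ∧ j ∈ window w N v := by
    obtain ⟨j, h1, h2⟩ := h.exists_window hi (i + 1)
    exact ⟨j, by omega, h2⟩
  refine ⟨Nat.find hex, hi, (Nat.find_spec hex).2, (Nat.find_spec hex).1, ?_⟩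
  intro k h1 h2 h3
  exact Nat.find_min hex h2 ⟨h1, h3⟩

theorem Consec.mem_gaps {w : ℕ → Fin 2} {N : ℕ} {v : ℤ} {i j : ℕ}
    (h : Consec (window w N v) i j) : (j - i, height w j - height w i) ∈ gaps w N v :=
  ⟨i, j, h, rfl⟩

/-- There are no four different returns. -/
theorem Good.not_four {w : ℕ → Fin 2} (h : Good w) {N : ℕ} {v : ℤ} {p q r s : ℕ × ℤ}
    (hp : p ∈ gaps w N v) (hq : q ∈ gaps w N v) (hr : r ∈ gaps w N v) (hs : s ∈ gaps w N v)
    (h1 : p ≠ q) (h2 : p ≠ r) (h3 : p ≠ s) (h4 : q ≠ r) (h5 : q ≠ s) (h6 : r ≠ s) : False := by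
  have hne : (window w N v).Nonempty := by
    obtain ⟨i, j, hij, -⟩ := hp
    exact ⟨i, hij.1⟩
  have hle : (gaps w N v).encard ≤ 3 := by
    rcases h.card N v hne with h | h <;> rw [h]
    decide
  have hsub : ({p, q, r, s} : Set (ℕ × ℤ)) ⊆ gaps w N v := by
    rintro x (rfl | rfl | rfl | rfl) <;> assumption
  have h4 : ({p, q, r, s} : Set (ℕ × ℤ)).encard = 4 := by
    rw [Set.encard_insert_of_notMem (by simp [*]), Set.encard_insert_of_notMem (by simp [*]),
      Set.encard_pair h6]
    rfl
  have := (Set.encard_le_encard hsub).trans hle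
  rw [h4] at this
  exact absurd this (by decide)

/-- The returns that occur late are not all equal. -/
theorem Good.not_one {w : ℕ → Fin 2} (h : Good w) {N : ℕ} {v : ℤ} {i₀ : ℕ}
    (hne : (window w N v).Nonempty) (p : ℕ × ℤ)
    (hp : ∀ i j, i₀ ≤ i → Consec (window w N v) i j → (j - i, height w j - height w i) = p) :
    False := by
  have hsub : gaps w N v ⊆ {p} := by
    rintro x ⟨i, j, hij, rfl⟩
    obtain ⟨i', hX, hc, hh⟩ := h.recur.exists_consec_late hij i₀
    have := hp _ _ hX hc
    rw [hh, Nat.add_sub_cancel_left] at this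
    exact this
  have hle := Set.encard_le_encard hsub
  rw [Set.encard_singleton] at hle
  rcases h.card N v hne with h | h <;> rw [h] at hle <;> exact absurd hle (by decide)

/-! ### Standard pairs, block codings and heights as cell counts -/

/-- The number of ones of a finite word. -/
def ones (l : List (Fin 2)) : ℤ := (l.count 1 : ℤ)

/-- Two words whose two concatenations differ exactly by a swap of the last two letters. -/
structure StdPair (A B V : List (Fin 2)) (c d : Fin 2) : Prop where
  hAB : A ++ B = V ++ [c, d]
  hBA : B ++ A = V ++ [d, c]
  ne : c ≠ d
  hA : 0 < A.length
  hB : 0 < B.length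
  coprime : A.length.Coprime B.length

/-- The word `w` is a product of blocks `A` and `B`, and `H x` blocks `B` precede the block `A`
with index `x`. -/
structure Coded (A B : List (Fin 2)) (H : ℕ → ℕ) (w : ℕ → Fin 2) : Prop where
  mono : Monotone H
  occA : ∀ x, OccursAt w A (x * A.length + H x * B.length)
  occB : ∀ x y, (x = 0 ∨ H (x - 1) ≤ y) → y < H x → OccursAt w B (x * A.length + y * B.length)

/-- The height function of the infinite power of `A`. -/
def powHeight (A : List (Fin 2)) (i : ℕ) : ℤ :=
  (i / A.length : ℕ) * ones A + ones (A.take (i % A.length))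

/-- The cells below the graph of `H` on the level `i`. -/
def cells (H : ℕ → ℕ) (a b e i : ℕ) : Set (ℕ × ℕ) :=
  {p | p.2 < H p.1 ∧ p.1 * a + p.2 * b + e = i}

theorem StdPair.symm {A B V : List (Fin 2)} {c d : Fin 2} (h : StdPair A B V c d) :
    StdPair B A V d c :=
  ⟨h.hBA, h.hAB, h.ne.symm, h.hB, h.hA, h.coprime.symm⟩

theorem StdPair.length {A B V : List (Fin 2)} {c d : Fin 2} (h : StdPair A B V c d) :
    A.length + B.length = V.length + 2 := by
  have := congrArg List.length h.hAB
  simpa using this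

theorem ones_append (l l' : List (Fin 2)) : ones (l ++ l') = ones l + ones l' := by
  simp [ones]

theorem ones_singleton (a : Fin 2) : ones [a] = ((a : ℕ) : ℤ) := by
  revert a; decide

theorem take_wordAt {A : Type*} (w : ℕ → A) (i : ℕ) {k n : ℕ} (h : k ≤ n) :
    (wordAt w i n).take k = wordAt w i k := by
  obtain ⟨m, rfl⟩ := Nat.exists_eq_add_of_le h
  rw [wordAt_add, List.take_append_of_le_length (by simp [length_wordAt])]
  rw [List.take_of_length_le (by simp [length_wordAt])]

theorem OccursAt.height {w : ℕ → Fin 2} {u : List (Fin 2)} {i : ℕ} (h : OccursAt w u i) {k : ℕ}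
    (hk : k ≤ u.length) : height w (i + k) = height w i + ones (u.take k) := by
  have h1 : u.take k = wordAt w i k := by
    rw [← take_wordAt w i hk, h]
  rw [h1]
  have := count_wordAt w i k
  unfold ones
  linarith

theorem OccursAt.height_length {w : ℕ → Fin 2} {u : List (Fin 2)} {i : ℕ} (h : OccursAt w u i) :
    _root_.height w (i + u.length) = _root_.height w i + ones u := by
  rw [h.height le_rfl, List.take_length]

theorem occursAt_shift {A : Type*} {w : ℕ → A} {u : List A} {s i : ℕ} :
    OccursAt (fun j => w (s + j)) u i ↔ OccursAt w u (s + i) := by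
  unfold OccursAt wordAt
  simp only [add_assoc]

theorem Coded.shiftA {A B : List (Fin 2)} {H : ℕ → ℕ} {w : ℕ → Fin 2} (h : Coded A B H w)
    (h0 : H 0 = 0) : Coded A B (fun x => H (x + 1)) (fun j => w (A.length + j)) := by
  refine ⟨fun x y hxy => h.mono (by omega), fun x => ?_, fun x y h1 h2 => ?_⟩
  · rw [occursAt_shift]
    convert h.occA (x + 1) using 1
    ring
  · rw [occursAt_shift]
    convert h.occB (x + 1) y ?_ h2 using 1
    · ring
    · right
      rcases h1 with rfl | h1
      · simp [h0]
      · rcases x with _ | x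
        · simp [h0]
        · simpa using h1

theorem Coded.shiftB {A B : List (Fin 2)} {H : ℕ → ℕ} {w : ℕ → Fin 2} (h : Coded A B H w)
    (h0 : 0 < H 0) : Coded A B (fun x => H x - 1) (fun j => w (B.length + j)) := by
  have hpos : ∀ x, 0 < H x := fun x => h0.trans_le (h.mono (Nat.zero_le x))
  refine ⟨fun x y hxy => Nat.sub_le_sub_right (h.mono hxy) 1, fun x => ?_, fun x y h1 h2 => ?_⟩
  · rw [occursAt_shift]
    convert h.occA x using 1
    obtain ⟨k, hk⟩ := Nat.exists_eq_add_of_le (hpos x)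
    rw [hk]
    simp
    ring
  · rw [occursAt_shift]
    convert h.occB x (y + 1) ?_ (by omega) using 1
    · ring
    · rcases h1 with h1 | h1
      · exact Or.inl h1
      · right
        omega

theorem Coded.occB_zero {A B : List (Fin 2)} {H : ℕ → ℕ} {w : ℕ → Fin 2} (h : Coded A B H w)
    (h0 : 0 < H 0) : OccursAt w B 0 := by
  simpa using h.occB 0 0 (Or.inl rfl) h0

theorem powHeight_of_lt {A : List (Fin 2)} {i : ℕ} (h : i < A.length) :
    powHeight A i = ones (A.take i) := by
  simp [powHeight, Nat.div_eq_of_lt h, Nat.mod_eq_of_lt h]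

theorem powHeight_add {A : List (Fin 2)} (hA : 0 < A.length) (i : ℕ) :
    powHeight A (i + A.length) = ones A + powHeight A i := by
  unfold powHeight
  rw [Nat.add_div_right _ hA, Nat.add_mod_right]
  push_cast
  ring

section

variable {A B V : List (Fin 2)} {c d : Fin 2}

theorem StdPair.take_eq (h : StdPair A B V c d) {i : ℕ} (hi : i ≤ V.length) :
    (A ++ B).take i = (B ++ A).take i := by
  rw [h.hAB, h.hBA, List.take_append_of_le_length hi, List.take_append_of_le_length hi]

/-- As `AB` and `BA` share the prefix `V`, the word `Vc` has period `|A|` and is a prefix of the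
infinite power of `A`. -/
theorem StdPair.powHeight_eq (h : StdPair A B V c d) {i : ℕ} (hi : i ≤ V.length + 1) :
    powHeight A i = ones ((A ++ B).take i) := by
  have hl := h.length
  have hA := h.hA
  have hB := h.hB
  induction i using Nat.strong_induction_on with
  | h i ih =>
    by_cases hlt : i < A.length
    · rw [powHeight_of_lt hlt, List.take_append_of_le_length hlt.le]
    · obtain ⟨j, rfl⟩ := Nat.exists_eq_add_of_le (not_lt.1 hlt)
      rw [add_comm, powHeight_add hA, ih j (by omega) (by omega), h.take_eq (by omega),
        List.take_append_of_le_length (by omega), add_comm j, List.take_length_add_append,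
        ones_append]

theorem StdPair.ones_take_BA (h : StdPair A B V c d) {i : ℕ} (hi : i ≤ V.length + 1) :
    ones ((B ++ A).take i) = powHeight A i +
      ((d : ℕ) - (c : ℕ) : ℤ) * (if i = V.length + 1 then 1 else 0) := by
  rw [h.powHeight_eq hi]
  split_ifs with h1
  · subst h1
    rw [h.hAB, h.hBA, List.take_length_add_append, List.take_length_add_append, ones_append,
      ones_append]
    simp [ones_singleton]
  · rw [h.take_eq (by omega)]
    simp

open scoped Classical in
/-- Moving a block `B` to the front of the infinite power of `A` changes the heights exactly at the
levels of the cells of the bottom row. -/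
theorem StdPair.powHeight_row (h : StdPair A B V c d) {i : ℕ} (hi : B.length ≤ i) :
    powHeight A i + ((d : ℕ) - (c : ℕ) : ℤ) *
      (if ∃ x, x * A.length + (V.length + 1) = i then 1 else 0) =
      ones B + powHeight A (i - B.length) := by
  have hl := h.length
  have hA := h.hA
  have hB := h.hB
  induction i using Nat.strong_induction_on with
  | h i ih =>
    by_cases hlt : i < A.length + B.length
    · have h1 : ones ((B ++ A).take i) = ones B + powHeight A (i - B.length) := by
        obtain ⟨j, rfl⟩ := Nat.exists_eq_add_of_le hi
        rw [List.take_length_add_append, ones_append, powHeight_of_lt (by omega)]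
        simp
      rw [← h1, h.ones_take_BA (by omega)]
      congr 2
      apply if_congr _ rfl rfl
      constructor
      · rintro ⟨x, hx⟩
        rcases x with _ | x
        · omega
        · have : A.length ≤ (x + 1) * A.length := Nat.le_mul_of_pos_left _ (by omega)
          omega
      · rintro rfl
        exact ⟨0, by simp⟩
    · obtain ⟨j, rfl⟩ := Nat.exists_eq_add_of_le (show A.length ≤ i by omega)
      have h1 := ih j (by omega) (by omega)
      have e1 : A.length + j - B.length = (j - B.length) + A.length := by omega
      rw [e1, add_comm A.length j, powHeight_add hA, powHeight_add hA]
      have h2 : (∃ x, x * A.length + (V.length + 1) = j + A.length) ↔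
          ∃ x, x * A.length + (V.length + 1) = j := by
        constructor
        · rintro ⟨x, hx⟩
          rcases x with _ | x
          · omega
          · refine ⟨x, ?_⟩
            rw [add_mul] at hx
            omega
        · rintro ⟨x, hx⟩
          refine ⟨x + 1, ?_⟩
          rw [add_mul]
          omega
      rw [if_congr h2 rfl rfl]
      linarith

end

theorem cells_finite (H : ℕ → ℕ) {a b : ℕ} (ha : 0 < a) (hb : 0 < b) (e i : ℕ) :
    (cells H a b e i).Finite := by
  apply ((Set.finite_Iic i).prod (Set.finite_Iic i)).subset
  rintro ⟨x, y⟩ ⟨-, h⟩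
  simp only at h
  have h1 : x ≤ x * a := Nat.le_mul_of_pos_right _ ha
  have h2 : y ≤ y * b := Nat.le_mul_of_pos_right _ hb
  simp only [Set.mem_prod, Set.mem_Iic]
  omega

theorem cells_eq_empty {H : ℕ → ℕ} {a b e i : ℕ} (h : i < e) : cells H a b e i = ∅ := by
  ext ⟨x, y⟩
  simp only [cells, Set.mem_ofPred_eq, Set.mem_empty_iff_false, iff_false, not_and]
  omega

theorem ncard_cells_shiftA {H : ℕ → ℕ} (h0 : H 0 = 0) (a b e i : ℕ) :
    (cells H a b e (i + a)).ncard = (cells (fun x => H (x + 1)) a b e i).ncard := by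
  have hinj : Function.Injective (fun p : ℕ × ℕ => (p.1 + 1, p.2)) := by
    rintro ⟨x, y⟩ ⟨x', y'⟩ h
    simp only [Prod.mk.injEq] at h
    ext <;> simp <;> omega
  rw [← Set.ncard_image_of_injective (cells (fun x => H (x + 1)) a b e i) hinj]
  congr 1
  ext ⟨x, y⟩
  simp only [cells, Set.mem_ofPred_eq, Set.mem_image, Prod.exists, Prod.mk.injEq]
  constructor
  · rintro ⟨h1, h2⟩
    rcases x with _ | x
    · omega
    · refine ⟨x, y, ⟨h1, ?_⟩, rfl, rfl⟩
      rw [add_mul] at h2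
      omega
  · rintro ⟨x', y', ⟨h1, h2⟩, rfl, rfl⟩
    refine ⟨h1, ?_⟩
    rw [add_mul]
    omega

-- Deleting a first block `B` deletes the bottom row of the diagram, which has at most one cell on
-- each level; the indicator counts it.
open scoped Classical in
theorem ncard_cells_shiftB {H : ℕ → ℕ} (h0 : ∀ x, 0 < H x) {a b : ℕ} (ha : 0 < a) (hb : 0 < b)
    (e i : ℕ) :
    (cells H a b e (i + b)).ncard = (cells (fun x => H x - 1) a b e i).ncard +
      (if ∃ x, x * a + e = i + b then 1 else 0) := by
  have hinj : Function.Injective (fun p : ℕ × ℕ => (p.1, p.2 + 1)) := by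
    rintro ⟨x, y⟩ ⟨x', y'⟩ h
    simp only [Prod.mk.injEq] at h
    ext <;> simp <;> omega
  rw [← Set.ncard_image_of_injective (cells (fun x => H x - 1) a b e i) hinj]
  have hfin := cells_finite (fun x => H x - 1) ha hb e i
  have hmem : ∀ x y, (x, y + 1) ∈ cells H a b e (i + b) ↔
      (x, y + 1) ∈ (fun p : ℕ × ℕ => (p.1, p.2 + 1)) '' cells (fun x => H x - 1) a b e i := by
    intro x y
    simp only [cells, Set.mem_ofPred_eq, Set.mem_image, Prod.exists, Prod.mk.injEq]
    constructor
    · rintro ⟨h1, h2⟩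
      refine ⟨x, y, ⟨by omega, ?_⟩, rfl, rfl⟩
      rw [add_mul] at h2
      omega
    · rintro ⟨x', y', ⟨h1, h2⟩, rfl, h3⟩
      obtain rfl : y' = y := by omega
      refine ⟨by omega, ?_⟩
      rw [add_mul]
      omega
  split_ifs with hx
  · obtain ⟨x, hx⟩ := hx
    rw [← Set.ncard_insert_of_notMem (a := (x, 0)) _ (hfin.image _)]
    · congr 1
      ext ⟨x', y'⟩
      rw [Set.mem_insert_iff]
      rcases y' with _ | y'
      · constructor
        · rintro ⟨-, h2⟩
          left
          simp only [zero_mul, add_zero] at h2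
          have : x' * a = x * a := by omega
          rw [Nat.eq_of_mul_eq_mul_right ha this]
        · rintro (h | h)
          · simp only [Prod.mk.injEq, and_true] at h
            subst h
            exact ⟨h0 _, by simpa using hx⟩
          · simp at h
      · rw [hmem]
        simp
    · simp
  · rw [add_zero]
    congr 1
    ext ⟨x', y'⟩
    rcases y' with _ | y'
    · constructor
      · rintro ⟨-, h2⟩
        exact absurd ⟨x', by simpa using h2⟩ hx
      · intro h
        simp at h
    · exact hmem _ _

open scoped Classical in
/-- The heights of a word coded by `H` differ from those of the infinite power of `A` by the number
of cells below the graph of `H`. -/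
theorem Coded.height_eq {A B V : List (Fin 2)} {c d : Fin 2} (hs : StdPair A B V c d) :
    ∀ (i : ℕ) {H : ℕ → ℕ} {w : ℕ → Fin 2}, Coded A B H w →
      height w i = powHeight A i +
        ((d : ℕ) - (c : ℕ) : ℤ) * (cells H A.length B.length (V.length + 1) i).ncard := by
  intro i
  have hl := hs.length
  have hA := hs.hA
  have hB := hs.hB
  induction i using Nat.strong_induction_on with
  | h i ih =>
    intro H w h
    -- The first block is removed. It is `A` precisely when `H 0 = 0`; removing a `B` costs the
    -- bottom row, as computed by `StdPair.powHeight_row`.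
    rcases Nat.eq_zero_or_pos (H 0) with h0 | h0
    · have hocc : OccursAt w A 0 := by simpa [h0] using h.occA 0
      by_cases hlt : i < A.length
      · rw [cells_eq_empty (by omega), powHeight_of_lt hlt]
        have := hocc.height hlt.le
        rw [zero_add, height_zero] at this
        simp [this]
      · obtain ⟨j, rfl⟩ := Nat.exists_eq_add_of_le (not_lt.1 hlt)
        have h1 := ih j (by omega) (h.shiftA h0)
        rw [height_shift] at h1
        have h2 := hocc.height_length
        rw [zero_add, height_zero] at h2
        rw [add_comm A.length j, ncard_cells_shiftA h0, powHeight_add hA, add_comm j]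
        linarith
    · have hocc := h.occB_zero h0
      by_cases hlt : i < B.length
      · rw [cells_eq_empty (by omega), hs.powHeight_eq (by omega), hs.take_eq (by omega),
          List.take_append_of_le_length hlt.le]
        have := hocc.height hlt.le
        rw [zero_add, height_zero] at this
        simp [this]
      · obtain ⟨j, rfl⟩ := Nat.exists_eq_add_of_le (not_lt.1 hlt)
        have h1 := ih j (by omega) (h.shiftB h0)
        rw [height_shift] at h1
        have h2 := hocc.height_length
        rw [zero_add, height_zero] at h2
        have h3 := hs.powHeight_row (i := B.length + j) (by omega)
        rw [Nat.add_sub_cancel_left] at h3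
        rw [add_comm B.length j] at h1 h3 ⊢
        rw [ncard_cells_shiftB (fun x => h0.trans_le (h.mono (Nat.zero_le x))) hA hB]
        push_cast
        linarith

/-! ### Translates of the path and the classes that see its extremal increments -/

section

variable {A B V : List (Fin 2)} {c d : Fin 2} {H : ℕ → ℕ} {w : ℕ → Fin 2}

theorem powHeight_add_mul (hA : 0 < A.length) (i m : ℕ) :
    powHeight A (i + m * A.length) = m * ones A + powHeight A i := by
  induction m with
  | zero => simp
  | succ m ih =>
    rw [add_mul, one_mul, ← add_assoc, powHeight_add hA, ih]
    push_cast
    ring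

/-- The row formula applied `C` times, for `C` blocks `B` put in front of the infinite power of `A`.
-/
theorem StdPair.powHeight_rows (h : StdPair A B V c d) (C : ℕ) {i : ℕ} :
    powHeight A (i + C * B.length) + ((d : ℕ) - (c : ℕ) : ℤ) *
      (cells (fun _ => C) A.length B.length (V.length + 1) (i + C * B.length)).ncard =
      C * ones B + powHeight A i := by
  induction C with
  | zero =>
    have : cells (fun _ => 0) A.length B.length (V.length + 1) (i + 0 * B.length) = ∅ := by
      ext ⟨x, y⟩
      simp [cells]
    rw [this]
    simp
  | succ C ih =>
    have e : i + (C + 1) * B.length = i + C * B.length + B.length := by ring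
    have h1 := h.powHeight_row (i := i + C * B.length + B.length) (by omega)
    rw [Nat.add_sub_cancel] at h1
    rw [e, ncard_cells_shiftB (fun _ => Nat.succ_pos C) h.hA h.hB]
    push_cast
    linarith

/-- Comparison of the path with its translate. -/
theorem Coded.height_sub (hs : StdPair A B V c d) (h : Coded A B H w) (hH : ∀ M, ∃ x, M ≤ H x)
    (m C : ℕ) : ∃ i₀, ∀ i ≥ i₀,
      height w (i + (m * A.length + C * B.length)) - height w i - (m * ones A + C * ones B) =
        ((d : ℕ) - (c : ℕ) : ℤ) *
          ((cells (fun x => H (x + m) - C) A.length B.length (V.length + 1) i).ncard -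
            (cells H A.length B.length (V.length + 1) i).ncard) := by
  have hA := hs.hA
  have hB := hs.hB
  obtain ⟨x₀, hx₀⟩ := hH C
  set a := A.length
  set b := B.length
  set e := V.length + 1
  -- On levels beyond this bound, cells in the `C` bottom rows lie in columns where `H ≥ C`, and all
  -- cells under the graph lie in columns from `m` on.
  refine ⟨x₀ * a + C * b + e + (m * a + H m * b + e), fun i hi => ?_⟩
  -- A cell on the higher level lies in one of the `C` bottom rows or is the translate by `(m, C)`
  -- of a cell under the shifted graph.
  have hcells : cells H a b e (i + (m * a + C * b)) =
      cells (fun _ => C) a b e (i + (m * a + C * b)) ∪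
        (fun p : ℕ × ℕ => (p.1 + m, p.2 + C)) '' cells (fun x => H (x + m) - C) a b e i := by
    ext ⟨x, y⟩
    simp only [cells, Set.mem_union, Set.mem_ofPred_eq, Set.mem_image, Prod.exists, Prod.mk.injEq]
    constructor
    · rintro ⟨h1, h2⟩
      by_cases hy : y < C
      · exact Or.inl ⟨hy, h2⟩
      · right
        have hx : m ≤ x := by
          by_contra hx
          push Not at hx
          have e1 : x * a ≤ m * a := Nat.mul_le_mul_right _ hx.le
          have e2 : y * b ≤ H m * b := Nat.mul_le_mul_right _ (h1.le.trans (h.mono hx.le))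
          omega
        refine ⟨x - m, y - C, ⟨?_, ?_⟩, by omega, by omega⟩
        · rw [Nat.sub_add_cancel hx]
          omega
        · obtain ⟨x', rfl⟩ := Nat.exists_eq_add_of_le hx
          obtain ⟨y', rfl⟩ := Nat.exists_eq_add_of_le (not_lt.1 hy)
          simp only [Nat.add_sub_cancel_left]
          rw [add_mul, add_mul] at h2
          omega
    · rintro (⟨h1, h2⟩ | ⟨x', y', ⟨h1, h2⟩, rfl, rfl⟩)
      · refine ⟨?_, h2⟩
        by_contra hy
        have hx : x < x₀ := by
          by_contra hx
          have := h.mono (not_lt.1 hx)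
          omega
        have e1 : x * a ≤ x₀ * a := Nat.mul_le_mul_right _ hx.le
        have e2 : y * b ≤ C * b := Nat.mul_le_mul_right _ h1.le
        omega
      · refine ⟨by omega, ?_⟩
        rw [add_mul, add_mul]
        omega
  have hinj : Function.Injective (fun p : ℕ × ℕ => (p.1 + m, p.2 + C)) := by
    rintro ⟨x, y⟩ ⟨x', y'⟩ h
    simp only [Prod.mk.injEq] at h
    ext <;> simp <;> omega
  have hdisj : Disjoint (cells (fun _ => C) a b e (i + (m * a + C * b)))
      ((fun p : ℕ × ℕ => (p.1 + m, p.2 + C)) '' cells (fun x => H (x + m) - C) a b e i) := by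
    rw [Set.disjoint_left]
    rintro ⟨x, y⟩ ⟨h1, -⟩ ⟨⟨x', y'⟩, -, h3⟩
    simp only [Prod.mk.injEq] at h1 h3
    omega
  have hcard := Set.ncard_union_eq hdisj (cells_finite _ hA hB _ _)
    ((cells_finite _ hA hB _ _).image _)
  rw [← hcells, Set.ncard_image_of_injective _ hinj] at hcard
  have h1 := Coded.height_eq hs (i + (m * a + C * b)) h
  have h2 := Coded.height_eq hs i h
  have h3 := hs.powHeight_rows C (i := i + m * a)
  rw [powHeight_add_mul hA] at h3
  rw [hcard] at h1
  have e1 : i + m * a + C * b = i + (m * a + C * b) := by ring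
  change powHeight A (i + m * a + C * b) + ((d : ℕ) - (c : ℕ) : ℤ) *
    (cells (fun _ => C) a b e (i + m * a + C * b)).ncard = _ at h3
  rw [e1] at h3
  rw [h1, h2]
  push_cast
  linarith

theorem sq_eq_one_of_ne (h : c ≠ d) :
    ((d : ℕ) - (c : ℕ) : ℤ) * ((d : ℕ) - (c : ℕ) : ℤ) = 1 := by
  revert h; revert c d; decide

theorem Coded.start_strictMono (h : Coded A B H w) (hA : 0 < A.length) :
    StrictMono fun x => x * A.length + H x * B.length := by
  intro x y hxy
  have h1 : (x + 1) * A.length ≤ y * A.length := Nat.mul_le_mul_right _ hxy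
  have h2 : H x * B.length ≤ H y * B.length := Nat.mul_le_mul_right _ (h.mono hxy.le)
  simp only
  rw [add_mul] at h1
  omega

/-- When the increments over `m` columns are at most `C + 1`, the translated diagram can exceed the
original only by the corner cell `(x, H x)` of a column, and does so exactly when the bound is
attained. Corner cells lie on distinct levels, so the class with surplus `d - c` records the columns
of maximal increment. -/
theorem Coded.window_max (hs : StdPair A B V c d) (h : Coded A B H w) (hH : ∀ M, ∃ x, M ≤ H x)
    {m C x₁ : ℕ} (hx₁ : ∀ x ≥ x₁, H (x + m) ≤ H x + C + 1) : ∃ i₀, ∀ i ≥ i₀,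
      (i ∈ window w (m * A.length + C * B.length)
          (m * ones A + C * ones B + ((d : ℕ) - (c : ℕ))) ↔
        ∃ x ≥ x₁, H (x + m) = H x + C + 1 ∧
          i = x * A.length + H x * B.length + (V.length + 1)) := by
  have hA := hs.hA
  have hB := hs.hB
  have hsq := sq_eq_one_of_ne hs.ne
  obtain ⟨i₀, hi₀⟩ := h.height_sub hs hH m C
  have hρ := h.start_strictMono hA
  set a := A.length
  set b := B.length
  set e := V.length + 1
  refine ⟨i₀ + (x₁ * a + H (x₁ + m) * b + e), fun i hi => ?_⟩
  have hd := hi₀ i (by omega)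
  set U := cells (fun x => H (x + m) - C) a b e i with hU
  set W := cells H a b e i with hW
  have hfU : U.Finite := cells_finite _ hA hB _ _
  have hfW : W.Finite := cells_finite _ hA hB _ _
  have hmem : i ∈ window w (m * a + C * b) (m * ones A + C * ones B + ((d : ℕ) - (c : ℕ))) ↔
      U.ncard = W.ncard + 1 := by
    simp only [window, Set.mem_ofPred_eq]
    constructor
    · intro h1
      have h2 : ((d : ℕ) - (c : ℕ) : ℤ) = ((d : ℕ) - (c : ℕ) : ℤ) * (U.ncard - W.ncard) := by
        linarith
      -- Multiplying by the sign `d - c`, whose square is 1, cancels it.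
      have h3 := congrArg (fun t => ((d : ℕ) - (c : ℕ) : ℤ) * t) h2
      rw [← mul_assoc, hsq] at h3
      omega
    · intro h1
      rw [h1] at hd
      push_cast at hd
      linarith
  have hlarge : ∀ x y, y < H (x + m) → x * a + y * b + e = i → x₁ ≤ x := by
    intro x y hy hl
    by_contra hx
    have e1 : x * a ≤ x₁ * a := Nat.mul_le_mul_right _ (by omega)
    have e2 : (y + 1) * b ≤ H (x₁ + m) * b :=
      Nat.mul_le_mul_right _ (hy.trans_le (h.mono (by omega)))
    rw [add_mul] at e2
    omega
  rw [hmem]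
  constructor
  · intro hcard
    by_contra hno
    push Not at hno
    have hsub : U ⊆ W := by
      rintro ⟨x, y⟩ ⟨h1, h2⟩
      simp only at h1 h2
      have hx := hlarge x y (by omega) h2
      have h3 := hx₁ x hx
      refine ⟨?_, h2⟩
      show y < H x
      by_contra hy
      have hy' : y = H x := by omega
      refine hno x hx (by omega) ?_
      rw [← hy', h2]
    have := Set.ncard_le_ncard hsub hfW
    omega
  · rintro ⟨x, hx, hΔ, hlev⟩
    -- No cell of `W` is lost: earlier columns are too low to reach this level, and later ones have
    -- `y' ≤ H x < H (x' + m) - C`.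
    have : U = insert (x, H x) W := by
      ext ⟨x', y'⟩
      rw [Set.mem_insert_iff]
      constructor
      · rintro ⟨h1, h2⟩
        simp only at h1 h2
        have hx' := hlarge x' y' (by omega) h2
        have h3 := hx₁ x' hx'
        by_cases hy : y' < H x'
        · exact Or.inr ⟨hy, h2⟩
        · left
          have hy' : y' = H x' := by omega
          subst hy'
          have : x' = x := hρ.injective (by omega)
          rw [this]
      · rintro (h1 | ⟨h1, h2⟩)
        · simp only [Prod.mk.injEq] at h1
          obtain ⟨rfl, rfl⟩ := h1
          exact ⟨show H x' < H (x' + m) - C by omega, hlev.symm⟩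
        · simp only at h1 h2
          refine ⟨?_, h2⟩
          show y' < H (x' + m) - C
          rcases lt_or_ge x' x with hlt | hge
          · have e1 : (x' + 1) * a ≤ x * a := Nat.mul_le_mul_right _ hlt
            have e2 : y' * b ≤ H x * b := Nat.mul_le_mul_right _ (h1.le.trans (h.mono hlt.le))
            rw [add_mul] at e1
            omega
          · have e1 : x * a ≤ x' * a := Nat.mul_le_mul_right _ hge
            have e3 : H (x + m) ≤ H (x' + m) := h.mono (by omega)
            by_cases hy : y' ≤ H x
            · omega
            · have e2 : (H x + 1) * b ≤ y' * b := Nat.mul_le_mul_right _ (by omega)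
              rw [add_mul] at e2
              omega
    rw [this, Set.ncard_insert_of_notMem (fun h1 => lt_irrefl _ h1.1) hfW]

/-- The counterpart of `Coded.window_max` for minimal increments. A translation by `C + 1` rows can
remove only the top cell `(x, H x - 1)` of a column. The row `H x - 1` accounts for the shift by
`B.length`. -/
theorem Coded.window_min (hs : StdPair A B V c d) (h : Coded A B H w) (hH : ∀ M, ∃ x, M ≤ H x)
    {m C x₁ : ℕ} (hx₁ : ∀ x ≥ x₁, H x + C ≤ H (x + m)) : ∃ i₀, ∀ i ≥ i₀,
      (i ∈ window w (m * A.length + (C + 1 : ℕ) * B.length)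
          (m * ones A + (C + 1 : ℕ) * ones B - ((d : ℕ) - (c : ℕ))) ↔
        ∃ x ≥ x₁, H (x + m) = H x + C ∧
          i + B.length = x * A.length + H x * B.length + (V.length + 1)) := by
  have hA := hs.hA
  have hB := hs.hB
  have hsq := sq_eq_one_of_ne hs.ne
  obtain ⟨i₀, hi₀⟩ := h.height_sub hs hH m (C + 1)
  have hρ := h.start_strictMono hA
  obtain ⟨x₀, hx₀⟩ := hH 1
  set a := A.length
  set b := B.length
  set e := V.length + 1
  refine ⟨i₀ + (x₁ * a + H (x₁ + m) * b + e) + (x₁ * a + H x₁ * b + e) + (x₀ * a + e),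
    fun i hi => ?_⟩
  have hd := hi₀ i (by omega)
  set U := cells (fun x => H (x + m) - (C + 1)) a b e i with hU
  set W := cells H a b e i with hW
  have hfU : U.Finite := cells_finite _ hA hB _ _
  have hfW : W.Finite := cells_finite _ hA hB _ _
  have hmem : i ∈ window w (m * a + (C + 1 : ℕ) * b)
      (m * ones A + (C + 1 : ℕ) * ones B - ((d : ℕ) - (c : ℕ))) ↔ W.ncard = U.ncard + 1 := by
    simp only [window, Set.mem_ofPred_eq]
    constructor
    · intro h1
      have h2 : ((d : ℕ) - (c : ℕ) : ℤ) = ((d : ℕ) - (c : ℕ) : ℤ) * (W.ncard - U.ncard) := by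
        linarith
      have h3 := congrArg (fun t => ((d : ℕ) - (c : ℕ) : ℤ) * t) h2
      rw [← mul_assoc, hsq] at h3
      omega
    · intro h1
      rw [h1] at hd
      push_cast at hd ⊢
      linarith
  have hlarge : ∀ x y, y < H x → x * a + y * b + e = i → x₁ ≤ x := by
    intro x y hy hl
    by_contra hx
    have e1 : x * a ≤ x₁ * a := Nat.mul_le_mul_right _ (by omega)
    have e2 : (y + 1) * b ≤ H x₁ * b :=
      Nat.mul_le_mul_right _ (hy.trans_le (h.mono (by omega)))
    rw [add_mul] at e2
    omega
  rw [hmem]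
  constructor
  · intro hcard
    by_contra hno
    push Not at hno
    have hsub : W ⊆ U := by
      rintro ⟨x, y⟩ ⟨h1, h2⟩
      simp only at h1 h2
      have hx := hlarge x y h1 h2
      have h3 := hx₁ x hx
      refine ⟨?_, h2⟩
      show y < H (x + m) - (C + 1)
      by_contra hy
      have hy' : H x = y + 1 := by omega
      refine hno x hx (by omega) ?_
      rw [hy', add_mul, ← h2]
      ring
    have := Set.ncard_le_ncard hsub hfU
    omega
  · rintro ⟨x, hx, hΔ, hlev⟩
    have hpos : 0 < H x := by
      by_contra h0
      have h0' : H x = 0 := by omega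
      have hxx : x < x₀ := by
        by_contra hxx
        have := h.mono (not_lt.1 hxx)
        omega
      have e1 : x * a ≤ x₀ * a := Nat.mul_le_mul_right _ hxx.le
      rw [h0'] at hlev
      omega
    obtain ⟨y, hy⟩ : ∃ y, H x = y + 1 := ⟨H x - 1, by omega⟩
    have hlev' : i = x * a + y * b + e := by
      rw [hy, add_mul] at hlev
      omega
    have : W = insert (x, y) U := by
      ext ⟨x', y'⟩
      rw [Set.mem_insert_iff]
      constructor
      · rintro ⟨h1, h2⟩
        simp only at h1 h2
        have hx' := hlarge x' y' h1 h2
        have h3 := hx₁ x' hx'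
        by_cases hyU : y' < H (x' + m) - (C + 1)
        · exact Or.inr ⟨hyU, h2⟩
        · left
          have hy' : H x' = y' + 1 := by omega
          have : x' = x := hρ.injective (by
            rw [hy, hy', add_mul, add_mul]
            omega)
          subst this
          rw [hy] at hy'
          simp only [Prod.mk.injEq, true_and]
          omega
      · rintro (h1 | ⟨h1, h2⟩)
        · simp only [Prod.mk.injEq] at h1
          obtain ⟨rfl, rfl⟩ := h1
          exact ⟨show y' < H x' by omega, hlev'.symm⟩
        · simp only at h1 h2
          refine ⟨?_, h2⟩
          show y' < H x'
          rcases lt_or_ge x x' with hlt | hge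
          · have e1 : (x + 1) * a ≤ x' * a := Nat.mul_le_mul_right _ hlt
            have e3 : H x ≤ H x' := h.mono hlt.le
            by_contra hy'
            have e2 : y * b ≤ y' * b := Nat.mul_le_mul_right _ (by omega)
            rw [add_mul] at e1
            omega
          · have e1 : x' * a ≤ x * a := Nat.mul_le_mul_right _ hge
            have e3 : H (x' + m) ≤ H (x + m) := h.mono (by omega)
            have e2 : (y' + 1) * b ≤ y * b := Nat.mul_le_mul_right _ (by omega)
            rw [add_mul] at e2
            omega
    rw [this, Set.ncard_insert_of_notMem _ hfU]
    rintro ⟨h1, -⟩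
    simp only at h1
    omega

/-- A translation by two rows and no column removes the two top cells of each column. As `B` is
shorter than `A`, all these cells lie on distinct levels, and each yields one occurrence of the
class. -/
theorem Coded.window_two (hs : StdPair A B V c d) (h : Coded A B H w) (hH : ∀ M, ∃ x, M ≤ H x)
    (hab : B.length < A.length) : ∃ i₀, ∀ i ≥ i₀,
      (i ∈ window w (2 * B.length) (2 * ones B - ((d : ℕ) - (c : ℕ))) ↔
        ∃ x, i + B.length = x * A.length + H x * B.length + (V.length + 1) ∨
          i + 2 * B.length = x * A.length + H x * B.length + (V.length + 1)) := by
  have hA := hs.hA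
  have hB := hs.hB
  have hsq := sq_eq_one_of_ne hs.ne
  obtain ⟨i₀, hi₀⟩ := h.height_sub hs hH 0 2
  have hρ := h.start_strictMono hA
  obtain ⟨x₀, hx₀⟩ := hH 2
  have hnext : ∀ x x', x < x' → x * A.length + H x * B.length + B.length <
      x' * A.length + H x' * B.length := by
    intro x x' hlt
    have e1 : (x + 1) * A.length ≤ x' * A.length := Nat.mul_le_mul_right _ hlt
    have e2 : H x * B.length ≤ H x' * B.length := Nat.mul_le_mul_right _ (h.mono hlt.le)
    rw [add_mul] at e1
    omega
  set a := A.length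
  set b := B.length
  set e := V.length + 1
  refine ⟨i₀ + (x₀ * a + 2 * b + e), fun i hi => ?_⟩
  have hd := hi₀ i (by omega)
  set U := cells (fun x => H (x + 0) - 2) a b e i with hU
  set W := cells H a b e i with hW
  have hfW : W.Finite := cells_finite _ hA hB _ _
  have hUW : U ⊆ W := by
    rintro ⟨x, y⟩ ⟨h1, h2⟩
    simp only [add_zero] at h1 h2
    exact ⟨show y < H x by omega, h2⟩
  have hdiff : ∀ x y, (x, y) ∈ W \ U ↔
      x * a + y * b + e = i ∧ (H x = y + 1 ∨ H x = y + 2) := by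
    intro x y
    simp only [hU, hW, cells, Set.mem_sdiff, Set.mem_ofPred_eq, add_zero]
    omega
  have hsub : (W \ U).Subsingleton := by
    have key : ∀ x y x' y', (x, y) ∈ W \ U → (x', y') ∈ W \ U → ¬ x < x' := by
      intro x y x' y' h1 h2 hlt
      obtain ⟨h3, h4⟩ := (hdiff _ _).1 h1
      obtain ⟨h5, h6⟩ := (hdiff _ _).1 h2
      have := hnext x x' hlt
      rcases h4 with h4 | h4 <;> rcases h6 with h6 | h6 <;> rw [h4, h6] at this <;>
        simp only [add_mul, one_mul] at this <;> omega
    rintro ⟨x, y⟩ h1 ⟨x', y'⟩ h2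
    have hxx : x = x' := by
      have := key _ _ _ _ h1 h2
      have := key _ _ _ _ h2 h1
      omega
    subst hxx
    obtain ⟨h3, -⟩ := (hdiff _ _).1 h1
    obtain ⟨h5, -⟩ := (hdiff _ _).1 h2
    have : y * b = y' * b := by omega
    rw [Nat.eq_of_mul_eq_mul_right hB this]
  have hcard : W.ncard = (W \ U).ncard + U.ncard := (Set.ncard_sdiff_add_ncard_of_subset hUW hfW).symm
  have hmem : i ∈ window w (2 * b) (2 * ones B - ((d : ℕ) - (c : ℕ))) ↔ (W \ U).ncard = 1 := by
    simp only [window, Set.mem_ofPred_eq]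
    rw [hcard] at hd
    push_cast at hd
    simp only [zero_mul, zero_add] at hd
    constructor
    · intro h1
      have h2 : ((d : ℕ) - (c : ℕ) : ℤ) = ((d : ℕ) - (c : ℕ) : ℤ) * (W \ U).ncard := by
        linarith
      have h3 := congrArg (fun t => ((d : ℕ) - (c : ℕ) : ℤ) * t) h2
      rw [← mul_assoc, hsq] at h3
      omega
    · intro h1
      rw [h1] at hd
      push_cast at hd ⊢
      linarith
  rw [hmem, Set.ncard_eq_one]
  constructor
  · rintro ⟨⟨x, y⟩, hxy⟩
    obtain ⟨h1, h2⟩ := (hdiff x y).1 (by rw [hxy]; rfl)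
    refine ⟨x, ?_⟩
    rcases h2 with h2 | h2 <;> rw [h2, add_mul] <;> omega
  · rintro ⟨x, hx⟩
    have hpos : 2 ≤ H x := by
      by_contra h0
      have hxx : x < x₀ := by
        by_contra hxx
        have := h.mono (not_lt.1 hxx)
        omega
      have e1 : x * a ≤ x₀ * a := Nat.mul_le_mul_right _ hxx.le
      have e2 : H x * b ≤ 2 * b := Nat.mul_le_mul_right _ (by omega)
      omega
    have hne : (W \ U).Nonempty := by
      rcases hx with hx | hx
      · obtain ⟨y, hy⟩ : ∃ y, H x = y + 1 := ⟨H x - 1, by omega⟩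
        refine ⟨(x, y), (hdiff _ _).2 ⟨?_, Or.inl hy⟩⟩
        rw [hy, add_mul] at hx
        omega
      · obtain ⟨y, hy⟩ : ∃ y, H x = y + 2 := ⟨H x - 2, by omega⟩
        refine ⟨(x, y), (hdiff _ _).2 ⟨?_, Or.inr hy⟩⟩
        rw [hy, add_mul] at hx
        omega
    obtain ⟨p, hp⟩ := hne
    exact ⟨p, hsub.eq_singleton_of_mem hp⟩

end

/-! ### Index sets detected by abelian classes -/

/-- The set `X` of indices is visible, up to a constant shift of the positions `ρ x`, as the set of
late positions of an abelian class. -/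
def Detected (w : ℕ → Fin 2) (ρ : ℕ → ℕ) (X : Set ℕ) : Prop :=
  ∃ (N : ℕ) (v : ℤ) (k l i₀ : ℕ), ∀ i ≥ i₀, (i ∈ window w N v ↔ ∃ x ∈ X, i + k = ρ x + l)

/-- The distances between consecutive elements of `X` beyond `X₀`, measured by `ρ`. -/
def lens (ρ : ℕ → ℕ) (X : Set ℕ) (X₀ : ℕ) : Set ℕ :=
  {n | ∃ x y, X₀ ≤ x ∧ Consec X x y ∧ n = ρ y - ρ x}

/-- A constant shift of positions does not affect distances, so late distances in a detected set are
lengths of returns. -/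
theorem Good.lens_three {w : ℕ → Fin 2} (hw : Good w) {ρ : ℕ → ℕ} {X : Set ℕ}
    (hX : Detected w ρ X) (hρ : StrictMono ρ) :
    ∃ X₀, ∀ p ∈ lens ρ X X₀, ∀ q ∈ lens ρ X X₀, ∀ r ∈ lens ρ X X₀, ∀ s ∈ lens ρ X X₀,
      p = q ∨ p = r ∨ p = s ∨ q = r ∨ q = s ∨ r = s := by
  obtain ⟨N, v, k, l, i₀, hi₀⟩ := hX
  have key : ∀ p ∈ lens ρ X (i₀ + k), ∃ t, (p, t) ∈ gaps w N v := by
    rintro p ⟨x, y, hx, ⟨hxX, hyX, hlt, hno⟩, rfl⟩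
    have h1 : x ≤ ρ x := hρ.id_le x
    have h2 : ρ x < ρ y := hρ hlt
    have hc : Consec (window w N v) (ρ x + l - k) (ρ y + l - k) := by
      refine ⟨(hi₀ _ (by omega)).2 ⟨x, hxX, by omega⟩, (hi₀ _ (by omega)).2 ⟨y, hyX, by omega⟩,
        by omega, fun j h3 h4 h5 => ?_⟩
      obtain ⟨z, hz, hjz⟩ := (hi₀ _ (by omega)).1 h5
      exact hno z (hρ.lt_iff_lt.1 (by omega)) (hρ.lt_iff_lt.1 (by omega)) hz
    have := hc.mem_gaps
    have e : ρ y + l - k - (ρ x + l - k) = ρ y - ρ x := by omega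
    rw [e] at this
    exact ⟨_, this⟩
  refine ⟨i₀ + k, fun p hp q hq r hr s hs => ?_⟩
  obtain ⟨_, hp⟩ := key p hp
  obtain ⟨_, hq⟩ := key q hq
  obtain ⟨_, hr⟩ := key r hr
  obtain ⟨_, hs⟩ := key s hs
  by_contra hcon
  push Not at hcon
  obtain ⟨h1, h2, h3, h4, h5, h6⟩ := hcon
  exact hw.not_four hp hq hr hs (by simp [h1]) (by simp [h2]) (by simp [h3]) (by simp [h4])
    (by simp [h5]) (by simp [h6])

section

variable {A B V : List (Fin 2)} {c d : Fin 2} {H : ℕ → ℕ} {w : ℕ → Fin 2}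

theorem Coded.detected_max (hs : StdPair A B V c d) (h : Coded A B H w) (hH : ∀ M, ∃ x, M ≤ H x)
    {m C x₁ : ℕ} (hx₁ : ∀ x ≥ x₁, H (x + m) ≤ H x + C + 1) :
    Detected w (fun x => x * A.length + H x * B.length)
      {x | x₁ ≤ x ∧ H (x + m) = H x + C + 1} := by
  obtain ⟨i₀, hi₀⟩ := h.window_max hs hH hx₁
  refine ⟨m * A.length + C * B.length, m * ones A + C * ones B + ((d : ℕ) - (c : ℕ)), 0,
    V.length + 1, i₀, fun i hi => ?_⟩
  rw [hi₀ i hi]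
  constructor
  · rintro ⟨x, h1, h2, h3⟩
    exact ⟨x, ⟨h1, h2⟩, h3⟩
  · rintro ⟨x, ⟨h1, h2⟩, h3⟩
    exact ⟨x, h1, h2, h3⟩

theorem Coded.detected_min (hs : StdPair A B V c d) (h : Coded A B H w) (hH : ∀ M, ∃ x, M ≤ H x)
    {m C x₁ : ℕ} (hx₁ : ∀ x ≥ x₁, H x + C ≤ H (x + m)) :
    Detected w (fun x => x * A.length + H x * B.length)
      {x | x₁ ≤ x ∧ H (x + m) = H x + C} := by
  obtain ⟨i₀, hi₀⟩ := h.window_min hs hH hx₁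
  refine ⟨m * A.length + (C + 1 : ℕ) * B.length,
    m * ones A + (C + 1 : ℕ) * ones B - ((d : ℕ) - (c : ℕ)), B.length, V.length + 1, i₀,
    fun i hi => ?_⟩
  rw [hi₀ i hi]
  constructor
  · rintro ⟨x, h1, h2, h3⟩
    exact ⟨x, ⟨h1, h2⟩, h3⟩
  · rintro ⟨x, ⟨h1, h2⟩, h3⟩
    exact ⟨x, h1, h2, h3⟩

theorem Coded.height_path (h : Coded A B H w) (x : ℕ) :
    ∀ y, (x = 0 ∨ H (x - 1) ≤ y) → y ≤ H x →
      height w (x * A.length + y * B.length) = x * ones A + y * ones B := by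
  induction x with
  | zero =>
    intro y
    induction y with
    | zero => intro _ _; simp [height_zero]
    | succ y ih =>
      intro _ hy
      have h1 := ih (Or.inl rfl) (by omega)
      have h2 := (h.occB 0 y (Or.inl rfl) hy).height_length
      have e : 0 * A.length + (y + 1) * B.length = 0 * A.length + y * B.length + B.length := by ring
      rw [e, h2, h1]
      push_cast
      ring
  | succ x ihx =>
    intro y hy1 hy2
    have hy1' : H x ≤ y := by simpa using hy1
    induction y, hy1' using Nat.le_induction with
    | base =>
      have h1 := ihx (H x) (by
        rcases x with _ | x
        · exact Or.inl rfl
        · exact Or.inr (h.mono (by omega))) le_rfl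
      have h2 := (h.occA x).height_length
      have e : (x + 1) * A.length + H x * B.length = x * A.length + H x * B.length + A.length := by
        ring
      rw [e, h2, h1]
      push_cast
      ring
    | succ y hxy ih =>
      have h1 := ih (Or.inr (by simpa using hxy)) (by omega)
      have h2 := (h.occB (x + 1) y (Or.inr (by simpa using hxy)) hy2).height_length
      have e : (x + 1) * A.length + (y + 1) * B.length =
        (x + 1) * A.length + y * B.length + B.length := by ring
      rw [e, h2, h1]
      push_cast
      ring

theorem Coded.height_start (h : Coded A B H w) (x : ℕ) :
    height w (x * A.length + H x * B.length) = x * ones A + H x * ones B :=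
  h.height_path x (H x) (by
    rcases x with _ | x
    · exact Or.inl rfl
    · exact Or.inr (h.mono (by omega))) le_rfl

theorem Coded.tail (h : Coded A B H w) (x : ℕ) : Coded A B (fun x' => H (x + x') - H x)
    (fun j => w (x * A.length + H x * B.length + j)) := by
  refine ⟨fun y z hyz => Nat.sub_le_sub_right (h.mono (by omega)) _, fun y => ?_,
    fun y z h1 h2 => ?_⟩
  · rw [occursAt_shift]
    convert h.occA (x + y) using 1
    have : H x ≤ H (x + y) := h.mono (by omega)
    obtain ⟨k, hk⟩ := Nat.exists_eq_add_of_le this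
    rw [hk, Nat.add_sub_cancel_left]
    ring
  · rw [occursAt_shift]
    rcases Nat.eq_zero_or_pos y with rfl | hy
    · simp at h2
    · convert h.occB (x + y) (H x + z) ?_ (by omega) using 1
      · ring
      · right
        rcases h1 with h1 | h1
        · omega
        · have e : x + y - 1 = x + (y - 1) := by omega
          rw [e]
          omega

/-- Only the cell `(0, 0)` of the tail could correct this height, and it is not below the graph of
the tail, which starts at 0. The value gives the number of ones of the returns in
`Good.not_single_max`. -/
theorem Coded.height_level (hs : StdPair A B V c d) (h : Coded A B H w) (x : ℕ) :
    height w (x * A.length + H x * B.length + (V.length + 1)) =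
      x * ones A + H x * ones B + powHeight A (V.length + 1) := by
  have h1 := Coded.height_eq hs (V.length + 1) (h.tail x)
  have h2 : cells (fun x' => H (x + x') - H x) A.length B.length (V.length + 1) (V.length + 1) =
      ∅ := by
    ext ⟨y, z⟩
    simp only [cells, Set.mem_ofPred_eq, Set.mem_empty_iff_false, iff_false, not_and]
    intro h3 h4
    have hy : y * A.length = 0 := by omega
    have : y = 0 := by
      rcases Nat.mul_eq_zero.1 hy with h | h
      · exact h
      · exact absurd h hs.hA.ne'
    subst this
    simp at h3
  rw [h2, height_shift, h.height_start] at h1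
  simp at h1
  linarith

/-- The index set of a maximal class does not have a single return. -/
theorem Good.not_single_max (hw : Good w) (hs : StdPair A B V c d) (h : Coded A B H w)
    (hH : ∀ M, ∃ x, M ≤ H x) {m C x₁ : ℕ} (hx₁ : ∀ x ≥ x₁, H (x + m) ≤ H x + C + 1)
    (hinf : ∀ n, ∃ x ≥ n, H (x + m) = H x + C + 1) (X₀ δ η : ℕ)
    (hone : ∀ x y, X₀ ≤ x → Consec {x | x₁ ≤ x ∧ H (x + m) = H x + C + 1} x y →
      y = x + δ ∧ H y = H x + η) : False := by
  have hρ := h.start_strictMono hs.hA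
  obtain ⟨i₀, hi₀⟩ := h.window_max hs hH hx₁
  have hpos : ∀ x, x ≤ x * A.length + H x * B.length := fun x => hρ.id_le x
  obtain ⟨z, hz, hzX⟩ := hinf (i₀ + x₁)
  refine hw.not_one (i₀ := i₀ + X₀ * A.length + H X₀ * B.length + (V.length + 1))
    ⟨z * A.length + H z * B.length + (V.length + 1),
      (hi₀ _ (by have := hpos z; omega)).2 ⟨z, by omega, hzX, rfl⟩⟩
    (δ * A.length + η * B.length, δ * ones A + η * ones B) ?_
  rintro i j hi ⟨hiw, hjw, hlt, hno⟩
  obtain ⟨x, hx, hxX, rfl⟩ := (hi₀ i (by omega)).1 hiw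
  obtain ⟨y, hy, hyX, rfl⟩ := (hi₀ j (by omega)).1 hjw
  have hxy : x < y := hρ.lt_iff_lt.1 (by omega)
  have hX₀ : X₀ ≤ x := hρ.le_iff_le.1 (by omega)
  obtain ⟨h1, h2⟩ := hone x y hX₀ ⟨⟨hx, hxX⟩, ⟨hy, hyX⟩, hxy, fun t h3 h4 h5 => by
    have h6 := hρ h3
    have h7 := hρ h4
    simp only at h6 h7
    exact hno (t * A.length + H t * B.length + (V.length + 1)) (by omega) (by omega)
      ((hi₀ _ (by omega)).2 ⟨t, h5.1, h5.2, rfl⟩)⟩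
  rw [h.height_level hs, h.height_level hs, h2, h1]
  ext
  · simp only [add_mul]
    omega
  · push_cast
    ring

/-- For `m = C = 0` every index attains the minimum, so all indices are detected and neighbouring
ones are at distance `|A| + (H (x + 1) - H x) * |B|`. -/
theorem Good.jumps_three (hw : Good w) (hs : StdPair A B V c d) (h : Coded A B H w)
    (hH : ∀ M, ∃ x, M ≤ H x) : ∃ X₀, ∀ p ≥ X₀, ∀ q ≥ X₀, ∀ r ≥ X₀, ∀ s ≥ X₀,
      H (p + 1) - H p = H (q + 1) - H q ∨ H (p + 1) - H p = H (r + 1) - H r ∨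
      H (p + 1) - H p = H (s + 1) - H s ∨ H (q + 1) - H q = H (r + 1) - H r ∨
      H (q + 1) - H q = H (s + 1) - H s ∨ H (r + 1) - H r = H (s + 1) - H s := by
  have hρ := h.start_strictMono hs.hA
  obtain ⟨X₀, hX₀⟩ := hw.lens_three (h.detected_min hs hH (m := 0) (C := 0) (x₁ := 0)
    (fun x _ => by simp)) hρ
  have hmem : ∀ x ≥ X₀, A.length + (H (x + 1) - H x) * B.length ∈
      lens (fun x => x * A.length + H x * B.length) {x | 0 ≤ x ∧ H (x + 0) = H x + 0} X₀ := by
    intro x hx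
    refine ⟨x, x + 1, hx, ⟨by simp, by simp, by omega, fun k h1 h2 => by omega⟩, ?_⟩
    obtain ⟨k, hk⟩ := Nat.exists_eq_add_of_le (h.mono (Nat.le_succ x))
    rw [Nat.succ_eq_add_one] at hk
    simp only
    rw [hk, Nat.add_sub_cancel_left, add_mul, add_mul]
    omega
  refine ⟨X₀, fun p hp q hq r hr s hs' => ?_⟩
  have hinj : ∀ m n : ℕ, A.length + m * B.length = A.length + n * B.length → m = n := fun m n h =>
    Nat.eq_of_mul_eq_mul_right hs.hB (by omega)
  rcases hX₀ _ (hmem p hp) _ (hmem q hq) _ (hmem r hr) _ (hmem s hs') with h | h | h | h | h | h <;>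
    have := hinj _ _ h <;> tauto

end

/-! ### Few distances force constant run lengths -/

/-- Only three distances between consecutive elements of `X` occur late. -/
def FewLens (ρ : ℕ → ℕ) (X : Set ℕ) : Prop :=
  ∃ X₀, ∀ p ∈ lens ρ X X₀, ∀ q ∈ lens ρ X X₀, ∀ r ∈ lens ρ X X₀, ∀ s ∈ lens ρ X X₀,
      p = q ∨ p = r ∨ p = s ∨ q = r ∨ q = s ∨ r = s

/-- Eventually, the maximal intervals of the complement of `Z` have length `k`. -/
def RunLength (Z : Set ℕ) (k : ℕ) : Prop :=
  ∃ n₀, ∀ x ≥ n₀, x ∈ Z → x + 1 ∉ Z → x + k + 1 ∈ Z ∧ ∀ i, x < i → i < x + k + 1 → i ∉ Z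

theorem exists_next {Z : Set ℕ} (hZ : ∀ n, ∃ j ≥ n, j ∈ Z) (x : ℕ) :
    ∃ n, x + n + 1 ∈ Z ∧ ∀ i, x < i → i < x + n + 1 → i ∉ Z := by
  classical
  have hex : ∃ n, x + n + 1 ∈ Z := by
    obtain ⟨j, hj, hjZ⟩ := hZ (x + 1)
    exact ⟨j - x - 1, by rwa [show x + (j - x - 1) + 1 = j by omega]⟩
  refine ⟨Nat.find hex, Nat.find_spec hex, fun i h1 h2 h3 => ?_⟩
  refine Nat.find_min hex (m := i - x - 1) (by omega) ?_
  rwa [show x + (i - x - 1) + 1 = i by omega]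

theorem exists_last {Z : Set ℕ} {p x : ℕ} (hp : p ∈ Z) (hpx : p ≤ x) :
    ∃ q, p ≤ q ∧ q ≤ x ∧ q ∈ Z ∧ ∀ i, q < i → i ≤ x → i ∉ Z := by
  induction x, hpx using Nat.le_induction with
  | base => exact ⟨p, le_rfl, le_rfl, hp, fun i h1 h2 => by omega⟩
  | succ x hx ih =>
    by_cases h : x + 1 ∈ Z
    · exact ⟨x + 1, by omega, le_rfl, h, fun i h1 h2 => by omega⟩
    · obtain ⟨q, h1, h2, h3, h4⟩ := ih
      refine ⟨q, h1, by omega, h3, fun i h5 h6 => ?_⟩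
      rcases Nat.lt_or_ge x i with h7 | h7
      · rwa [show i = x + 1 by omega]
      · exact h4 i h5 h7

theorem exists_exit {Z : Set ℕ} (hZ : ∀ n, ∃ j ≥ n, j ∈ Z) (hZc : ∀ n, ∃ j ≥ n, j ∉ Z) (n : ℕ) :
    ∃ j ≥ n, j ∈ Z ∧ j + 1 ∉ Z := by
  obtain ⟨p, hp, hpZ⟩ := hZ n
  obtain ⟨x, hx, hxZ⟩ := hZc p
  obtain ⟨q, h1, h2, h3, h4⟩ := exists_last hpZ hx
  have hqx : q ≠ x := fun h => hxZ (h ▸ h3)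
  exact ⟨q, by omega, h3, h4 _ (by omega) (by omega)⟩

/-- If the runs of `Z` and of its complement have constant lengths `l` and `k`, then the starts of
the runs of `Z` have a constant distance. -/
theorem RunLength.starts {Z : Set ℕ} {k l : ℕ} (hk : RunLength Z k) (hl : RunLength Zᶜ l)
    (hk1 : 1 ≤ k) (hl1 : 1 ≤ l) (hZc : ∀ n, ∃ j ≥ n, j ∉ Z) :
    ∃ J, ∀ j ≥ J, (∀ i < l, j + i ∈ Z) → (∀ i < l, j + (k + l) + i ∈ Z) ∧
      (∀ i, j + l ≤ i → i < j + (k + l) → i ∉ Z) ∧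
      ∀ t, j < t → t < j + (k + l) → ¬ ∀ i < l, t + i ∈ Z := by
  obtain ⟨n₁, h₁⟩ := hk
  obtain ⟨n₂, h₂⟩ := hl
  simp only [Set.mem_compl_iff, not_not] at h₂
  obtain ⟨p, hp, hpZ⟩ := hZc (n₁ + n₂)
  refine ⟨p, fun j hj hjZ => ?_⟩
  -- Otherwise the run of `Z` through `j, …, j + l`, counted from the last `q < j` outside `Z`,
  -- would be longer than `l`.
  have hend : j + l ∉ Z := by
    intro hcon
    obtain ⟨q, h3, h4, h5, h6⟩ := exists_last (Z := Zᶜ) hpZ hj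
    simp only [Set.mem_compl_iff, not_not] at h5 h6
    have hq : q ≠ j := fun h => h5 (h ▸ by simpa using hjZ 0 hl1)
    obtain ⟨h7, -⟩ := h₂ q (by omega) h5 (h6 _ (by omega) (by omega))
    rcases Nat.lt_or_ge j (q + l + 1) with h | h
    · rcases Nat.lt_or_ge (q + l + 1 - j) l with h8 | h8
      · exact h7 (by simpa [Nat.add_sub_cancel' h.le] using hjZ _ h8)
      · exact h7 (by rwa [show q + l + 1 = j + l by omega])
    · exact h7 (h6 _ (by omega) h)
  obtain ⟨h3, h4⟩ := h₁ (j + (l - 1)) (by omega) (hjZ _ (by omega))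
    (by rwa [show j + (l - 1) + 1 = j + l by omega])
  have e3 : j + (l - 1) + k + 1 = j + (k + l) := by omega
  rw [e3] at h3 h4
  obtain ⟨h5, h6⟩ := h₂ (j + (k + l) - 1) (by omega) (h4 _ (by omega) (by omega))
    (by rwa [show j + (k + l) - 1 + 1 = j + (k + l) by omega])
  refine ⟨fun i hi => h6 _ (by omega) (by omega), fun i h7 h8 => h4 i (by omega) h8,
    fun t h7 h8 h9 => ?_⟩
  rcases Nat.lt_or_ge (j + l) t with h | h
  · exact h4 t (by omega) h8 (by simpa using h9 0 hl1)
  · refine hend ?_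
    have := h9 (j + l - t) (by omega)
    rwa [Nat.add_sub_cancel' h] at this

theorem div_block {a j r : ℕ} (hr : r < a) : (j * a + r) / a = j := by
  rw [add_comm, Nat.add_mul_div_right _ _ (by omega), Nat.div_eq_of_lt hr, zero_add]

theorem div_block_zero {a j : ℕ} (ha : 0 < a) : j * a / a = j := Nat.mul_div_cancel _ ha

section

variable {σ : ℕ → ℕ} {a₀ a b s t n₀ : ℕ} {Z : Set ℕ}

theorem sum_outside (ht : ∀ j ≥ n₀, j ∉ Z → σ (j + 1) = σ j + t) {x : ℕ} (hx : n₀ ≤ x) {n : ℕ}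
    (hn : ∀ i, x < i → i < x + n + 1 → i ∉ Z) : σ (x + n + 1) = σ (x + 1) + n * t := by
  induction n with
  | zero => simp
  | succ n ih =>
    rw [show x + (n + 1) + 1 = x + n + 1 + 1 by ring, ht _ (by omega) (hn _ (by omega) (by omega)),
      ih fun i h1 h2 => hn i h1 (by omega)]
    ring

/-- Two neighbouring columns of the same group are at distance `a`; this takes up one of the three
available distances. -/
theorem mem_lens_inner (hb : 2 ≤ a₀) {P : ℕ → Prop} (hP : ∀ n, ∃ j ≥ n, P j) (X₀ : ℕ) :
    a ∈ lens (fun x => x * a + σ (x / a₀) * b) {x | P (x / a₀)} X₀ := by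
  obtain ⟨j, hj, hPj⟩ := hP X₀
  have e0 : j * a₀ / a₀ = j := div_block_zero (by omega)
  have e1 : (j * a₀ + 1) / a₀ = j := div_block (by omega)
  refine ⟨j * a₀, j * a₀ + 1, ?_, ⟨?_, ?_, by omega, fun k h1 h2 => by omega⟩, ?_⟩
  · exact hj.trans (Nat.le_mul_of_pos_right _ (by omega))
  · simpa [e0] using hPj
  · simpa [e1] using hPj
  · simp only [e0, e1, add_mul, one_mul]
    omega

/-- The distance from the last column of group `j` to the first column of group `j + n + 1`, which
is `n * a₀ + 1` columns further right and `η` rows higher. -/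
theorem mem_lens_outer (ha₀ : 0 < a₀) {P : ℕ → Prop} {X₀ j n : ℕ} (hj : X₀ ≤ j) (h1 : P j)
    (h2 : P (j + n + 1)) (h3 : ∀ i, j < i → i < j + n + 1 → ¬ P i) {η : ℕ}
    (hη : σ (j + n + 1) = σ j + η) :
    (n * a₀ + 1) * a + η * b ∈ lens (fun x => x * a + σ (x / a₀) * b) {x | P (x / a₀)} X₀ := by
  obtain ⟨r, rfl⟩ : ∃ r, a₀ = r + 1 := ⟨a₀ - 1, by omega⟩
  have e0 : (j * (r + 1) + r) / (r + 1) = j := div_block (by omega)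
  have e1 : (j + n + 1) * (r + 1) / (r + 1) = j + n + 1 := div_block_zero (by omega)
  have e2 : (j + n + 1) * (r + 1) = j * (r + 1) + r + (n * (r + 1) + 1) := by ring
  refine ⟨j * (r + 1) + r, (j + n + 1) * (r + 1), ?_, ⟨?_, ?_, by omega, fun k h4 h5 h6 => ?_⟩, ?_⟩
  · have : j ≤ j * (r + 1) := Nat.le_mul_of_pos_right _ (by omega)
    omega
  · simpa [e0] using h1
  · simpa [e1] using h2
  · refine h3 (k / (r + 1)) ?_ ?_ h6
    · rw [Nat.lt_iff_add_one_le, Nat.le_div_iff_mul_le (by omega), add_mul]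
      omega
    · rw [Nat.div_lt_iff_lt_mul (by omega)]
      omega
  · simp only [e0, e1]
    rw [hη, e2, add_mul (j * (r + 1) + r), add_mul (σ j)]
    omega

/-- The distance between successive groups in `Z` grows with the number `n` of groups between them,
and the distance `a` inside a group takes one of the three values. If neighbours in `Z` recur, `n =
0` takes the second value and a single positive `n` remains. If not, the set of groups in `Z` or
just before `Z` is used, and the passage from a group before `Z` into `Z` takes the second value. -/
theorem runLength_of_fewLens (hσ : StrictMono σ) (ha₀ : 2 ≤ a₀) (ha : 0 < a) (hb : 0 < b)
    (hst : s ≠ t) (hs : ∀ j ≥ n₀, j ∈ Z → σ (j + 1) = σ j + s)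
    (ht : ∀ j ≥ n₀, j ∉ Z → σ (j + 1) = σ j + t)
    (hZ : ∀ n, ∃ j ≥ n, j ∈ Z) (hZc : ∀ n, ∃ j ≥ n, j ∉ Z)
    (h1 : FewLens (fun x => x * a + σ (x / a₀) * b) {x | x / a₀ ∈ Z})
    (h2 : ∀ n, (∀ j ≥ n, ¬ (j ∈ Z ∧ j + 1 ∈ Z)) →
      FewLens (fun x => x * a + σ (x / a₀) * b) {x | x / a₀ ∈ Z ∨ x / a₀ + 1 ∈ Z}) :
    ∃ k ≥ 1, RunLength Z k := by
  have hs1 : 0 < s := by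
    obtain ⟨j, hj, hjZ⟩ := hZ n₀
    have := hs j hj hjZ
    have := hσ (Nat.lt_add_one j)
    omega
  have ht1 : 0 < t := by
    obtain ⟨j, hj, hjZ⟩ := hZc n₀
    have := ht j hj hjZ
    have := hσ (Nat.lt_add_one j)
    omega
  have hlt : ∀ (m n s' : ℕ), m < n →
      (m * a₀ + 1) * a + (s' + m * t) * b < (n * a₀ + 1) * a + (s' + n * t) * b := by
    intro m n s' hmn
    have h3 : m * a₀ + 1 < n * a₀ + 1 := by
      have := Nat.mul_lt_mul_of_pos_right hmn (show 0 < a₀ by omega)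
      omega
    have h4 : s' + m * t ≤ s' + n * t := by
      have := Nat.mul_le_mul_right t hmn.le
      omega
    exact add_lt_add_of_lt_of_le (Nat.mul_lt_mul_of_pos_right h3 ha) (Nat.mul_le_mul_right _ h4)
  have hinj : ∀ m n s' : ℕ, (m * a₀ + 1) * a + (s' + m * t) * b =
      (n * a₀ + 1) * a + (s' + n * t) * b → m = n := by
    intro m n s' h
    rcases lt_trichotomy m n with h3 | h3 | h3
    · have := hlt m n s' h3
      omega
    · exact h3
    · have := hlt n m s' h3
      omega
  have hgt : ∀ m, a < (m * a₀ + 1) * a + (s + m * t) * b := by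
    intro m
    have h3 : 1 * a ≤ (m * a₀ + 1) * a := Nat.mul_le_mul_right _ (by omega)
    have h4 : 0 < (s + m * t) * b := Nat.mul_pos (by omega) hb
    omega
  obtain ⟨X₁, hX₁⟩ := h1
  have hmem : ∀ j ≥ X₁ + n₀, j ∈ Z → ∀ n, j + n + 1 ∈ Z → (∀ i, j < i → i < j + n + 1 → i ∉ Z) →
      (n * a₀ + 1) * a + (s + n * t) * b ∈
        lens (fun x => x * a + σ (x / a₀) * b) {x | x / a₀ ∈ Z} X₁ := by
    intro j hj hjZ n h3 h4
    refine mem_lens_outer (P := fun j => j ∈ Z) (by omega) (by omega) hjZ h3 h4 ?_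
    rw [sum_outside ht (by omega) h4, hs j (by omega) hjZ]
    ring
  have hin := mem_lens_inner (σ := σ) (a := a) (b := b) ha₀ (P := fun j => j ∈ Z) hZ X₁
  by_cases hZZ : ∃ n, ∀ j ≥ n, ¬ (j ∈ Z ∧ j + 1 ∈ Z)
  · obtain ⟨n₁, hn₁⟩ := hZZ
    obtain ⟨X₂, hX₂⟩ := h2 n₁ hn₁
    have hin2 := mem_lens_inner (σ := σ) (a := a) (b := b) ha₀ (P := fun j => j ∈ Z ∨ j + 1 ∈ Z)
      (fun n => (hZ n).imp fun j h => ⟨h.1, Or.inl h.2⟩) X₂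
    have hmem2 : ∀ j ≥ X₂ + n₀ + n₁, j ∈ Z → ∀ n, j + n + 1 ∈ Z →
        (∀ i, j < i → i < j + n + 1 → i ∉ Z) → 1 ≤ n ∧
        ((n - 1) * a₀ + 1) * a + (s + (n - 1) * t) * b ∈
        lens (fun x => x * a + σ (x / a₀) * b) {x | x / a₀ ∈ Z ∨ x / a₀ + 1 ∈ Z} X₂ := by
      intro j hj hjZ n h3 h4
      have hn : 1 ≤ n := by
        rcases Nat.eq_zero_or_pos n with rfl | h
        · exact absurd ⟨hjZ, h3⟩ (hn₁ j (by omega))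
        · exact h
      obtain ⟨n, rfl⟩ : ∃ n', n = n' + 1 := ⟨n - 1, by omega⟩
      refine ⟨hn, ?_⟩
      rw [Nat.add_sub_cancel]
      refine mem_lens_outer (P := fun j => j ∈ Z ∨ j + 1 ∈ Z) (by omega) (by omega) (Or.inl hjZ)
        (Or.inr h3) (fun i h5 h6 h7 => ?_) ?_
      · rcases h7 with h7 | h7
        · exact h4 i h5 (by omega) h7
        · exact h4 _ (by omega) (by omega) h7
      · rw [sum_outside ht (by omega) fun i h5 h6 => h4 i h5 (by omega), hs j (by omega) hjZ]
        ring
    have hmid : (0 * a₀ + 1) * a + t * b ∈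
        lens (fun x => x * a + σ (x / a₀) * b) {x | x / a₀ ∈ Z ∨ x / a₀ + 1 ∈ Z} X₂ := by
      obtain ⟨j, hj, h3, h4⟩ := exists_exit (Z := Zᶜ) hZc (fun n => (hZ n).imp fun j h =>
        ⟨h.1, fun h' => h' h.2⟩) (X₂ + n₀)
      simp only [Set.mem_compl_iff, not_not] at h3 h4
      refine mem_lens_outer (n := 0) (P := fun j => j ∈ Z ∨ j + 1 ∈ Z) (by omega)
        (show X₂ ≤ j by omega) (Or.inr h4) (Or.inl h4) (fun i h5 h6 => by omega)
        (ht j (by omega) h3)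
    obtain ⟨x, hx, hxZ⟩ := hZ (X₂ + n₀ + n₁)
    obtain ⟨k, hk1, hk2⟩ := exists_next hZ x
    obtain ⟨hk, hkm⟩ := hmem2 x hx hxZ k hk1 hk2
    refine ⟨k, hk, X₂ + n₀ + n₁, fun y hy hyZ _ => ?_⟩
    obtain ⟨n, hn1, hn2⟩ := exists_next hZ y
    obtain ⟨hn, hnm⟩ := hmem2 y hy hyZ n hn1 hn2
    have hne : ∀ m, (m * a₀ + 1) * a + (s + m * t) * b ≠ (0 * a₀ + 1) * a + t * b := by
      intro m h
      rcases Nat.eq_zero_or_pos m with rfl | hm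
      · have : s * b = t * b := by
          simp only [zero_mul, zero_add, add_zero] at h
          omega
        exact hst (Nat.eq_of_mul_eq_mul_right hb this)
      · have h3 : (0 * a₀ + 1) * a < (m * a₀ + 1) * a := by
          apply Nat.mul_lt_mul_of_pos_right _ ha
          have : 0 < m * a₀ := by positivity
          omega
        have h4 : t * b ≤ (s + m * t) * b := by
          apply Nat.mul_le_mul_right
          have : 1 * t ≤ m * t := Nat.mul_le_mul_right _ hm
          omega
        omega
    have hta : 0 < t * b := Nat.mul_pos ht1 hb
    have hkn : k = n := by
      -- Of the distances `a`, `a + t * b` and those given by `k` and `n`, only the last two can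
      -- coincide.
      rcases hX₂ _ hin2 _ hmid _ hkm _ hnm with h | h | h | h | h | h
      · simp only [zero_mul, zero_add, one_mul] at h
        omega
      · have := hgt (k - 1)
        omega
      · have := hgt (n - 1)
        omega
      · exact absurd h.symm (hne _)
      · exact absurd h.symm (hne _)
      · have := hinj _ _ _ h
        omega
    subst hkn
    exact ⟨hn1, hn2⟩
  · push Not at hZZ
    obtain ⟨j, hj, hj1, hj2⟩ := hZZ (X₁ + n₀)
    have hm0 := hmem j hj hj1 0 hj2 (fun i h3 h4 => by omega)
    obtain ⟨x, hx, hxZ, hxZ'⟩ := exists_exit hZ hZc (X₁ + n₀)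
    obtain ⟨k, hk1, hk2⟩ := exists_next hZ x
    have hkm := hmem x hx hxZ k hk1 hk2
    have hk0 : k ≠ 0 := by
      rintro rfl
      exact hxZ' hk1
    refine ⟨k, by omega, X₁ + n₀, fun y hy hyZ hyZ' => ?_⟩
    obtain ⟨n, hn1, hn2⟩ := exists_next hZ y
    have hnm := hmem y hy hyZ n hn1 hn2
    have hn0 : n ≠ 0 := by
      rintro rfl
      exact hyZ' hn1
    have hkn : k = n := by
      rcases hX₁ _ hin _ hm0 _ hkm _ hnm with h | h | h | h | h | h
      · have := hgt 0
        omega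
      · have := hgt k
        omega
      · have := hgt n
        omega
      · exact absurd (hinj _ _ _ h).symm hk0
      · exact absurd (hinj _ _ _ h).symm hn0
      · exact hinj _ _ _ h
    subst hkn
    exact ⟨hn1, hn2⟩

end

theorem FewLens.congr {ρ : ℕ → ℕ} {X Y : Set ℕ} (h : FewLens ρ X) {n : ℕ}
    (hXY : ∀ x ≥ n, (x ∈ X ↔ x ∈ Y)) : FewLens ρ Y := by
  obtain ⟨X₀, hX₀⟩ := h
  have key : ∀ p ∈ lens ρ Y (X₀ + n), p ∈ lens ρ X X₀ := by
    rintro p ⟨x, y, h1, ⟨h2, h3, h4, h5⟩, rfl⟩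
    exact ⟨x, y, by omega, ⟨(hXY x (by omega)).2 h2, (hXY y (by omega)).2 h3, h4,
      fun k h6 h7 h8 => h5 k h6 h7 ((hXY k (by omega)).1 h8)⟩, rfl⟩
  exact ⟨X₀ + n, fun p hp q hq r hr s hs =>
    hX₀ p (key p hp) q (key q hq) r (key r hr) s (key s hs)⟩

theorem le_div_of_mul_le' {a x n : ℕ} (ha : 0 < a) (h : n * a ≤ x) : n ≤ x / a :=
  (Nat.le_div_iff_mul_le ha).2 h

/-- The width `(l - 1) * a + 1` is the smallest that can meet `l` group boundaries, and it does so
only from the last column of a group. -/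
theorem block_cases {a : ℕ} (ha : 0 < a) (x l : ℕ) (hl : 1 ≤ l) :
    (x = x / a * a + (a - 1) ∧ (x + ((l - 1) * a + 1)) / a = x / a + l) ∨
      (x + ((l - 1) * a + 1)) / a = x / a + (l - 1) := by
  obtain ⟨l, rfl⟩ : ∃ l', l = l' + 1 := ⟨l - 1, by omega⟩
  have h1 := Nat.div_add_mod x a
  have h2 := Nat.mod_lt x ha
  rw [Nat.add_sub_cancel]
  rw [mul_comm] at h1
  set j := x / a
  set r := x % a
  by_cases h : r + 1 = a
  · left
    refine ⟨by omega, ?_⟩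
    have : x + (l * a + 1) = (j + (l + 1)) * a := by
      rw [add_mul, add_mul]
      omega
    rw [this, div_block_zero ha]
  · right
    have : x + (l * a + 1) = (j + l) * a + (r + 1) := by
      rw [add_mul]
      omega
    rw [this, div_block (by omega)]

theorem sum_le_of_steps {σ : ℕ → ℕ} {s t n₀ : ℕ} (hts : t < s)
    (hst : ∀ j ≥ n₀, σ (j + 1) = σ j + t ∨ σ (j + 1) = σ j + s) {j : ℕ} (hj : n₀ ≤ j) (n : ℕ) :
    σ (j + n) ≤ σ j + n * s ∧
      (σ (j + n) = σ j + n * s ↔ ∀ i < n, σ (j + i + 1) = σ (j + i) + s) := by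
  induction n with
  | zero => simp
  | succ n ih =>
    have h1 := hst (j + n) (by omega)
    rw [← add_assoc, add_mul, one_mul]
    refine ⟨by omega, ?_⟩
    constructor
    · intro h i hi
      rcases Nat.lt_succ_iff_lt_or_eq.1 hi with h2 | rfl
      · exact ih.2.1 (by omega) i h2
      · omega
    · intro h
      have h2 := ih.2.2 fun i hi => h i (by omega)
      have h3 := h n (by omega)
      omega

/-! ### Codings whose exponents are multiples of a fixed number -/

section

variable {A B V : List (Fin 2)} {c d : Fin 2} {w : ℕ → Fin 2} {σ : ℕ → ℕ} {a₀ : ℕ}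

theorem unbounded_of_blocks (hσ : StrictMono σ) (ha : 0 < a₀) (M : ℕ) : ∃ x, M ≤ σ (x / a₀) :=
  ⟨M * a₀, by rw [div_block_zero ha]; exact hσ.id_le M⟩

/-- A constant step makes the coding periodic: the maximal one-column increment then occurs once per
group, at its last column, always with the same return. -/
theorem Good.not_const_blocks (hw : Good w) (hs : StdPair A B V c d)
    (h : Coded A B (fun x => σ (x / a₀)) w) (hσ : StrictMono σ) (ha : 0 < a₀) (s n₀ : ℕ)
    (hconst : ∀ j ≥ n₀, σ (j + 1) = σ j + s) : False := by
  have hs1 : 0 < s := by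
    have := hconst n₀ le_rfl
    have := hσ (Nat.lt_add_one n₀)
    omega
  have hdiv : ∀ x, (x = x / a₀ * a₀ + (a₀ - 1) ∧ (x + 1) / a₀ = x / a₀ + 1) ∨
      (x + 1) / a₀ = x / a₀ := by
    intro x
    simpa using block_cases ha x 1 le_rfl
  have hlast : ∀ j, (j * a₀ + (a₀ - 1)) / a₀ = j := fun j => div_block (by omega)
  have hlast' : ∀ j, (j * a₀ + (a₀ - 1) + 1) / a₀ = j + 1 := fun j => by
    rw [show j * a₀ + (a₀ - 1) + 1 = (j + 1) * a₀ by rw [add_mul]; omega, div_block_zero ha]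
  have hsub : s - 1 + 1 = s := by omega
  refine hw.not_single_max hs h (unbounded_of_blocks hσ ha) (m := 1) (C := s - 1)
    (x₁ := n₀ * a₀) (fun x hx => ?_) (fun n => ?_) 0 a₀ s (fun x y _ hxy => ?_)
  · have h1 := le_div_of_mul_le' ha hx
    have h2 := hconst _ h1
    rcases hdiv x with ⟨-, h3⟩ | h3 <;> rw [h3] <;> omega
  · refine ⟨(n + n₀) * a₀ + (a₀ - 1), ?_, ?_⟩
    · have : n + n₀ ≤ (n + n₀) * a₀ := Nat.le_mul_of_pos_right _ ha
      omega
    · simp only [hlast, hlast']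
      have := hconst (n + n₀) (by omega)
      omega
  · obtain ⟨⟨hx1, hx2⟩, ⟨hy1, hy2⟩, hlt, hno⟩ := hxy
    have hx3 : x = x / a₀ * a₀ + (a₀ - 1) := by
      rcases hdiv x with ⟨h3, -⟩ | h3
      · exact h3
      · rw [h3] at hx2
        omega
    have hy3 : y = y / a₀ * a₀ + (a₀ - 1) := by
      rcases hdiv y with ⟨h3, -⟩ | h3
      · exact h3
      · rw [h3] at hy2
        omega
    have hj := le_div_of_mul_le' ha hx1
    have hj' := le_div_of_mul_le' ha hy1
    generalize x / a₀ = j at *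
    generalize y / a₀ = j' at *
    subst hx3 hy3
    have h4 : j < j' := by
      by_contra hcon
      have := Nat.mul_le_mul_right a₀ (not_lt.1 hcon)
      omega
    have h5 : j' = j + 1 := by
      by_contra hcon
      have h6 : (j + 2) * a₀ ≤ j' * a₀ := Nat.mul_le_mul_right a₀ (by omega)
      refine hno ((j + 1) * a₀ + (a₀ - 1)) ?_ ?_ ⟨?_, ?_⟩
      · rw [add_mul]
        omega
      · rw [add_mul] at h6 ⊢
        omega
      · exact (Nat.mul_le_mul_right a₀ (show n₀ ≤ j + 1 by omega)).trans (by omega)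
      · rw [hlast, hlast']
        have := hconst (j + 1) (by omega)
        omega
    subst h5
    refine ⟨?_, hconst j hj⟩
    rw [add_mul]
    omega

/-- The runs of the larger step and those of the smaller one both have constant length, so the steps
are eventually periodic. The starts of the runs of the larger step then form a class with a single
return. -/
theorem Good.not_two_blocks (hw : Good w) (hs : StdPair A B V c d)
    (h : Coded A B (fun x => σ (x / a₀)) w) (hσ : StrictMono σ) (ha : 2 ≤ a₀) {s t n₀ : ℕ}
    (hts : t < s) (hst : ∀ j ≥ n₀, σ (j + 1) = σ j + t ∨ σ (j + 1) = σ j + s)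
    (hsf : ∀ n, ∃ j ≥ n, σ (j + 1) = σ j + s) (htf : ∀ n, ∃ j ≥ n, σ (j + 1) = σ j + t) :
    False := by
  have ha0 : 0 < a₀ := by omega
  have hρ := h.start_strictMono hs.hA
  have hH := unbounded_of_blocks hσ ha0
  have ht1 : 0 < t := by
    obtain ⟨j, -, hj⟩ := htf 0
    have := hσ (Nat.lt_add_one j)
    omega
  have hadd1 : ∀ x, (x + a₀) / a₀ = x / a₀ + 1 := fun x => Nat.add_div_right x ha0
  have hadd2 : ∀ x, (x + 2 * a₀) / a₀ = x / a₀ + 1 + 1 := fun x => Nat.add_mul_div_right x 2 ha0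
  set Z : Set ℕ := {j | σ (j + 1) = σ j + s} with hZdef
  have hZ : ∀ j, j ∈ Z ↔ σ (j + 1) = σ j + s := fun j => Iff.rfl
  have hZs : ∀ j ≥ n₀, j ∈ Z → σ (j + 1) = σ j + s := fun j _ h => h
  have hZt : ∀ j ≥ n₀, j ∉ Z → σ (j + 1) = σ j + t := fun j hj h =>
    (hst j hj).resolve_right h
  have hZt' : ∀ j, σ (j + 1) = σ j + t → j ∉ Z := fun j h h' => by
    have := (hZ j).1 h'
    omega
  have hsf' : ∀ n, ∃ j ≥ n, j ∈ Z := hsf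
  have htf' : ∀ n, ∃ j ≥ n, j ∉ Z := fun n => (htf n).imp fun j h => ⟨h.1, hZt' j h.2⟩
  have hle : ∀ n x, x ≥ n * a₀ → n ≤ x / a₀ := fun n x hx => le_div_of_mul_le' ha0 hx
  -- Increments over one group are maximal on `Z`. If `Z` eventually has no neighbours, increments
  -- over two groups are at most `s + t`, with equality when one of the two groups is in `Z`.
  obtain ⟨k, hk1, hk⟩ : ∃ k ≥ 1, RunLength Z k := by
    refine runLength_of_fewLens hσ ha hs.hA hs.hB hts.ne' hZs hZt hsf' htf' ?_ ?_
    · refine FewLens.congr (hw.lens_three (h.detected_max hs hH (m := a₀) (C := s - 1)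
        (x₁ := n₀ * a₀) fun x hx => ?_) hρ) (n := n₀ * a₀) fun x hx => ?_
      · have := hst _ (hle _ _ hx)
        simp only [hadd1]
        omega
      · simp only [Set.mem_ofPred_eq, hadd1, hZ]
        omega
    · intro n hn
      refine FewLens.congr (hw.lens_three (h.detected_max hs hH (m := 2 * a₀) (C := s + t - 1)
        (x₁ := (n₀ + n) * a₀) fun x hx => ?_) hρ) (n := (n₀ + n) * a₀) fun x hx => ?_
      · have h1 := hle _ _ hx
        have h2 := hst (x / a₀) (by omega)
        have h3 := hst (x / a₀ + 1) (by omega)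
        have h4 := hn (x / a₀) (by omega)
        simp only [hZ] at h4
        simp only [hadd2]
        omega
      · have h1 := hle _ _ hx
        have h2 := hst (x / a₀) (by omega)
        have h3 := hst (x / a₀ + 1) (by omega)
        have h4 := hn (x / a₀) (by omega)
        simp only [hZ] at h4
        simp only [Set.mem_ofPred_eq, hadd2, hZ]
        omega
  obtain ⟨l, hl1, hl⟩ : ∃ l ≥ 1, RunLength Zᶜ l := by
    refine runLength_of_fewLens hσ ha hs.hA hs.hB hts.ne hZt (fun j hj h => ?_) htf' ?_ ?_ ?_
    · exact not_not.1 h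
    · exact fun n => (hsf' n).imp fun j h => ⟨h.1, fun h' => h' h.2⟩
    · refine FewLens.congr (hw.lens_three (h.detected_min hs hH (m := a₀) (C := t)
        (x₁ := n₀ * a₀) fun x hx => ?_) hρ) (n := n₀ * a₀) fun x hx => ?_
      · have := hst _ (hle _ _ hx)
        simp only [hadd1]
        omega
      · have := hst _ (hle _ _ hx)
        simp only [Set.mem_ofPred_eq, hadd1, Set.mem_compl_iff, hZ]
        omega
    · intro n hn
      refine FewLens.congr (hw.lens_three (h.detected_min hs hH (m := 2 * a₀) (C := s + t)
        (x₁ := (n₀ + n) * a₀) fun x hx => ?_) hρ) (n := (n₀ + n) * a₀) fun x hx => ?_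
      · have h1 := hle _ _ hx
        have h2 := hst (x / a₀) (by omega)
        have h3 := hst (x / a₀ + 1) (by omega)
        have h4 := hn (x / a₀) (by omega)
        simp only [Set.mem_compl_iff, hZ] at h4
        simp only [hadd2]
        omega
      · have h1 := hle _ _ hx
        have h2 := hst (x / a₀) (by omega)
        have h3 := hst (x / a₀ + 1) (by omega)
        have h4 := hn (x / a₀) (by omega)
        simp only [Set.mem_compl_iff, hZ] at h4
        simp only [Set.mem_ofPred_eq, hadd2, Set.mem_compl_iff, hZ]
        omega
  obtain ⟨J, hJ⟩ := hk.starts hl hk1 hl1 htf'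
  have hls : l * s - 1 + 1 = l * s := by
    have : 0 < l * s := Nat.mul_pos (by omega) (by omega)
    omega
  have hls' : (l - 1) * s < l * s := Nat.mul_lt_mul_of_pos_right (by omega) (by omega)
  have hT : ∀ x, n₀ * a₀ ≤ x → (σ ((x + ((l - 1) * a₀ + 1)) / a₀) ≤ σ (x / a₀) + l * s ∧
      (σ ((x + ((l - 1) * a₀ + 1)) / a₀) = σ (x / a₀) + l * s ↔
        x = x / a₀ * a₀ + (a₀ - 1) ∧ ∀ i < l, x / a₀ + i ∈ Z)) := by
    intro x hx
    have h1 := sum_le_of_steps hts hst (hle _ _ hx) l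
    have h2 := sum_le_of_steps hts hst (hle _ _ hx) (l - 1)
    rcases block_cases ha0 x l hl1 with ⟨h3, h4⟩ | h4
    · rw [h4]
      exact ⟨h1.1, h1.2.trans ⟨fun h => ⟨h3, h⟩, fun h => h.2⟩⟩
    · rw [h4]
      refine ⟨by omega, ⟨fun h => by omega, fun ⟨h5, h6⟩ => ?_⟩⟩
      exfalso
      have h7 : x + ((l - 1) * a₀ + 1) = (x / a₀ + l) * a₀ := by
        obtain ⟨l, rfl⟩ : ∃ l', l = l' + 1 := ⟨l - 1, by omega⟩
        rw [Nat.add_sub_cancel, add_mul, add_mul]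
        omega
      rw [h7, div_block_zero ha0] at h4
      omega
  have hlast : ∀ j, (j * a₀ + (a₀ - 1)) / a₀ = j := fun j => div_block (by omega)
  -- This width meets `l` boundaries only from the last column of a group, and the increment `l * s`
  -- needs `l` larger steps in a row: this singles out the starts of the runs of `Z`.
  refine hw.not_single_max hs h hH (m := (l - 1) * a₀ + 1) (C := l * s - 1)
    (x₁ := n₀ * a₀) (fun x hx => ?_) (fun n => ?_) ((J + n₀) * a₀) ((k + l) * a₀) (l * s + k * t)
    (fun x y hX hxy => ?_)
  · have := (hT x hx).1
    omega
  · obtain ⟨n₁, hn₁⟩ := hl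
    obtain ⟨j, hj, h1, h2⟩ := exists_exit (Z := Zᶜ) htf' (fun n => (hsf' n).imp fun j h =>
      ⟨h.1, fun h' => h' h.2⟩) (n + n₀ + n₁)
    obtain ⟨-, h3⟩ := hn₁ j (by omega) h1 h2
    have h4 : n + n₀ ≤ (n + n₀) * a₀ := Nat.le_mul_of_pos_right _ ha0
    have h5 : (n + n₀) * a₀ ≤ (j + 1) * a₀ := Nat.mul_le_mul_right _ (by omega)
    have h6 : n₀ * a₀ ≤ (n + n₀) * a₀ := Nat.mul_le_mul_right _ (by omega)
    refine ⟨(j + 1) * a₀ + (a₀ - 1), by omega, ?_⟩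
    have h7 := ((hT ((j + 1) * a₀ + (a₀ - 1)) (by omega)).2).2 (by
      rw [hlast]
      refine ⟨rfl, fun i hi => ?_⟩
      have := h3 (j + 1 + i) (by omega) (by omega)
      simpa using this)
    omega
  · obtain ⟨⟨hx1, hx2⟩, ⟨hy1, hy2⟩, hlt, hno⟩ := hxy
    simp only [add_assoc (σ _), hls] at hx2 hy2 hno ⊢
    obtain ⟨hx3, hx4⟩ := (hT x hx1).2.1 hx2
    obtain ⟨hy3, hy4⟩ := (hT y hy1).2.1 hy2
    have hj := hle _ _ hx1
    have hj2 := hle _ _ hX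
    generalize x / a₀ = j at *
    generalize y / a₀ = j' at *
    subst hx3 hy3
    have h4 : j < j' := by
      by_contra hcon
      have := Nat.mul_le_mul_right a₀ (not_lt.1 hcon)
      omega
    obtain ⟨h5, h6, h7⟩ := hJ j (by omega) hx4
    have h8 : j' = j + (k + l) := by
      by_contra hcon
      rcases lt_or_gt_of_ne hcon with h9 | h9
      · exact h7 j' h4 h9 hy4
      · have h10 : (j + (k + l) + 1) * a₀ ≤ j' * a₀ := Nat.mul_le_mul_right a₀ h9
        have h11 : (j + 1) * a₀ ≤ (j + (k + l)) * a₀ := Nat.mul_le_mul_right a₀ (by omega)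
        rw [add_mul _ 1] at h10 h11
        have h12 : n₀ * a₀ ≤ (j + (k + l)) * a₀ + (a₀ - 1) :=
          (Nat.mul_le_mul_right a₀ (show n₀ ≤ j + (k + l) by omega)).trans (by omega)
        refine hno ((j + (k + l)) * a₀ + (a₀ - 1)) (by omega) (by omega) ⟨h12, ?_⟩
        refine (hT _ h12).2.2 ?_
        rw [hlast]
        exact ⟨rfl, h5⟩
    subst h8
    refine ⟨by ring, ?_⟩
    have h9 := ((sum_le_of_steps hts hst hj l).2).2 hx4
    have h10 := sum_outside (x := j + l - 1) (n := k) hZt (by omega)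
      (fun i h11 h12 => h6 i (by omega) (by omega))
    rw [show j + l - 1 + k + 1 = j + (k + l) by omega, show j + l - 1 + 1 = j + l by omega] at h10
    omega

/-- The exponents of the blocks are not all divisible by some `a₀ ≥ 2`. -/
theorem Good.not_blocks (hw : Good w) (hs : StdPair A B V c d)
    (h : Coded A B (fun x => σ (x / a₀)) w) (hσ : StrictMono σ) (ha : 2 ≤ a₀) : False := by
  have ha0 : 0 < a₀ := by omega
  obtain ⟨X₀, hX₀⟩ := hw.jumps_three hs h (unbounded_of_blocks hσ ha0)
  have hadd : ∀ j, (j * a₀ + (a₀ - 1)) / a₀ = j ∧ (j * a₀ + (a₀ - 1) + 1) / a₀ = j + 1 ∧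
      (j * a₀ + 1) / a₀ = j ∧ j * a₀ / a₀ = j ∧ j ≤ j * a₀ := fun j =>
    ⟨div_block (by omega), by
      rw [show j * a₀ + (a₀ - 1) + 1 = (j + 1) * a₀ by rw [add_mul]; omega, div_block_zero ha0],
      div_block (by omega), div_block_zero ha0, Nat.le_mul_of_pos_right _ ha0⟩
  have h3 : ∀ p ≥ X₀, ∀ q ≥ X₀, ∀ r ≥ X₀, σ (p + 1) - σ p = σ (q + 1) - σ q ∨
      σ (p + 1) - σ p = σ (r + 1) - σ r ∨ σ (q + 1) - σ q = σ (r + 1) - σ r := by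
    intro p hp q hq r hr
    -- Since `a₀ ≥ 2`, the column `p * a₀` is not the last of its group and contributes the jump 0;
    -- this leaves two values for the positive jumps.
    have h1 := hX₀ (p * a₀) (by have := hadd p; omega) (p * a₀ + (a₀ - 1))
      (by have := hadd p; omega) (q * a₀ + (a₀ - 1)) (by have := hadd q; omega)
      (r * a₀ + (a₀ - 1)) (by have := hadd r; omega)
    simp only [(hadd p).1, (hadd p).2.1, (hadd p).2.2.1, (hadd p).2.2.2.1, (hadd q).1, (hadd r).1,
      (hadd q).2.1, (hadd r).2.1] at h1
    have := hσ (Nat.lt_add_one p)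
    have := hσ (Nat.lt_add_one q)
    have := hσ (Nat.lt_add_one r)
    omega
  have hstep : ∀ j, ∃ s, σ (j + 1) = σ j + s := fun j =>
    Nat.exists_eq_add_of_le (hσ (Nat.lt_add_one j)).le
  obtain ⟨s, hsX⟩ := hstep X₀
  have hnc : ∀ s n, ∃ j ≥ n, σ (j + 1) ≠ σ j + s := by
    intro s n
    by_contra hcon
    push Not at hcon
    exact hw.not_const_blocks hs h hσ ha0 s n hcon
  obtain ⟨q, hq, hqs⟩ := hnc s X₀
  obtain ⟨t, ht⟩ := hstep q
  have hst : ∀ j ≥ X₀, σ (j + 1) = σ j + s ∨ σ (j + 1) = σ j + t := by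
    intro j hj
    have h4 := h3 X₀ le_rfl q hq j hj
    have := hσ (Nat.lt_add_one j)
    omega
  have hsf : ∀ n, ∃ j ≥ n, σ (j + 1) = σ j + s := by
    intro n
    obtain ⟨j, hj, hjt⟩ := hnc t (n + X₀)
    exact ⟨j, by omega, (hst j (by omega)).resolve_right hjt⟩
  have htf : ∀ n, ∃ j ≥ n, σ (j + 1) = σ j + t := by
    intro n
    obtain ⟨j, hj, hjt⟩ := hnc s (n + X₀)
    exact ⟨j, by omega, (hst j (by omega)).resolve_left hjt⟩
  have hne : s ≠ t := by
    rintro rfl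
    exact hqs ht
  rcases lt_or_gt_of_ne hne with h5 | h5
  · exact hw.not_two_blocks hs h hσ ha h5 hst htf hsf
  · exact hw.not_two_blocks hs h hσ ha h5 (fun j hj => (hst j hj).symm) hsf htf

end

/-! ### Exchanging the roles of the two blocks -/

/-- The generalized inverse of an unbounded monotone function. -/
noncomputable def dual (H : ℕ → ℕ) (y : ℕ) : ℕ := sInf {x | y < H x}

section

variable {H : ℕ → ℕ}

/-- `y < H x` says that the `B` with index `y` precedes the `A` with index `x`; `dual` reads the
same path with the axes exchanged. -/
theorem dual_le_iff (hm : Monotone H) (hH : ∀ M, ∃ x, M ≤ H x) {x y : ℕ} :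
    dual H y ≤ x ↔ y < H x := by
  constructor
  · intro h
    have hne : {x | y < H x}.Nonempty := (hH (y + 1)).imp fun _ h => h
    have h1 : y < H (dual H y) := Nat.sInf_mem hne
    exact h1.trans_le (hm h)
  · intro h
    exact Nat.sInf_le h

theorem lt_dual_iff (hm : Monotone H) (hH : ∀ M, ∃ x, M ≤ H x) {x y : ℕ} :
    x < dual H y ↔ H x ≤ y := by
  have := dual_le_iff hm hH (x := x) (y := y)
  omega

theorem dual_mono (hm : Monotone H) (hH : ∀ M, ∃ x, M ≤ H x) : Monotone (dual H) := by
  intro y z hyz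
  rw [dual_le_iff hm hH]
  exact hyz.trans_lt ((dual_le_iff hm hH).1 le_rfl)

theorem dual_unbounded (hm : Monotone H) (hH : ∀ M, ∃ x, M ≤ H x) (M : ℕ) : ∃ y, M ≤ dual H y :=
  ⟨H M, ((lt_dual_iff hm hH).2 le_rfl).le⟩

theorem Coded.dual {A B : List (Fin 2)} {w : ℕ → Fin 2} (h : Coded A B H w)
    (hH : ∀ M, ∃ x, M ≤ H x) : Coded B A (dual H) w := by
  refine ⟨dual_mono h.mono hH, fun y => ?_, fun y x h1 h2 => ?_⟩
  · rw [add_comm]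
    refine h.occB _ y ?_ ((dual_le_iff h.mono hH).1 le_rfl)
    rcases Nat.eq_zero_or_pos (_root_.dual H y) with h1 | h1
    · exact Or.inl h1
    · exact Or.inr ((lt_dual_iff h.mono hH).1 (by omega))
  · rw [lt_dual_iff h.mono hH] at h2
    rw [dual_le_iff h.mono hH] at h1
    have : H x = y := by omega
    rw [add_comm, ← this]
    exact h.occA x

theorem exists_dual_const (hm : Monotone H) (hH : ∀ M, ∃ x, M ≤ H x)
    (h2 : ∀ n, ∃ x ≥ n, H x + 2 ≤ H (x + 1)) (n : ℕ) : ∃ y ≥ n, dual H (y + 1) = dual H y := by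
  obtain ⟨x₀, hx₀⟩ := hH n
  obtain ⟨x, hx, h⟩ := h2 x₀
  refine ⟨H x, hx₀.trans (hm hx), le_antisymm ?_ (dual_mono hm hH (Nat.le_add_right _ _))⟩
  have h3 : x < dual H (H x) := (lt_dual_iff hm hH).2 le_rfl
  have h4 : dual H (H x + 1) ≤ x + 1 := (dual_le_iff hm hH).2 (by omega)
  omega

theorem exists_dual_jump (hm : Monotone H) (hH : ∀ M, ∃ x, M ≤ H x)
    (h0 : ∀ n, ∃ x ≥ n, H (x + 1) = H x) (n : ℕ) : ∃ y ≥ n, dual H y + 2 ≤ dual H (y + 1) := by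
  obtain ⟨x₀, hx₀⟩ := hH (n + 1)
  obtain ⟨x, hx, h⟩ := h0 x₀
  have h1 := hm hx
  refine ⟨H x - 1, by omega, ?_⟩
  have h3 : dual H (H x - 1) ≤ x := (dual_le_iff hm hH).2 (by omega)
  have h4 : x + 1 < dual H (H x - 1 + 1) := (lt_dual_iff hm hH).2 (by omega)
  omega

/-- If all values of `H` are multiples of `b`, the blocks `B` come in groups of `b`, and the dual
path is constant on each group. This is the form required by `Good.not_blocks`. -/
theorem dual_mul {G : ℕ → ℕ} {b : ℕ} (hb : 0 < b) (hG : ∀ x, H x = G x * b) (hm : Monotone H)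
    (hH : ∀ M, ∃ x, M ≤ H x) (hGm : Monotone G) (hGu : ∀ M, ∃ x, M ≤ G x) :
    dual H = fun y => dual G (y / b) := by
  funext y
  apply eq_of_forall_ge_iff
  intro x
  rw [dual_le_iff hm hH, dual_le_iff hGm hGu, hG, Nat.div_lt_iff_lt_mul hb]

/-- As `G` skips no value, each further row needs a further column. -/
theorem dual_strictMono {G : ℕ → ℕ} (hGm : Monotone G) (hGu : ∀ M, ∃ x, M ≤ G x) (h0 : G 0 = 0)
    (h1 : ∀ x, G (x + 1) ≤ G x + 1) : StrictMono (dual G) := by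
  apply strictMono_nat_of_lt_succ
  intro q
  rw [lt_dual_iff hGm hGu]
  have h2 : q < G (dual G q) := (dual_le_iff hGm hGu).1 le_rfl
  rcases Nat.eq_zero_or_pos (dual G q) with h3 | h3
  · rw [h3, h0] at h2
    omega
  · have h4 : G (dual G q - 1) ≤ q := (lt_dual_iff hGm hGu).1 (by omega)
    have h5 := h1 (dual G q - 1)
    rw [Nat.sub_add_cancel h3] at h5
    omega

end

/-! ### The squares of blocks of different lengths do not both recur -/

section

variable {A B V : List (Fin 2)} {c d : Fin 2} {H : ℕ → ℕ} {w : ℕ → Fin 2}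

/-- Settles the only coincidence of return lengths in `Good.jumps_two`. -/
theorem StdPair.letters (hs : StdPair A B V c d) (hA : A.length = 2) (hB : B.length = 1) :
    A = [d, c] := by
  have hV : V.length = 1 := by
    have := hs.length
    omega
  obtain ⟨a, a', rfl⟩ := List.length_eq_two.1 hA
  obtain ⟨b, rfl⟩ := List.length_eq_one_iff.1 hB
  obtain ⟨v, rfl⟩ := List.length_eq_one_iff.1 hV
  have h1 := hs.hAB
  have h2 := hs.hBA
  simp only [List.cons_append, List.nil_append, List.cons.injEq, and_true] at h1 h2
  rw [h1.2.1, h1.1, ← h2.1, h1.2.2]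

/-- The class of `Coded.window_two` occurs twice for each block `A`, at distance `|B|`; before the
next pair there are `|A| + (j - 1) * |B|` letters, where `j` is the jump. The jump 0 and two
different positive jumps would give four returns. -/
theorem Good.jumps_two (hw : Good w) (hs : StdPair A B V c d) (h : Coded A B H w)
    (hH : ∀ M, ∃ x, M ≤ H x) (hab : B.length < A.length) : ∃ X₀, ∀ p ≥ X₀, ∀ q ≥ X₀, ∀ r ≥ X₀,
      H (p + 1) = H p → H (q + 1) = H q ∨ H (r + 1) = H r ∨
        H (q + 1) - H q = H (r + 1) - H r := by
  obtain ⟨i₀, hi₀⟩ := h.window_two hs hH hab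
  have hρ := h.start_strictMono hs.hA
  have hB := hs.hB
  set W := window w (2 * B.length) (2 * ones B - ((d : ℕ) - (c : ℕ)))
  set b := B.length
  have hstep : ∀ x, (x + 1) * A.length + H (x + 1) * b =
      x * A.length + H x * b + (A.length + (H (x + 1) - H x) * b) := by
    intro x
    obtain ⟨k, hk⟩ := Nat.exists_eq_add_of_le (h.mono (Nat.le_add_right x 1))
    rw [hk, Nat.add_sub_cancel_left]
    ring
  obtain ⟨ρ, hρdef⟩ : ∃ ρ : ℕ → ℕ, ρ = fun x => x * A.length + H x * b := ⟨_, rfl⟩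
  have hρ' : ∀ x, x * A.length + H x * b = ρ x := fun x => by rw [hρdef]
  simp only [hρ'] at hi₀ hstep
  rw [← hρdef] at hρ
  have hsep : ∀ x y, x < y → ρ x + A.length ≤ ρ y := by
    intro x y hxy
    have h1 := hstep x
    have h2 : ρ (x + 1) ≤ ρ y := hρ.monotone hxy
    omega
  have htri : ∀ x y, ρ x + A.length ≤ ρ y ∨ x = y ∨ ρ y + A.length ≤ ρ x := by
    intro x y
    rcases lt_trichotomy x y with h | h | h
    · exact Or.inl (hsep x y h)
    · exact Or.inr (Or.inl h)
    · exact Or.inr (Or.inr (hsep y x h))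
  have hshort : ∀ x ≥ i₀ + 2 * b, Consec W (ρ x + (V.length + 1) - 2 * b)
      (ρ x + (V.length + 1) - b) := by
    intro x hx
    have h1 : x ≤ ρ x := hρ.id_le x
    refine ⟨(hi₀ _ (by omega)).2 ⟨x, Or.inr (by omega)⟩, (hi₀ _ (by omega)).2
      ⟨x, Or.inl (by omega)⟩, by omega, fun k h2 h3 h4 => ?_⟩
    obtain ⟨y, hy⟩ := (hi₀ _ (by omega)).1 h4
    rcases htri x y with h5 | rfl | h5 <;> omega
  have hlong : ∀ x ≥ i₀ + 2 * b, Consec W (ρ x + (V.length + 1) - b)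
      (ρ x + (V.length + 1) - b + (A.length + (H (x + 1) - H x) * b - b)) := by
    intro x hx
    have h1 : x ≤ ρ x := hρ.id_le x
    have h2 := hstep x
    have e : ρ x + (V.length + 1) - b + (A.length + (H (x + 1) - H x) * b - b) =
      ρ (x + 1) + (V.length + 1) - 2 * b := by omega
    rw [e]
    refine ⟨(hi₀ _ (by omega)).2 ⟨x, Or.inl (by omega)⟩, (hi₀ _ (by omega)).2
      ⟨x + 1, Or.inr (by omega)⟩, by omega, fun k h3 h4 h5 => ?_⟩
    obtain ⟨y, hy⟩ := (hi₀ _ (by omega)).1 h5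
    rcases Nat.lt_trichotomy y x with h6 | rfl | h6
    · have := hsep y x h6
      omega
    · omega
    · rcases Nat.lt_or_ge (x + 1) y with h7 | h7
      · have := hsep _ _ h7
        omega
      · obtain rfl : y = x + 1 := by omega
        omega
  refine ⟨i₀ + 2 * b, fun p hp q hq r hr hp0 => ?_⟩
  by_contra hcon
  push Not at hcon
  obtain ⟨hq0, hr0, hqr⟩ := hcon
  have g1 := (hshort p hp).mem_gaps
  have g2 := (hlong p hp).mem_gaps
  have g3 := (hlong q hq).mem_gaps
  have g4 := (hlong r hr).mem_gaps
  rw [Nat.add_sub_cancel_left] at g2 g3 g4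
  have hpρ : p ≤ ρ p := hρ.id_le p
  have e1 : ρ p + (V.length + 1) - b - (ρ p + (V.length + 1) - 2 * b) = b := by omega
  rw [e1] at g1
  have hmq := h.mono (Nat.le_add_right q 1)
  have hmr := h.mono (Nat.le_add_right r 1)
  have hq1 : 1 * b ≤ (H (q + 1) - H q) * b := Nat.mul_le_mul_right _ (by omega)
  have hr1 : 1 * b ≤ (H (r + 1) - H r) * b := Nat.mul_le_mul_right _ (by omega)
  have hqr1 : (H (q + 1) - H q) * b ≠ (H (r + 1) - H r) * b := fun h =>
    hqr (Nat.eq_of_mul_eq_mul_right hB h)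
  refine hw.not_four g1 g2 g3 g4 ?_ ?_ ?_ ?_ ?_ ?_ <;> intro heq <;> rw [Prod.mk.injEq] at heq
  -- Equal lengths mean `|A| = 2 * |B|`, so `|B| = 1` by coprimality and `A` consists of `d` and
  -- `c`. The two returns are these two different letters.
  · obtain ⟨h1, h2⟩ := heq
    rw [hp0] at h1 h2
    simp only [Nat.sub_self, zero_mul, add_zero] at h1 h2
    have hA2 : A.length = 2 * b := by omega
    have hb1 : b = 1 := by
      have hc := hs.coprime
      rw [hA2] at hc
      exact Nat.Coprime.eq_one_of_dvd hc.symm ⟨2, by simp only [b]; ring⟩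
    rw [hb1] at h2 hA2
    have hlen := hs.length
    have hAl := hs.letters hA2 hb1
    have e2 : ρ p + (V.length + 1) - 2 * 1 = ρ p := by omega
    have e3 : ρ p + (V.length + 1) - 1 = ρ p + 1 := by omega
    rw [e2, e3, show ρ p + 1 + (A.length - 1) = ρ p + 1 + 1 by omega, height_succ w (ρ p + 1),
      height_succ] at h2
    have h3 := h.occA p
    rw [hρ', OccursAt, hAl] at h3
    have h4 : w (ρ p) = d ∧ w (ρ p + 1) = c := by
      simpa [wordAt, List.range_succ] using h3
    rw [h4.1, h4.2] at h2
    exact hs.ne (letter_eq_of_val (by linarith))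
  all_goals
    have h1 := heq.1
    try simp only [hp0, Nat.sub_self, zero_mul, add_zero] at h1
    omega

/-- By `Good.jumps_two` all late jumps are 0 or one fixed `b₀ ≥ 2`. So `B` occurs in groups of `b₀`,
and the dual coding contradicts `Good.not_blocks`. -/
theorem Good.not_both_of_lt (hw : Good w) (hs : StdPair A B V c d) (h : Coded A B H w)
    (hH : ∀ M, ∃ x, M ≤ H x) (hab : B.length < A.length) (h0 : ∀ n, ∃ x ≥ n, H (x + 1) = H x)
    (h2 : ∀ n, ∃ x ≥ n, H x + 2 ≤ H (x + 1)) : False := by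
  obtain ⟨X₀, hX₀⟩ := hw.jumps_two hs h hH hab
  obtain ⟨p, hp, hp0⟩ := h0 X₀
  obtain ⟨q, hq, hq2⟩ := h2 X₀
  obtain ⟨b₀, hb₀⟩ := Nat.exists_eq_add_of_le (show H q ≤ H (q + 1) by omega)
  have hstep : ∀ x ≥ X₀, H (x + 1) = H x ∨ H (x + 1) = H x + b₀ := by
    intro x hx
    have h3 := hX₀ p hp q hq x hx hp0
    have := h.mono (Nat.le_add_right x 1)
    omega
  -- In the tail the path starts at 0, so that all its values are multiples of `b₀`.
  have hw' := hw.shift (X₀ * A.length + H X₀ * B.length)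
  have h' := h.tail X₀
  have hstep' : ∀ x, H (X₀ + (x + 1)) - H X₀ = H (X₀ + x) - H X₀ ∨
      H (X₀ + (x + 1)) - H X₀ = H (X₀ + x) - H X₀ + b₀ := by
    intro x
    have h3 := hstep (X₀ + x) (by omega)
    have := h.mono (Nat.le_add_right X₀ x)
    rw [← add_assoc]
    omega
  have hH' : ∀ M, ∃ x, M ≤ H (X₀ + x) - H X₀ := by
    intro M
    obtain ⟨x, hx⟩ := hH (M + H X₀)
    refine ⟨x, ?_⟩
    have := h.mono (Nat.le_add_left x X₀)
    omega
  generalize hE : (fun x' => H (X₀ + x') - H X₀) = H' at h'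
  have hval : ∀ x, H (X₀ + x) - H X₀ = H' x := fun x => by rw [← hE]
  simp only [hval] at hstep' hH'
  have hz : H' 0 = 0 := by
    rw [← hval]
    simp
  have hG : ∀ x, H' x = H' x / b₀ * b₀ := by
    intro x
    refine (Nat.div_mul_cancel ?_).symm
    induction x with
    | zero => simp [hz]
    | succ x ih =>
      rcases hstep' x with h3 | h3 <;> rw [h3]
      · exact ih
      · exact dvd_add ih dvd_rfl
  have hGm : Monotone fun x => H' x / b₀ := fun x y hxy => Nat.div_le_div_right (h'.mono hxy)
  have hGu : ∀ M, ∃ x, M ≤ H' x / b₀ := by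
    intro M
    obtain ⟨x, hx⟩ := hH' (M * b₀)
    exact ⟨x, (Nat.le_div_iff_mul_le (by omega)).2 hx⟩
  have hK := h'.dual hH'
  rw [dual_mul (by omega) hG h'.mono hH' hGm hGu] at hK
  refine hw'.not_blocks hs.symm hK (dual_strictMono hGm hGu (by simp [hz]) fun x => ?_)
    (show 2 ≤ b₀ by omega)
  rcases hstep' x with h3 | h3 <;> rw [h3]
  · omega
  · rw [Nat.add_div_right _ (by omega)]

/-- Not both of the squares `AA` and `BB` occur late in the coding sequence. -/
theorem Good.not_both (hw : Good w) (hs : StdPair A B V c d) (h : Coded A B H w)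
    (hH : ∀ M, ∃ x, M ≤ H x) (hab : A.length ≠ B.length) (h0 : ∀ n, ∃ x ≥ n, H (x + 1) = H x)
    (h2 : ∀ n, ∃ x ≥ n, H x + 2 ≤ H (x + 1)) : False := by
  rcases lt_or_gt_of_ne hab with hlt | hlt
  · exact hw.not_both_of_lt hs.symm (h.dual hH) (dual_unbounded h.mono hH) hlt
      (exists_dual_const h.mono hH h2) (exists_dual_jump h.mono hH h0)
  · exact hw.not_both_of_lt hs h hH hlt h0 h2

end

/-! ### Exchange of letters and extension of factors -/

/-- The word with the two letters exchanged. -/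
def flipLetters (w : ℕ → Fin 2) (i : ℕ) : Fin 2 := (w i).rev

theorem val_rev (a : Fin 2) : (((a.rev : Fin 2) : ℕ) : ℤ) = 1 - ((a : ℕ) : ℤ) := by
  revert a; decide

theorem height_flip (w : ℕ → Fin 2) (i : ℕ) : height (flipLetters w) i = i - height w i := by
  induction i with
  | zero => simp [height_zero]
  | succ i ih =>
    rw [height_succ, height_succ, ih, flipLetters, val_rev]
    push_cast
    ring

theorem window_flip (w : ℕ → Fin 2) (N : ℕ) (v : ℤ) :
    window (flipLetters w) N v = window w N (N - v) := by
  ext i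
  simp only [window, Set.mem_ofPred_eq, height_flip]
  push_cast
  constructor <;> intro h <;> linarith

theorem gaps_flip (w : ℕ → Fin 2) (N : ℕ) (v : ℤ) :
    gaps (flipLetters w) N v = (fun p : ℕ × ℤ => (p.1, (p.1 : ℤ) - p.2)) '' gaps w N (N - v) := by
  have hkey : ∀ i j : ℕ, i < j → (j - i, height (flipLetters w) j - height (flipLetters w) i) =
      (j - i, ((j - i : ℕ) : ℤ) - (height w j - height w i)) := by
    intro i j hij
    rw [height_flip, height_flip, Nat.cast_sub hij.le]
    congr 1
    ring
  ext p
  constructor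
  · rintro ⟨i, j, hij, rfl⟩
    rw [window_flip] at hij
    exact ⟨_, ⟨i, j, hij, rfl⟩, (hkey i j hij.2.2.1).symm⟩
  · rintro ⟨_, ⟨i, j, hij, rfl⟩, rfl⟩
    refine ⟨i, j, by rwa [window_flip], (hkey i j hij.2.2.1).symm⟩

theorem Good.flip {w : ℕ → Fin 2} (hw : Good w) : Good (flipLetters w) := by
  refine ⟨fun i n X => ?_, fun N v hne => ?_⟩
  · obtain ⟨i', h1, h2⟩ := hw.recur i n X
    exact ⟨i', h1, fun k hk => congrArg Fin.rev (h2 k hk)⟩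
  · rw [gaps_flip, Function.Injective.encard_image]
    · rw [window_flip] at hne
      exact hw.card _ _ hne
    · rintro ⟨n, t⟩ ⟨n', t'⟩ h
      obtain ⟨h1, h2⟩ := Prod.mk.inj h
      simp only at h1 h2
      subst h1
      congr 1
      linarith

theorem isFactor_flip {w : ℕ → Fin 2} {l : List (Fin 2)} :
    IsFactor (flipLetters w) l ↔ IsFactor w (l.map Fin.rev) := by
  refine exists_congr fun i => ?_
  have hrev : ∀ l : List (Fin 2), (l.map Fin.rev).map Fin.rev = l := fun l => by
    rw [List.map_map, show Fin.rev ∘ Fin.rev = (id : Fin 2 → Fin 2) from funext Fin.rev_rev,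
      List.map_id]
  have h1 : wordAt (flipLetters w) i l.length = (wordAt w i l.length).map Fin.rev := by
    simp [wordAt, flipLetters]
  rw [OccursAt, OccursAt, h1, List.length_map]
  constructor
  · intro h
    rw [← hrev (wordAt w i l.length), h]
  · intro h
    rw [h, hrev]

theorem OccursAt.ext_right {w : ℕ → Fin 2} {l : List (Fin 2)} {i : ℕ} (hi : OccursAt w l i) :
    OccursAt w (l ++ [0]) i ∨ OccursAt w (l ++ [1]) i := by
  have key : OccursAt w (l ++ [w (i + l.length)]) i := by
    rw [OccursAt, List.length_append, List.length_singleton, wordAt_succ, hi]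
  have h2 : w (i + l.length) = 0 ∨ w (i + l.length) = 1 := by
    generalize w (i + l.length) = a
    revert a; decide
  rcases h2 with h2 | h2 <;> rw [h2] at key
  · exact Or.inl key
  · exact Or.inr key

theorem IsFactor.ext_right {w : ℕ → Fin 2} {l : List (Fin 2)} (h : IsFactor w l) :
    IsFactor w (l ++ [0]) ∨ IsFactor w (l ++ [1]) := by
  obtain ⟨i, hi⟩ := h
  exact hi.ext_right.imp (fun h => ⟨i, h⟩) fun h => ⟨i, h⟩

theorem Recur.exists_occ {w : ℕ → Fin 2} (hw : Recur w) {l : List (Fin 2)} (h : IsFactor w l)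
    (X : ℕ) : ∃ i ≥ X, OccursAt w l i := by
  obtain ⟨i, hi⟩ := h
  obtain ⟨i', h1, h2⟩ := hw i l.length X
  exact ⟨i', h1, (wordAt_eq_iff.2 h2).trans hi⟩

theorem Recur.ext_left {w : ℕ → Fin 2} (hw : Recur w) {l : List (Fin 2)} (h : IsFactor w l) :
    IsFactor w (0 :: l) ∨ IsFactor w (1 :: l) := by
  obtain ⟨i, h1, hi⟩ := hw.exists_occ h 1
  obtain ⟨i, rfl⟩ : ∃ k, i = k + 1 := ⟨i - 1, by omega⟩
  have key : OccursAt w (w i :: l) i := by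
    rw [OccursAt, List.length_cons, add_comm l.length, wordAt_add, hi]
    simp [wordAt]
  have h2 : w i = 0 ∨ w i = 1 := by
    generalize w i = a
    revert a; decide
  rcases h2 with h2 | h2 <;> rw [h2] at key
  · exact Or.inl ⟨i, key⟩
  · exact Or.inr ⟨i, key⟩

theorem OccursAt.drop {A : Type*} {w : ℕ → A} {l l' : List A} {i : ℕ}
    (h : OccursAt w (l ++ l') i) : OccursAt w l i ∧ OccursAt w l' (i + l.length) := by
  rw [OccursAt, List.length_append, wordAt_add] at h
  exact List.append_inj h (length_wordAt _ _ _)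

theorem IsFactor.sub {A : Type*} {w : ℕ → A} {l l' : List A} (h : IsFactor w l) (hl : l' <:+: l) :
    IsFactor w l' := by
  obtain ⟨i, hi⟩ := h
  obtain ⟨s, t, rfl⟩ := hl
  exact ⟨_, hi.drop.1.drop.2⟩

theorem OccursAt.append {A : Type*} {w : ℕ → A} {l l' : List A} {i : ℕ}
    (h : OccursAt w l i) (h' : OccursAt w l' (i + l.length)) : OccursAt w (l ++ l') i := by
  rw [OccursAt, List.length_append, wordAt_add, h, h']

/-! ### Returns read off from finite factors -/

/-- The positions `i < j` of the finite word `l` are consecutive positions of blocks with length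
`N` and `v` ones. -/
def IsGap (l : List (Fin 2)) (N v i j : ℕ) : Prop :=
  i < j ∧ j + N ≤ l.length ∧ (l.take (i + N)).count 1 = (l.take i).count 1 + v ∧
    (l.take (j + N)).count 1 = (l.take j).count 1 + v ∧
    ∀ k < j, i < k → (l.take (k + N)).count 1 ≠ (l.take k).count 1 + v

instance (l : List (Fin 2)) (N v i j : ℕ) : Decidable (IsGap l N v i j) :=
  inferInstanceAs (Decidable (_ ∧ _ ∧ _ ∧ _ ∧ _))

theorem OccursAt.mem_window {w : ℕ → Fin 2} {l : List (Fin 2)} {p : ℕ} (h : OccursAt w l p)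
    {N v i : ℕ} (hi : i + N ≤ l.length) :
    p + i ∈ window w N v ↔ (l.take (i + N)).count 1 = (l.take i).count 1 + v := by
  have h1 := h.height hi
  have h2 := h.height (show i ≤ l.length by omega)
  rw [window, Set.mem_ofPred_eq, add_assoc, h1, h2]
  unfold ones
  omega

theorem OccursAt.consec {w : ℕ → Fin 2} {l : List (Fin 2)} {p : ℕ} (h : OccursAt w l p)
    {N v i j : ℕ} (hg : IsGap l N v i j) : Consec (window w N v) (p + i) (p + j) := by
  obtain ⟨h1, h2, h3, h4, h5⟩ := hg
  refine ⟨(h.mem_window (by omega)).2 h3, (h.mem_window h2).2 h4, by omega, fun k h6 h7 h8 => ?_⟩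
  obtain ⟨k, rfl⟩ := Nat.exists_eq_add_of_le (show p ≤ k by omega)
  exact h5 k (by omega) (by omega) ((h.mem_window (by omega)).1 h8)

/-- Exhibiting a return becomes a decidable check on a finite word. -/
theorem IsFactor.mem_gaps {w : ℕ → Fin 2} {l : List (Fin 2)} (h : IsFactor w l) (N v i j : ℕ)
    (hg : IsGap l N v i j) :
    (j - i, ((l.take j).count 1 : ℤ) - ((l.take i).count 1 : ℤ)) ∈ gaps w N v := by
  obtain ⟨p, hp⟩ := h
  have h1 := (hp.consec hg).mem_gaps
  have h2 := hg.2.1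
  rw [hp.height (show i ≤ l.length by have := hg.1; omega),
    hp.height (show j ≤ l.length by omega), Nat.add_sub_add_left] at h1
  unfold ones at h1
  rwa [add_sub_add_left_eq_sub] at h1

/-- A factor without windows forces a long gap. -/
theorem Good.exists_long_gap {w : ℕ → Fin 2} (hw : Good w) {l : List (Fin 2)} (h : IsFactor w l)
    (N v L : ℕ) (hne : (window w N v).Nonempty) (hl : L + N ≤ l.length + 1)
    (hno : ∀ k < L, (l.take (k + N)).count 1 ≠ (l.take k).count 1 + v) :
    ∃ n t, L < n ∧ (n, t) ∈ gaps w N v := by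
  obtain ⟨p, hp⟩ := hne
  obtain ⟨i, hi, hocc⟩ := hw.recur.exists_occ h (p + 1)
  obtain ⟨q, h1, h2, h3, h4⟩ := exists_last hp (show p ≤ i - 1 by omega)
  obtain ⟨j, hj⟩ := hw.recur.exists_consec h3
  refine ⟨j - q, _, ?_, hj.mem_gaps⟩
  by_contra hcon
  rcases Nat.lt_or_ge j i with h5 | h5
  · exact h4 j hj.2.2.1 (by omega) hj.2.1
  · obtain ⟨k, rfl⟩ := Nat.exists_eq_add_of_le h5
    exact hno k (by omega) ((hocc.mem_window (by omega)).1 hj.2.1)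

theorem IsFactor.right_zero {w : ℕ → Fin 2} {l l' : List (Fin 2)} (h : IsFactor w l)
    (h' : ¬ IsFactor w l') (hl : l' <:+: l ++ [1]) : IsFactor w (l ++ [0]) :=
  h.ext_right.resolve_right fun h1 => h' (h1.sub hl)

theorem IsFactor.right_one {w : ℕ → Fin 2} {l l' : List (Fin 2)} (h : IsFactor w l)
    (h' : ¬ IsFactor w l') (hl : l' <:+: l ++ [0]) : IsFactor w (l ++ [1]) :=
  h.ext_right.resolve_left fun h1 => h' (h1.sub hl)

theorem OccursAt.right_zero {w : ℕ → Fin 2} {l l' : List (Fin 2)} {i : ℕ} (h : OccursAt w l i)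
    (h' : ¬ IsFactor w l') (hl : l' <:+: l ++ [1]) : OccursAt w (l ++ [0]) i :=
  h.ext_right.resolve_right fun h1 => h' (IsFactor.sub ⟨i, h1⟩ hl)

theorem OccursAt.right_one {w : ℕ → Fin 2} {l l' : List (Fin 2)} {i : ℕ} (h : OccursAt w l i)
    (h' : ¬ IsFactor w l') (hl : l' <:+: l ++ [0]) : OccursAt w (l ++ [1]) i :=
  h.ext_right.resolve_left fun h1 => h' (IsFactor.sub ⟨i, h1⟩ hl)

theorem Good.left_zero {w : ℕ → Fin 2} (hw : Good w) {l l' : List (Fin 2)} (h : IsFactor w l)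
    (h' : ¬ IsFactor w l') (hl : l' <:+: 1 :: l) : IsFactor w (0 :: l) :=
  (hw.recur.ext_left h).resolve_right fun h1 => h' (h1.sub hl)

theorem Good.left_one {w : ℕ → Fin 2} (hw : Good w) {l l' : List (Fin 2)} (h : IsFactor w l)
    (h' : ¬ IsFactor w l') (hl : l' <:+: 0 :: l) : IsFactor w (1 :: l) :=
  (hw.recur.ext_left h).resolve_left fun h1 => h' (h1.sub hl)

theorem Consec.unique {S : Set ℕ} {i j j' : ℕ} (h : Consec S i j) (h' : Consec S i j') :
    j = j' := by
  rcases lt_trichotomy j j' with h1 | h1 | h1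
  · exact absurd h.2.1 (h'.2.2.2 j h.2.2.1 h1)
  · exact h1
  · exact absurd h'.2.1 (h.2.2.2 j' h'.2.2.1 h1)

/-- A factor that is followed by itself at the distance `p` recurs periodically. -/
theorem OccursAt.periodic {w : ℕ → Fin 2} {l : List (Fin 2)} {p i₀ : ℕ} (h₀ : OccursAt w l i₀)
    (h : ∀ i, OccursAt w l i → OccursAt w l (i + p)) (k : ℕ) : OccursAt w l (i₀ + p * k) := by
  induction k with
  | zero => exact h₀
  | succ k ih =>
    rw [mul_add, mul_one, ← add_assoc]
    exact h _ ih

/-- Used in `ShortRuns.false`: once all these factors are excluded, the class `(4, 2)` has a single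
return, of length two. -/
theorem isGap_of_excluded : ∀ a b c d e f : Fin 2,
    (∀ l ∈ ([[0, 0, 0], [1, 1, 1], [0, 0, 1, 1], [1, 1, 0, 0], [1, 1, 0, 1, 1], [0, 0, 1, 0, 0],
      [0, 1, 0, 1, 0], [1, 0, 1, 0, 1]] : List (List (Fin 2))), ¬ l <:+: [a, b, c, d, e, f]) →
    [a, b, c, d].count 1 = 2 → IsGap [a, b, c, d, e, f] 4 2 0 2 ∧ [a, b].count 1 = 1 := by
  decide

/-! ### Runs of lengths one and two for both letters -/

/-- Good words in which all runs have length one or two, and all four runs occur. -/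
structure ShortRuns (w : ℕ → Fin 2) : Prop where
  good : Good w
  n000 : ¬ IsFactor w [0, 0, 0]
  n111 : ¬ IsFactor w [1, 1, 1]
  f010 : IsFactor w [0, 1, 0]
  f101 : IsFactor w [1, 0, 1]
  f00 : IsFactor w [0, 0]
  f11 : IsFactor w [1, 1]

namespace ShortRuns

variable {w : ℕ → Fin 2}

theorem flip (h : ShortRuns w) : ShortRuns (flipLetters w) :=
  ⟨h.good.flip, fun h' => h.n111 (isFactor_flip.1 h'), fun h' => h.n000 (isFactor_flip.1 h'),
    isFactor_flip.2 h.f101, isFactor_flip.2 h.f010, isFactor_flip.2 h.f11, isFactor_flip.2 h.f00⟩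

/-- Otherwise each `010` is followed by another one two letters later, and `00` cannot recur. -/
theorem not_alternating (h : ShortRuns w) (h1 : ¬ IsFactor w [0, 1, 0, 0]) (h2 : ¬ IsFactor w [0, 1, 0, 1, 1]) :
    False := by
  obtain ⟨i₀, hi₀⟩ := h.f010
  have key := hi₀.periodic (p := 2) fun i hi =>
    (OccursAt.drop (l := [0, 1]) (((hi.right_one h1 (by decide)).right_zero h2 (by decide)))).2
  obtain ⟨n, hn, hocc⟩ := h.good.recur.exists_occ h.f00 i₀
  obtain ⟨k, r, hr, rfl⟩ : ∃ k r, r < 2 ∧ n = i₀ + 2 * k + r :=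
    ⟨(n - i₀) / 2, (n - i₀) % 2, by omega, by omega⟩
  have h3 := key k
  simp only [OccursAt, wordAt, List.length_cons, List.length_nil, List.range_succ, List.range_zero,
    List.map_cons, List.map_nil, List.nil_append, List.cons_append,
    List.cons.injEq, and_true] at h3 hocc
  interval_cases r
  · exact absurd (hocc.2.symm.trans h3.2.1) (by decide)
  · exact absurd (hocc.1.symm.trans h3.2.1) (by decide)

theorem f0110 (h : ShortRuns w) : IsFactor w [0, 1, 1, 0] :=
  (h.good.left_zero h.f11 h.n111 (by decide)).right_zero h.n111 (by decide)

theorem f1001 (h : ShortRuns w) : IsFactor w [1, 0, 0, 1] :=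
  (h.good.left_one h.f00 h.n000 (by decide)).right_one h.n000 (by decide)

/-- The class `(4, 2)` would have the returns `(3, 2)`, `(1, 1)`, `(1, 0)`. Factors giving `(2, 1)`
or `(3, 1)` are then excluded, which leaves only the situation of `not_alternating`. -/
theorem not_11011 (h : ShortRuns w) (hI : IsFactor w [0, 0, 1, 1] ∨ IsFactor w [1, 1, 0, 0]) :
    ¬ IsFactor w [1, 1, 0, 1, 1] := by
  intro hf
  have g3 := ((h.good.left_zero hf h.n111 (by decide)).right_zero h.n111 (by decide)).mem_gaps
    4 2 0 3 (by decide)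
  have key : ∀ p ∈ gaps w 4 (2 : ℕ), p = (2, 1) ∨ p = (3, 1) → False := by
    intro p hp hp'
    rcases hI with hI | hI
    · have hf' := (h.good.left_one hI h.n000 (by decide)).right_zero h.n111 (by decide)
      refine h.good.not_four hp g3 (hf'.mem_gaps 4 2 0 1 (by decide))
        (hf'.mem_gaps 4 2 1 2 (by decide)) ?_ ?_ ?_ (by decide) (by decide) (by decide) <;>
      · rcases hp' with rfl | rfl <;> decide
    · have hf' := (h.good.left_zero hI h.n111 (by decide)).right_one h.n000 (by decide)
      refine h.good.not_four hp g3 (hf'.mem_gaps 4 2 0 1 (by decide))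
        (hf'.mem_gaps 4 2 1 2 (by decide)) ?_ ?_ ?_ (by decide) (by decide) (by decide) <;>
      · rcases hp' with rfl | rfl <;> decide
  have n00100 : ¬ IsFactor w [0, 0, 1, 0, 0] := fun hf =>
    key _ (((h.good.left_one hf h.n000 (by decide)).right_one h.n000 (by decide)).mem_gaps
      4 2 0 3 (by decide)) (Or.inr (by decide))
  have n101001 : ¬ IsFactor w [1, 0, 1, 0, 0, 1] := fun hf =>
    key _ (hf.mem_gaps 4 2 0 2 (by decide)) (Or.inl (by decide))
  have n010110 : ¬ IsFactor w [0, 1, 0, 1, 1, 0] := fun hf =>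
    key _ (hf.mem_gaps 4 2 0 2 (by decide)) (Or.inl (by decide))
  exact h.not_alternating
    (fun hf => n101001 ((h.good.left_one hf n00100 (by decide)).right_one h.n000 (by decide)))
    (fun hf => n010110 (hf.right_zero h.n111 (by decide)))

/-- If `00` were never next to an isolated `1`, the class `(3, 2)` would have the returns `(1, 0)`,
`(1, 1)`, `(3, 2)` and `(2, 1)`. -/
theorem not_isolated (h : ShortRuns w) (h1 : ¬ IsFactor w [0, 0, 1, 0]) (h2 : ¬ IsFactor w [0, 1, 0, 0]) :
    False := by
  have f1011 : IsFactor w [1, 0, 1, 1] := by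
    by_contra h3
    exact h.not_alternating h2 fun h4 => h3 (h4.sub (by decide))
  have f10101 : IsFactor w [1, 0, 1, 0, 1] :=
    (h.good.left_one h.f010 h1 (by decide)).right_one h2 (by decide)
  have f110011 : IsFactor w [1, 1, 0, 0, 1, 1] :=
    h.good.left_one (h.good.left_one ((h.f00.right_one h.n000 (by decide)).right_one h1 (by decide))
      h.n000 (by decide)) h2 (by decide)
  exact h.good.not_four (h.f0110.mem_gaps 3 2 0 1 (by decide)) (f1011.mem_gaps 3 2 0 1 (by decide))
    (f110011.mem_gaps 3 2 0 3 (by decide)) (f10101.mem_gaps 3 2 0 2 (by decide))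
    (by decide) (by decide) (by decide) (by decide) (by decide) (by decide)

/-- The class `(3, 1)` already has two returns of length one, hence at most one longer return. That
one must be `(4, 2)`, and each of the excluded factors would produce a different one. -/
theorem excluded_of_adjacent (h : ShortRuns w) (hI : IsFactor w [0, 0, 1, 1] ∨ IsFactor w [1, 1, 0, 0])
    (h0 : IsFactor w [0, 0, 1, 0] ∨ IsFactor w [0, 1, 0, 0])
    (h1 : IsFactor w [1, 1, 0, 1] ∨ IsFactor w [1, 0, 1, 1])
    (n11011 : ¬ IsFactor w [1, 1, 0, 1, 1]) :
    ¬ IsFactor w [0, 0, 1, 1, 0, 0] ∧ ¬ IsFactor w [0, 1, 0, 1, 0] ∧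
      ¬ IsFactor w [0, 1, 0, 1, 1, 0, 1, 0] := by
  have g1 := h.f1001.mem_gaps 3 1 0 1 (by decide)
  have g0 : (1, (0 : ℤ)) ∈ gaps w 3 (1 : ℕ) := by
    rcases h0 with h0 | h0
    · exact h0.mem_gaps 3 1 0 1 (by decide)
    · exact h0.mem_gaps 3 1 0 1 (by decide)
  have key : ∀ p ∈ gaps w 3 (1 : ℕ), ∀ q ∈ gaps w 3 (1 : ℕ), 1 < p.1 → 1 < q.1 → p = q := by
    intro p hp q hq hp1 hq1
    by_contra hpq
    have hne : ∀ p q : ℕ × ℤ, 1 < p.1 → q.1 = 1 → p ≠ q := by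
      rintro p q h1 h2 rfl
      omega
    exact h.good.not_four hp hq g1 g0 hpq (hne _ _ hp1 rfl) (hne _ _ hp1 rfl) (hne _ _ hq1 rfl)
      (hne _ _ hq1 rfl) (by decide)
  have gAB : (3, (1 : ℤ)) ∈ gaps w 3 (1 : ℕ) ∨ (4, (2 : ℤ)) ∈ gaps w 3 (1 : ℕ) := by
    rcases hI with hI | hI
    · rcases (hI.right_zero h.n111 (by decide)).ext_right with h3 | h3
      · exact Or.inl (h3.mem_gaps 3 1 0 3 (by decide))
      · exact Or.inr ((h3.right_zero n11011 (by decide)).mem_gaps 3 1 0 4 (by decide))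
    · rcases h.good.recur.ext_left (h.good.left_zero hI h.n111 (by decide)) with h3 | h3
      · exact Or.inl (h3.mem_gaps 3 1 0 3 (by decide))
      · exact Or.inr ((h.good.left_zero h3 n11011 (by decide)).mem_gaps 3 1 0 4 (by decide))
  have gBD : (5, (3 : ℤ)) ∈ gaps w 3 (1 : ℕ) ∨ (4, (2 : ℤ)) ∈ gaps w 3 (1 : ℕ) := by
    rcases h1 with h1 | h1
    · rcases h.good.recur.ext_left (h.good.left_zero (h1.right_zero n11011 (by decide)) h.n111
        (by decide)) with h3 | h3
      · exact Or.inr (h3.mem_gaps 3 1 0 4 (by decide))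
      · exact Or.inl ((h.good.left_zero h3 n11011 (by decide)).mem_gaps 3 1 0 5 (by decide))
    · rcases ((h.good.left_zero h1 n11011 (by decide)).right_zero h.n111
        (by decide)).ext_right with h3 | h3
      · exact Or.inr (h3.mem_gaps 3 1 0 4 (by decide))
      · exact Or.inl ((h3.right_zero n11011 (by decide)).mem_gaps 3 1 0 5 (by decide))
  -- There is a long return of length 3 or 4 and one of length 5 or 4; they agree, so the length is
  -- 4.
  have gB : (4, (2 : ℤ)) ∈ gaps w 3 (1 : ℕ) := by
    rcases gAB with g | g
    · rcases gBD with g' | g'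
      · exact absurd (key _ g _ g' (by decide) (by decide)) (by decide)
      · exact g'
    · exact g
  exact ⟨fun hf => absurd (key _ (hf.mem_gaps 3 1 0 3 (by decide)) _ gB (by decide) (by decide))
      (by decide), fun hf => absurd (key _ (hf.mem_gaps 3 1 0 2 (by decide)) _ gB (by decide)
      (by decide)) (by decide), fun hf => absurd (key _ (hf.mem_gaps 3 1 0 5 (by decide)) _ gB
      (by decide) (by decide)) (by decide)⟩

/-- Every `0011` is continued by `010011`, so the word is periodic with period six from there on. As
`00` occurs once per period, the class `(2, 0)` has a single return. -/
theorem not_period_six (h : ShortRuns w) (hI : IsFactor w [0, 0, 1, 1]) (n11011 : ¬ IsFactor w [1, 1, 0, 1, 1])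
    (n00100 : ¬ IsFactor w [0, 0, 1, 0, 0]) (n001100 : ¬ IsFactor w [0, 0, 1, 1, 0, 0])
    (n10101 : ¬ IsFactor w [1, 0, 1, 0, 1]) (n10100101 : ¬ IsFactor w [1, 0, 1, 0, 0, 1, 0, 1]) :
    False := by
  obtain ⟨i₀, hi₀⟩ := hI
  have step : ∀ i, OccursAt w [0, 0, 1, 1] i → OccursAt w [0, 0, 1, 1, 0, 1, 0, 0, 1, 1] i :=
    fun i hi => by
      have h1 := ((((hi.right_zero h.n111 (by decide)).right_one n001100 (by decide)).right_zero
        n11011 (by decide)).right_zero n10101 (by decide)).right_one h.n000 (by decide)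
      rcases h1.ext_right with h2 | h2
      · exact absurd (IsFactor.sub ⟨i, h2.right_one n00100 (by decide)⟩ (by decide)) n10100101
      · exact h2
  have key := hi₀.periodic (p := 6) fun i hi =>
    (OccursAt.drop (l := [0, 0, 1, 1, 0, 1]) (step i hi)).2
  refine h.good.not_one (N := 2) (v := (0 : ℕ)) (i₀ := i₀) ⟨i₀ + 0, (hi₀.mem_window
    (by decide)).2 (by decide)⟩ (6, 3) ?_
  intro i j hi hij
  obtain ⟨k, r, hr, rfl⟩ : ∃ k r, r < 6 ∧ i = i₀ + 6 * k + r :=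
    ⟨(i - i₀) / 6, (i - i₀) % 6, by omega, by omega⟩
  have h3 := step _ (key k)
  have hr0 : r = 0 := by
    have := (h3.mem_window (N := 2) (v := 0) (i := r) (by simp; omega)).1 hij.1
    interval_cases r
    · rfl
    all_goals exact absurd this (by decide)
  subst hr0
  have h4 := h3.consec (N := 2) (v := 0) (i := 0) (j := 6) (by decide)
  obtain rfl := hij.unique h4
  have h5 := h3.height (k := 6) (by decide)
  rw [h5, add_zero, Nat.add_sub_cancel_left, add_sub_cancel_left]
  decide

/-- The exclusions for the word and for its exchange of letters together provide the hypotheses of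
`not_period_six`. -/
theorem not_adjacent (h : ShortRuns w) (hI : IsFactor w [0, 0, 1, 1] ∨ IsFactor w [1, 1, 0, 0]) : False := by
  have hI' : IsFactor (flipLetters w) [0, 0, 1, 1] ∨ IsFactor (flipLetters w) [1, 1, 0, 0] :=
    hI.symm.imp isFactor_flip.2 isFactor_flip.2
  have n11011 := h.not_11011 hI
  have n11011' := h.flip.not_11011 hI'
  have n00100 : ¬ IsFactor w [0, 0, 1, 0, 0] := fun h' => n11011' (isFactor_flip.2 h')
  have n00100' : ¬ IsFactor (flipLetters w) [0, 0, 1, 0, 0] := fun h' => n11011 (isFactor_flip.1 h')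
  have h0 : IsFactor w [0, 0, 1, 0] ∨ IsFactor w [0, 1, 0, 0] := by
    by_contra hcon
    push Not at hcon
    exact h.not_isolated hcon.1 hcon.2
  have h1' : IsFactor (flipLetters w) [0, 0, 1, 0] ∨ IsFactor (flipLetters w) [0, 1, 0, 0] := by
    by_contra hcon
    push Not at hcon
    exact h.flip.not_isolated hcon.1 hcon.2
  have h1 : IsFactor w [1, 1, 0, 1] ∨ IsFactor w [1, 0, 1, 1] :=
    h1'.imp isFactor_flip.1 isFactor_flip.1
  have h0' : IsFactor (flipLetters w) [1, 1, 0, 1] ∨ IsFactor (flipLetters w) [1, 0, 1, 1] :=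
    h0.imp isFactor_flip.2 isFactor_flip.2
  obtain ⟨h2, h3, h4⟩ := h.excluded_of_adjacent hI h0 h1 n11011
  obtain ⟨h2', h3', h4'⟩ := h.flip.excluded_of_adjacent hI' h1' h0' n11011'
  rcases hI with hI | hI
  · exact h.not_period_six hI n11011 n00100 h2
      (fun h' => h3' (isFactor_flip.2 h')) fun h' => h4' (isFactor_flip.2 h')
  · exact h.flip.not_period_six (isFactor_flip.2 hI) n11011' n00100' h2'
      (fun h' => h3 (isFactor_flip.1 h')) fun h' => h4 (isFactor_flip.1 h')

/-- The class `(5, 3)` would have the returns `(1, 1)`, `(2, 1)`, `(1, 0)` and a fourth one longer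
than two, because `10010` and its extension contain too few ones. -/
theorem not_11011_of_separated (h : ShortRuns w) (n0011 : ¬ IsFactor w [0, 0, 1, 1])
    (n1100 : ¬ IsFactor w [1, 1, 0, 0]) : ¬ IsFactor w [1, 1, 0, 1, 1] := by
  intro hf
  -- Otherwise `110` repeats with period three, and `00` never comes again.
  have f11010 : IsFactor w [1, 1, 0, 1, 0] := by
    by_contra n11010
    obtain ⟨i₀, hi₀⟩ := hf.right_zero h.n111 (by decide)
    have key := (OccursAt.drop (l := [1, 1, 0]) hi₀).1.periodic (p := 3) fun i hi =>
      (OccursAt.drop (l := [1, 1, 0]) (((hi.right_one n1100 (by decide)).right_one n11010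
        (by decide)).right_zero h.n111 (by decide))).2
    obtain ⟨n, hn, hocc⟩ := h.good.recur.exists_occ h.f00 i₀
    obtain ⟨k, r, hr, rfl⟩ : ∃ k r, r < 3 ∧ n = i₀ + 3 * k + r :=
      ⟨(n - i₀) / 3, (n - i₀) % 3, by omega, by omega⟩
    have h3 := key k
    have h4 := key (k + 1)
    rw [mul_add, mul_one, ← add_assoc] at h4
    simp only [OccursAt, wordAt, List.length_cons, List.length_nil, List.range_succ,
      List.range_zero, List.map_cons, List.map_nil, List.nil_append,
      List.cons_append, List.cons.injEq, and_true] at h3 h4 hocc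
    interval_cases r
    · exact absurd (hocc.1.symm.trans h3.1) (by decide)
    · exact absurd (hocc.1.symm.trans h3.2.1) (by decide)
    · exact absurd (hocc.2.symm.trans h4.1) (by decide)
  have f1 : IsFactor w [1, 0, 1, 1, 0, 1, 1, 0, 1] :=
    ((h.good.left_one (h.good.left_zero hf h.n111 (by decide)) n0011 (by decide)).right_zero
      h.n111 (by decide)).right_one n1100 (by decide)
  have f2 := h.good.left_zero f11010 h.n111 (by decide)
  have f3 := h.good.left_one ((h.f00.right_one h.n000 (by decide)).right_zero n0011 (by decide))
    h.n000 (by decide)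
  have g1 := f1.mem_gaps 5 3 0 1 (by decide)
  have g2 := f1.mem_gaps 5 3 1 3 (by decide)
  have g3 := f2.mem_gaps 5 3 0 1 (by decide)
  have hne : (window w 5 (3 : ℕ)).Nonempty := by
    obtain ⟨p, hp⟩ := f2
    exact ⟨p + 0, (hp.mem_window (by decide)).2 (by decide)⟩
  obtain ⟨n, t, hn, g4⟩ : ∃ n t, 2 < n ∧ (n, t) ∈ gaps w 5 (3 : ℕ) := by
    rcases f3.ext_right with f4 | f4
    · exact h.good.exists_long_gap f4 5 3 2 hne (by decide) (by decide)
    · exact h.good.exists_long_gap f4 5 3 2 hne (by decide) (by decide)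
  refine h.good.not_four g1 g2 g3 g4 (by decide) (by decide) ?_ (by decide) ?_ ?_ <;>
  · intro heq
    have := congrArg Prod.fst heq
    simp only at this
    omega

/-- The class `(3, 1)` would have the returns `(1, 1)`, `(1, 0)`, `(5, 3)` and `(2, 1)`. -/
theorem not_01010_of_separated (h : ShortRuns w) (n0011 : ¬ IsFactor w [0, 0, 1, 1])
    (n1100 : ¬ IsFactor w [1, 1, 0, 0]) (n11011 : ¬ IsFactor w [1, 1, 0, 1, 1]) :
    ¬ IsFactor w [0, 1, 0, 1, 0] := by
  intro hf
  have f1 := (h.f00.right_one h.n000 (by decide)).right_zero n0011 (by decide)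
  have f2 : IsFactor w [0, 1, 0, 1, 1, 0, 1, 0] :=
    h.good.left_zero (h.good.left_one ((h.f0110.right_one n1100 (by decide)).right_zero n11011
      (by decide)) n0011 (by decide)) n11011 (by decide)
  exact h.good.not_four (h.f1001.mem_gaps 3 1 0 1 (by decide)) (f1.mem_gaps 3 1 0 1 (by decide))
    (f2.mem_gaps 3 1 0 5 (by decide)) (hf.mem_gaps 3 1 0 2 (by decide))
    (by decide) (by decide) (by decide) (by decide) (by decide) (by decide)

/-- There are no good words with runs of length one and two for both letters. -/
theorem false (h : ShortRuns w) : False := by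
  have n0011 : ¬ IsFactor w [0, 0, 1, 1] := fun h' => h.not_adjacent (Or.inl h')
  have n1100 : ¬ IsFactor w [1, 1, 0, 0] := fun h' => h.not_adjacent (Or.inr h')
  have m0011 : ¬ IsFactor (flipLetters w) [0, 0, 1, 1] := fun h' => n1100 (isFactor_flip.1 h')
  have m1100 : ¬ IsFactor (flipLetters w) [1, 1, 0, 0] := fun h' => n0011 (isFactor_flip.1 h')
  have n11011 := h.not_11011_of_separated n0011 n1100
  have m11011 := h.flip.not_11011_of_separated m0011 m1100
  have n01010 := h.not_01010_of_separated n0011 n1100 n11011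
  have m01010 := h.flip.not_01010_of_separated m0011 m1100 m11011
  have hex : ∀ l ∈ ([[0, 0, 0], [1, 1, 1], [0, 0, 1, 1], [1, 1, 0, 0], [1, 1, 0, 1, 1],
      [0, 0, 1, 0, 0], [0, 1, 0, 1, 0], [1, 0, 1, 0, 1]] : List (List (Fin 2))),
      ¬ IsFactor w l := by
    simp only [List.mem_cons, List.not_mem_nil, or_false, forall_eq_or_imp, forall_eq]
    exact ⟨h.n000, h.n111, n0011, n1100, n11011, fun h' => m11011 (isFactor_flip.2 h'), n01010,
      fun h' => m01010 (isFactor_flip.2 h')⟩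
  obtain ⟨p, hp⟩ := h.f0110
  refine h.good.not_one (N := 4) (v := (2 : ℕ)) (i₀ := 0) ⟨p + 0, (hp.mem_window
    (by decide)).2 (by decide)⟩ (2, 1) fun i j _ hij => ?_
  have hocc : OccursAt w [w i, w (i + 1), w (i + 2), w (i + 3), w (i + 4), w (i + 5)] i := by
    simp [OccursAt, wordAt, List.range_succ]
  have h1 := (hocc.mem_window (N := 4) (v := 2) (i := 0) (by simp)).1 hij.1
  obtain ⟨h2, h3⟩ := isGap_of_excluded _ _ _ _ _ _ (fun l hl hl' => hex l hl (IsFactor.sub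
    ⟨i, hocc⟩ hl')) (by simpa using h1)
  obtain rfl := hij.unique (hocc.consec h2)
  have h4 := hocc.height (k := 2) (by simp)
  rw [h4, Nat.add_sub_cancel_left, add_sub_cancel_left]
  simp only [ones, List.take_succ_cons, List.take_zero, h3, Nat.cast_one]

end ShortRuns

/-! ### Runs and the coding by single letters -/

/-- A maximal run of `ℓ` letters `x` starts at the position `i + 1`. -/
structure Run (w : ℕ → Fin 2) (x : Fin 2) (i ℓ : ℕ) : Prop where
  pos : 0 < ℓ
  left : w i ≠ x
  mem : ∀ k < ℓ, w (i + 1 + k) = x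
  right : w (i + 1 + ℓ) ≠ x

theorem eq_of_ne_of_ne {x y a : Fin 2} (hxy : x ≠ y) (ha : a ≠ x) : a = y := by
  revert hxy ha; revert x y a; decide

theorem val_eq_of_ne {a x : Fin 2} (h : a ≠ x) : ((a : ℕ) : ℤ) = 1 - ((x : ℕ) : ℤ) := by
  revert h; revert a x; decide

theorem unbounded_of_steps {H : ℕ → ℕ} (hm : Monotone H) (h : ∀ n, ∃ k ≥ n, H k < H (k + 1))
    (M : ℕ) : ∃ x, M ≤ H x := by
  induction M with
  | zero => exact ⟨0, Nat.zero_le _⟩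
  | succ M ih =>
    obtain ⟨x, hx⟩ := ih
    obtain ⟨k, hk, h1⟩ := h x
    have := hm hk
    exact ⟨k + 1, by omega⟩

section

variable {w : ℕ → Fin 2} {x y : Fin 2}

theorem Run.flip {i ℓ : ℕ} (h : Run w x i ℓ) : Run (flipLetters w) x.rev i ℓ :=
  ⟨h.pos, fun h' => h.left (Fin.rev_injective h'), fun k hk => congrArg Fin.rev (h.mem k hk),
    fun h' => h.right (Fin.rev_injective h')⟩

theorem flipLetters_flipLetters (w : ℕ → Fin 2) : flipLetters (flipLetters w) = w := by
  funext i
  exact Fin.rev_rev _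

theorem Run.late {i ℓ : ℕ} (h : Run w x i ℓ) (hw : Recur w) (X : ℕ) : ∃ i' ≥ X, Run w x i' ℓ := by
  obtain ⟨i', h1, h2⟩ := hw i (1 + ℓ + 1) X
  refine ⟨i', h1, h.pos, ?_, fun k hk => ?_, ?_⟩
  · have := h2 0 (by omega)
    simp only [add_zero] at this
    rw [this]
    exact h.left
  · rw [add_assoc, h2 _ (by omega), ← add_assoc]
    exact h.mem k hk
  · rw [add_assoc, h2 _ (by omega), ← add_assoc]
    exact h.right

theorem exists_run (hw : Recur w) (hxy : x ≠ y) (hy : IsFactor w [y]) {n : ℕ}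
    (hn : 0 < n) (h : IsFactor w (List.replicate n x)) : ∃ i ℓ, n ≤ ℓ ∧ Run w x i ℓ := by
  have hyf : ∀ X, ∃ i ≥ X, i ∈ {i | w i ≠ x} := by
    intro X
    obtain ⟨i, h1, h2⟩ := hw.exists_occ hy X
    refine ⟨i, h1, ?_⟩
    have : w i = y := by simpa [OccursAt, wordAt] using h2
    rw [Set.mem_ofPred_eq, this]
    exact hxy.symm
  obtain ⟨p, -, hp⟩ := hyf 0
  obtain ⟨m, hm, hocc⟩ := hw.exists_occ h (p + 1)
  have hx : ∀ k < n, w (m + k) = x := by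
    intro k hk
    have h1 : (wordAt w m (List.replicate n x).length)[k]? = (List.replicate n x)[k]? := by
      rw [hocc]
    simpa [wordAt, hk] using h1
  obtain ⟨q, h1, h2, h3, h4⟩ := exists_last hp (show p ≤ m by omega)
  have hqm : q ≠ m := by
    rintro rfl
    exact h3 (by simpa using hx 0 hn)
  obtain ⟨ℓ, h5, h6⟩ := exists_next hyf q
  have hℓ : m + n ≤ q + ℓ + 1 := by
    by_contra hcon
    rcases Nat.lt_or_ge (q + ℓ + 1) m with h7 | h7
    · exact h4 _ (by omega) h7.le h5
    · obtain ⟨k, hk⟩ := Nat.exists_eq_add_of_le h7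
      rw [hk] at h5
      exact h5 (hx k (by omega))
  refine ⟨q, ℓ, by omega, by omega, h3, fun k hk => ?_, ?_⟩
  · exact not_not.1 (h6 (q + 1 + k) (by omega) (by omega))
  · rw [show q + 1 + ℓ = q + ℓ + 1 by omega]
    exact h5

/-- Every word in which the letter `x` occurs infinitely often is coded by letters. -/
theorem exists_coded (hxy : x ≠ y) (hx : ∀ n, ∃ i ≥ n, w i = x) : ∃ H, Coded [x] [y] H w := by
  have hinf : (Set.ofPred fun i => w i = x).Infinite := by
    rw [Set.infinite_iff_exists_gt]
    intro n
    obtain ⟨i, h1, h2⟩ := hx (n + 1)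
    exact ⟨i, h2, h1⟩
  classical
  set P := Nat.nth (fun i => w i = x) with hP
  have hmono : StrictMono P := Nat.nth_strictMono hinf
  have hPx : ∀ k, w (P k) = x := fun k => Nat.nth_mem_of_infinite hinf k
  have hle : ∀ k, k ≤ P k := fun k => hmono.id_le k
  have hsurj : ∀ n, w n = x → ∃ k, P k = n := fun n hn => ⟨_, Nat.nth_count hn⟩
  -- The letter `x` with index `k` is at position `P k`, so `P k - k` letters `y` precede it.
  refine ⟨fun k => P k - k, monotone_nat_of_le_succ fun k => ?_, fun k => ?_, fun k m h1 h2 => ?_⟩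
  · have := hmono (Nat.lt_add_one k)
    have := hle k
    omega
  · have e : k * [x].length + (P k - k) * [y].length = P k := by
      have := hle k
      simp
      omega
    rw [e]
    simp [OccursAt, wordAt, hPx]
  · have h3 : w (k + m) ≠ x := by
      intro h4
      obtain ⟨n, hn⟩ := hsurj _ h4
      have h5 : n < k := hmono.lt_iff_lt.1 (by omega)
      rcases h1 with h1 | h1
      · omega
      · have h6 : P n ≤ P (k - 1) := hmono.monotone (by omega)
        have := hle (k - 1)
        omega
    have h4 := eq_of_ne_of_ne hxy h3
    simp [OccursAt, wordAt, h4]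

theorem Recur.frequently_of_factor (hw : Recur w) (hx : IsFactor w [x]) (n : ℕ) :
    ∃ i ≥ n, w i = x := by
  obtain ⟨i, h1, h2⟩ := hw.exists_occ hx n
  exact ⟨i, h1, by simpa [OccursAt, wordAt] using h2⟩

theorem Coded.letterA {H : ℕ → ℕ} (h : Coded [x] [y] H w) (k : ℕ) : w (k + H k) = x := by
  simpa [OccursAt, wordAt] using h.occA k

theorem Coded.letterB {H : ℕ → ℕ} (h : Coded [x] [y] H w) {k m : ℕ} (h1 : k = 0 ∨ H (k - 1) ≤ m)
    (h2 : m < H k) : w (k + m) = y := by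
  simpa [OccursAt, wordAt] using h.occB k m h1 h2

theorem Coded.exists_step {H : ℕ → ℕ} (h : Coded [x] [y] H w) (hxy : x ≠ y)
    (hy : ∀ n, ∃ i ≥ n, w i = y) (n : ℕ) : ∃ k ≥ n, H k < H (k + 1) := by
  by_contra hcon
  push Not at hcon
  have hconst : ∀ k ≥ n, H k = H n := by
    intro k hk
    induction k, hk using Nat.le_induction with
    | base => rfl
    | succ k hk ih => exact ((hcon k hk).trans ih.le).antisymm (h.mono (by omega))
  obtain ⟨i, h1, h2⟩ := hy (n + H n)
  have h3 := h.letterA (i - H n)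
  rw [hconst (i - H n) (by omega), Nat.sub_add_cancel (by omega), h2] at h3
  exact hxy h3.symm

theorem const_of_no_step {H : ℕ → ℕ} (hm : Monotone H) {k l : ℕ} (hkl : k ≤ l)
    (h : ∀ t, k ≤ t → t < l → ¬ H t < H (t + 1)) : H l = H k := by
  induction l, hkl using Nat.le_induction with
  | base => rfl
  | succ l hl ih =>
    have h1 := ih fun t h1 h2 => h t h1 (by omega)
    have h2 := h l hl (by omega)
    have := hm (Nat.le_add_right l 1)
    omega

theorem Coded.run {H : ℕ → ℕ} (h : Coded [x] [y] H w) (hxy : x ≠ y) {k l : ℕ}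
    (hkl : Consec {k | H k < H (k + 1)} k l) : Run w x (k + H (k + 1)) (l - k) := by
  obtain ⟨h1, h2, h3, h4⟩ := hkl
  simp only [Set.mem_ofPred_eq] at h1 h2 h4
  have hconst : ∀ t, k < t → t ≤ l → H t = H (k + 1) := fun t h5 h6 =>
    const_of_no_step h.mono (by omega) fun s h7 h8 => h4 s (by omega) (by omega)
  refine ⟨by omega, ?_, fun t ht => ?_, ?_⟩
  · have h5 := h.letterB (k := k + 1) (m := H (k + 1) - 1) (Or.inr (by
      rw [Nat.add_sub_cancel]; omega)) (by omega)
    rw [show k + 1 + (H (k + 1) - 1) = k + H (k + 1) by omega] at h5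
    rw [h5]
    exact hxy.symm
  · have h5 := h.letterA (k + 1 + t)
    rw [hconst _ (by omega) (by omega)] at h5
    rw [← h5]
    congr 1
    omega
  · have h5 := h.letterB (k := l + 1) (m := H l) (Or.inr (by simp)) h2
    rw [hconst l h3 le_rfl] at h5
    rw [show k + H (k + 1) + 1 + (l - k) = l + 1 + H (k + 1) by omega, h5]
    exact hxy.symm

/-- The distances between the steps of `H` are not constant, except for the distance one. -/
theorem Good.not_const_steps {A B V : List (Fin 2)} {c d : Fin 2} {H : ℕ → ℕ} (hw : Good w)
    (hs : StdPair A B V c d) (h : Coded A B H w) {g : ℕ} (hg : 2 ≤ g)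
    (hstep : ∀ n, ∃ k ≥ n, H k < H (k + 1))
    (hgap : ∀ k l, Consec {k | H k < H (k + 1)} k l → l = k + g) : False := by
  obtain ⟨k₀, -, hk₀⟩ := hstep 0
  have hE : ∀ j, H (k₀ + j * g) < H (k₀ + j * g + 1) := by
    intro j
    induction j with
    | zero => simpa using hk₀
    | succ j ih =>
      obtain ⟨n, h1, h2⟩ := exists_next (Z := {k | H k < H (k + 1)}) hstep (k₀ + j * g)
      have h3 := hgap _ _ ⟨ih, h1, by omega, h2⟩
      rw [h3] at h1
      rwa [show k₀ + (j + 1) * g = k₀ + j * g + g by ring]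
  have hN : ∀ j t, k₀ + j * g < t → t < k₀ + j * g + g → ¬ H t < H (t + 1) := by
    intro j
    obtain ⟨n, h1, h2⟩ := exists_next (Z := {k | H k < H (k + 1)}) hstep (k₀ + j * g)
    have h3 := hgap _ _ ⟨hE j, h1, by omega, h2⟩
    intro t h4 h5
    exact h2 t h4 (by omega)
  -- Counted from column `k₀ + 1`, `σ j` is the number of blocks `B` before the group of `g` blocks
  -- `A` with index `j`.
  set σ : ℕ → ℕ := fun j => H (k₀ + 1 + j * g) - H (k₀ + 1) with hσdef
  have hσ : StrictMono σ := by
    apply strictMono_nat_of_lt_succ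
    intro j
    have h1 := hE (j + 1)
    have h2 : H (k₀ + 1 + j * g) ≤ H (k₀ + (j + 1) * g) := h.mono (by rw [add_mul]; omega)
    have h3 : H (k₀ + 1) ≤ H (k₀ + 1 + j * g) := h.mono (by omega)
    simp only [hσdef]
    rw [show k₀ + 1 + (j + 1) * g = k₀ + (j + 1) * g + 1 by ring]
    omega
  have h' := h.tail (k₀ + 1)
  have e : (fun x' => H (k₀ + 1 + x') - H (k₀ + 1)) = fun x => σ (x / g) := by
    funext x
    simp only [hσdef]
    congr 1
    refine const_of_no_step h.mono ?_ fun t h1 h2 => ?_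
    · have := Nat.div_mul_le_self x g
      omega
    · have h3 := Nat.div_add_mod x g
      have h4 := Nat.mod_lt x (show g > 0 by omega)
      rw [mul_comm] at h3
      exact hN (x / g) t (by omega) (by omega)
  rw [e] at h'
  exact (hw.shift _).not_blocks hs h' hσ hg

theorem stdPair_letters (hxy : x ≠ y) : StdPair [x] [y] [] x y :=
  ⟨rfl, rfl, hxy, by simp, by simp, by simp⟩

/-- If all runs of `x` had one length, which is at least two since `xx` occurs, then `x` would come
in equal groups, against `Good.not_const_steps`. -/
theorem Good.exists_two_runs (hw : Good w) (hxy : x ≠ y) (hx : IsFactor w [x, x])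
    (hy : IsFactor w [y]) : ∃ i ℓ i' ℓ', ℓ ≠ ℓ' ∧ Run w x i ℓ ∧ Run w x i' ℓ' := by
  by_contra hcon
  push Not at hcon
  obtain ⟨i₀, g, hg, hrun⟩ := exists_run (n := 2) hw.recur hxy hy (by omega) hx
  obtain ⟨H, h⟩ := exists_coded hxy (hw.recur.frequently_of_factor (hx.sub (l' := [x])
    ⟨[x], [], rfl⟩))
  refine hw.not_const_steps (stdPair_letters hxy) h hg
    (h.exists_step hxy (hw.recur.frequently_of_factor hy)) fun k l hkl => ?_
  have h1 := h.run hxy hkl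
  have h2 : l - k = g := by
    by_contra h3
    exact hcon _ _ _ _ h3 h1 hrun
  have := hkl.2.2.1
  omega

theorem Run.height {i ℓ : ℕ} (h : Run w x i ℓ) {k : ℕ} (hk : k ≤ ℓ) :
    height w (i + 1 + k) = height w i + ((w i : ℕ) : ℤ) + k * ((x : ℕ) : ℤ) := by
  induction k with
  | zero => simp [height_succ]
  | succ k ih =>
    rw [← add_assoc, height_succ, ih (by omega), h.mem k (by omega)]
    push_cast
    ring

end

/-! ### Possible run lengths from the classes `(2, 1)` and `(3, 2)` -/

/-- The class `(2, 1)` marks the ends of runs, so its returns measure run lengths. -/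
theorem mem_window_two {w : ℕ → Fin 2} {k : ℕ} : k ∈ window w 2 1 ↔ w k ≠ w (k + 1) := by
  rw [window, Set.mem_ofPred_eq, show k + 2 = k + 1 + 1 by rfl, height_succ, height_succ,
    add_assoc, add_right_inj]
  generalize w k = a
  generalize w (k + 1) = b
  revert a b
  decide

theorem mem_window_three {w : ℕ → Fin 2} {k : ℕ} : k ∈ window w 3 2 ↔
    ((w k : ℕ) : ℤ) + ((w (k + 1) : ℕ) : ℤ) + ((w (k + 2) : ℕ) : ℤ) = 2 := by
  rw [window, Set.mem_ofPred_eq, show k + 3 = k + 1 + 1 + 1 by rfl, height_succ, height_succ,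
    height_succ]
  constructor <;> intro h <;> linarith

section

variable {w : ℕ → Fin 2} {x : Fin 2}

/-- The return from the letter before the run to the last letter of the run. It has one letter `1`
for a run of zeros and `ℓ - 1` for a run of ones, so runs of different letters give equal returns
only when both have length two. -/
theorem Run.mem_gaps {i ℓ : ℕ} (h : Run w x i ℓ) :
    (ℓ, (1 - ((x : ℕ) : ℤ)) + (ℓ - 1) * ((x : ℕ) : ℤ)) ∈ gaps w 2 1 := by
  have hpos := h.pos
  have h1 : Consec (window w 2 1) i (i + ℓ) := by
    refine ⟨?_, ?_, by omega, fun k h2 h3 h4 => ?_⟩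
    · rw [mem_window_two, show i + 1 = i + 1 + 0 by rfl, h.mem 0 hpos]
      exact h.left
    · rw [mem_window_two]
      have h2 := h.mem (ℓ - 1) (by omega)
      rw [show i + 1 + (ℓ - 1) = i + ℓ by omega] at h2
      rw [h2, show i + ℓ + 1 = i + 1 + ℓ by omega]
      exact h.right.symm
    · rw [mem_window_two] at h4
      apply h4
      have h5 := h.mem (k - (i + 1)) (by omega)
      have h6 := h.mem (k - i) (by omega)
      rw [show i + 1 + (k - (i + 1)) = k by omega] at h5
      rw [show i + 1 + (k - i) = k + 1 by omega] at h6
      rw [h5, h6]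
  have h2 := h1.mem_gaps
  have h3 := h.height (k := ℓ - 1) (by omega)
  rw [show i + 1 + (ℓ - 1) = i + ℓ by omega] at h3
  rw [h3, Nat.add_sub_cancel_left, Nat.cast_sub hpos] at h2
  rw [val_eq_of_ne h.left] at h2
  convert h2 using 2
  push_cast
  ring

/-- The class `(3, 2)` sees the run as `011` at its beginning and as `110` at its end. -/
theorem Run.mem_gaps_ones {i ℓ : ℕ} (h : Run w 1 i ℓ) (hℓ : 2 ≤ ℓ) :
    (ℓ - 1, (ℓ : ℤ) - 2) ∈ gaps w 3 2 := by
  have h0 : w i = 0 := eq_of_ne_of_ne (by decide) h.left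
  have hend : w (i + ℓ + 1) = 0 := by
    have := h.right
    rw [show i + ℓ + 1 = i + 1 + ℓ by omega]
    exact eq_of_ne_of_ne (by decide) this
  have hval : ∀ k, i < k → k ≤ i + ℓ → w k = 1 := by
    intro k h1 h2
    have := h.mem (k - (i + 1)) (by omega)
    rwa [show i + 1 + (k - (i + 1)) = k by omega] at this
  have h1 : Consec (window w 3 2) i (i + (ℓ - 1)) := by
    refine ⟨?_, ?_, by omega, fun k h2 h3 h4 => ?_⟩
    · rw [mem_window_three, h0, hval (i + 1) (by omega) (by omega),
        hval (i + 2) (by omega) (by omega)]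
      rfl
    · rw [mem_window_three, hval _ (by omega) (by omega), hval (i + (ℓ - 1) + 1) (by omega)
        (by omega), show i + (ℓ - 1) + 2 = i + ℓ + 1 by omega, hend]
      rfl
    · rw [mem_window_three, hval _ (by omega) (by omega), hval (k + 1) (by omega) (by omega),
        hval (k + 2) (by omega) (by omega)] at h4
      exact absurd h4 (by decide)
  have h2 := h1.mem_gaps
  have h3 := h.height (k := ℓ - 2) (by omega)
  rw [show i + 1 + (ℓ - 2) = i + (ℓ - 1) by omega, h0, Nat.cast_sub hℓ] at h3
  rw [h3, Nat.add_sub_cancel_left] at h2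
  convert h2 using 2
  push_cast
  simp

/-- Without `010` the run of zeros lies between two blocks `11`, and the return leads from `110`
before it to `011` after it. -/
theorem Run.mem_gaps_zeros {i ℓ : ℕ} (hw : Recur w) (h : Run w 0 i ℓ) (hℓ : 2 ≤ ℓ)
    (n010 : ¬ IsFactor w [0, 1, 0]) : (ℓ + 1, (2 : ℤ)) ∈ gaps w 3 2 := by
  obtain ⟨i, hi, h⟩ := h.late hw 1
  obtain ⟨i, rfl⟩ : ∃ i', i = i' + 1 := ⟨i - 1, by omega⟩
  have h0 : w (i + 1) = 1 := eq_of_ne_of_ne (by decide) h.left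
  have hend : w (i + ℓ + 2) = 1 := by
    rw [show i + ℓ + 2 = i + 1 + 1 + ℓ by omega]
    exact eq_of_ne_of_ne (by decide) h.right
  have hval : ∀ k, i + 1 < k → k ≤ i + 1 + ℓ → w k = 0 := by
    intro k h1 h2
    have := h.mem (k - (i + 1 + 1)) (by omega)
    rwa [show i + 1 + 1 + (k - (i + 1 + 1)) = k by omega] at this
  have hpat : ∀ k, w k = 0 → w (k + 1) = 1 → w (k + 2) ≠ 0 := by
    intro k h1 h2 h3
    exact n010 ⟨k, by simp [OccursAt, wordAt, List.range_succ, h1, h2, h3]⟩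
  have hl : w i = 1 := by
    refine eq_of_ne_of_ne (x := 0) (by decide) fun h1 => hpat i h1 h0 (hval _ (by omega) (by omega))
  have hr : w (i + ℓ + 3) = 1 := by
    refine eq_of_ne_of_ne (x := 0) (by decide) fun h1 => hpat (i + ℓ + 1)
      (hval _ (by omega) (by omega)) hend h1
  have h1 : Consec (window w 3 2) i (i + (ℓ + 1)) := by
    refine ⟨?_, ?_, by omega, fun k h2 h3 h4 => ?_⟩
    · rw [mem_window_three, hl, h0, hval (i + 2) (by omega) (by omega)]
      rfl
    · rw [mem_window_three, hval _ (by omega) (by omega),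
        show i + (ℓ + 1) + 1 = i + ℓ + 2 by omega, show i + (ℓ + 1) + 2 = i + ℓ + 3 by omega,
        hend, hr]
      rfl
    · rw [mem_window_three] at h4
      rcases Nat.lt_or_ge k (i + 2) with h5 | h5
      · obtain rfl : k = i + 1 := by omega
        rw [hval (i + 1 + 1) (by omega) (by omega), hval (i + 1 + 2) (by omega) (by omega),
          h0] at h4
        exact absurd h4 (by decide)
      · rw [hval k (by omega) (by omega), hval (k + 1) (by omega) (by omega)] at h4
        have := letter_bounds (w (k + 2))
        simp at h4
        omega
  have h2 := h1.mem_gaps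
  have h3 := h.height (k := ℓ) le_rfl
  rw [show i + 1 + 1 + ℓ = i + (ℓ + 1) + 1 by omega, height_succ,
    hval (i + (ℓ + 1)) (by omega) (by omega), h0, height_succ, hl] at h3
  simp at h3
  rw [h3, Nat.add_sub_cancel_left] at h2
  convert h2 using 2
  ring

/-- Runs have length one or two. -/
structure ShortType (w : ℕ → Fin 2) (x y : Fin 2) : Prop where
  not_three : ¬ IsFactor w [x, x, x]
  one : IsFactor w [y, x, y]
  two : IsFactor w [x, x]

/-- Runs have length two or four. -/
structure EvenType (w : ℕ → Fin 2) (x y : Fin 2) : Prop where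
  even : ∀ i ℓ, Run w x i ℓ → Even ℓ
  not_six : ¬ IsFactor w [x, x, x, x, x, x]
  two : IsFactor w [y, x, x, y]
  four : IsFactor w [y, x, x, x, x, y]

theorem ShortType.flip {x y : Fin 2} (h : ShortType (flipLetters w) x y) :
    ShortType w x.rev y.rev :=
  ⟨fun h' => h.not_three (isFactor_flip.2 h'), isFactor_flip.1 h.one, isFactor_flip.1 h.two⟩

theorem EvenType.flip {x y : Fin 2} (h : EvenType (flipLetters w) x y) :
    EvenType w x.rev y.rev :=
  ⟨fun i ℓ h' => h.even i ℓ (by simpa using h'.flip), fun h' => h.not_six (isFactor_flip.2 h'),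
    isFactor_flip.1 h.two, isFactor_flip.1 h.four⟩

theorem Run.isFactor {y : Fin 2} (hxy : x ≠ y) {i ℓ : ℕ} (h : Run w x i ℓ) :
    IsFactor w (y :: List.replicate ℓ x ++ [y]) := by
  refine ⟨i, ?_⟩
  have h1 : OccursAt w (y :: List.replicate ℓ x) i := by
    rw [OccursAt, List.length_cons, List.length_replicate, add_comm, wordAt_add]
    have h2 : wordAt w (i + 1) ℓ = List.replicate ℓ x := by
      apply List.ext_getElem
      · simp [length_wordAt]
      · intro k h3 h4
        simp only [List.length_replicate] at h4
        simp [wordAt, h.mem k h4]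
    rw [h2]
    simp [wordAt, eq_of_ne_of_ne hxy h.left]
  apply h1.append
  rw [List.length_cons, List.length_replicate, show i + (ℓ + 1) = i + 1 + ℓ by omega]
  simp [OccursAt, wordAt, eq_of_ne_of_ne hxy h.right]

/-- Each letter has at least two run lengths, but the class `(2, 1)` has at most three returns. So
the coincidence at length two takes place, and the ones have just one further length `b`. If `b ≥
3`, the class `(3, 2)` forces `b = 4`. -/
theorem Good.ones_type (hw : Good w) (f00 : IsFactor w [0, 0]) (f11 : IsFactor w [1, 1]) :
    ShortType w 1 0 ∨ EvenType w 1 0 := by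
  have f0 : IsFactor w [0] := f00.sub (by decide)
  have f1 : IsFactor w [1] := f11.sub (by decide)
  have gz : ∀ {i ℓ}, Run w 0 i ℓ → (ℓ, (1 : ℤ)) ∈ gaps w 2 1 := fun h => by
    simpa using h.mem_gaps
  have go : ∀ {i ℓ}, Run w 1 i ℓ → (ℓ, (ℓ : ℤ) - 1) ∈ gaps w 2 1 := fun h => by
    simpa using h.mem_gaps
  obtain ⟨i₁, l₁, i₂, l₂, hl, r₁, r₂⟩ := hw.exists_two_runs (by decide) f00 f1
  obtain ⟨j₁, m₁, j₂, m₂, hm, s₁, s₂⟩ := hw.exists_two_runs (by decide) f11 f0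
  have h2 : (∃ i, Run w 0 i 2) ∧ ∃ i, Run w 1 i 2 := by
    by_contra hcon
    have hne : ∀ {i l j m}, Run w 0 i l → Run w 1 j m → ((l, (1 : ℤ)) : ℕ × ℤ) ≠ (m, (m : ℤ) - 1) := by
      intro i l j m h3 h4 h5
      obtain ⟨h6, h7⟩ := Prod.mk.inj h5
      obtain rfl : m = 2 := by omega
      subst h6
      exact hcon ⟨⟨_, h3⟩, ⟨_, h4⟩⟩
    exact hw.not_four (gz r₁) (gz r₂) (go s₁) (go s₂) (by simp [hl]) (hne r₁ s₁) (hne r₁ s₂)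
      (hne r₂ s₁) (hne r₂ s₂) (by simp [hm])
  obtain ⟨⟨i, hz2⟩, ⟨j, ho2⟩⟩ := h2
  obtain ⟨i', a, ha, hza⟩ : ∃ i' a, a ≠ 2 ∧ Run w 0 i' a := by
    by_cases h : l₁ = 2
    · exact ⟨i₂, l₂, by omega, r₂⟩
    · exact ⟨i₁, l₁, h, r₁⟩
  obtain ⟨j', b, hb, hob⟩ : ∃ j' b, b ≠ 2 ∧ Run w 1 j' b := by
    by_cases h : m₁ = 2
    · exact ⟨j₂, m₂, by omega, s₂⟩
    · exact ⟨j₁, m₁, h, s₁⟩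
  have hones : ∀ i ℓ, Run w 1 i ℓ → ℓ = 2 ∨ ℓ = b := by
    intro i ℓ h
    by_contra hcon
    push Not at hcon
    refine hw.not_four (gz hza) (go ho2) (go hob) (go h) ?_ ?_ ?_ ?_ ?_ ?_ <;>
    · intro heq
      obtain ⟨h6, h7⟩ := Prod.mk.inj heq
      omega
  have f0110 : IsFactor w [0, 1, 1, 0] := ho2.isFactor (by decide)
  have f1001 : IsFactor w [1, 0, 0, 1] := hz2.isFactor (by decide)
  have hb0 := hob.pos
  have ha0 := hza.pos
  have hlong : ∀ n > 0, IsFactor w (List.replicate n 1) → n ≤ 2 ∨ n ≤ b := by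
    intro n hn h
    obtain ⟨i, ℓ, h3, h4⟩ := exists_run hw.recur (by decide) f0 hn h
    rcases hones _ _ h4 with h5 | h5 <;> omega
  rcases Nat.lt_or_ge b 3 with hb3 | hb3
  · left
    obtain rfl : b = 1 := by omega
    refine ⟨fun h => ?_, hob.isFactor (by decide), f11⟩
    have := hlong 3 (by omega) h
    omega
  · right
    have n010 : ¬ IsFactor w [0, 1, 0] := by
      rintro ⟨i, hi⟩
      have h3 : w i = 0 ∧ w (i + 1) = 1 ∧ w (i + 2) = 0 := by
        simpa [OccursAt, wordAt, List.range_succ] using hi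
      have h4 : Run w 1 i 1 := ⟨by omega, by rw [h3.1]; decide, fun k hk => by
        obtain rfl : k = 0 := by omega
        exact h3.2.1, by rw [show i + 1 + 1 = i + 2 by rfl, h3.2.2]; decide⟩
      rcases hones _ _ h4 with h5 | h5 <;> omega
    -- The returns `(1, 0)`, `(b - 1, b - 2)`, `(3, 2)` and one coming from the other length of zero
    -- runs would be distinct; for `b = 4` the second and third coincide.
    have hb4 : b = 4 := by
      by_contra hb4
      have g1 := ho2.mem_gaps_ones le_rfl
      have g2 := hob.mem_gaps_ones (by omega)
      have g3 := hz2.mem_gaps_zeros hw.recur le_rfl n010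
      rcases Nat.lt_or_ge a 2 with ha2 | ha2
      · obtain rfl : a = 1 := by omega
        have f101 : IsFactor w [1, 0, 1] := hza.isFactor (by decide)
        have g4 := (f101.right_one n010 (by decide)).sub (l' := [1, 0, 1, 1]) (by decide)
        have g5 := g4.mem_gaps 3 2 0 1 (by decide)
        refine hw.not_four g1 g2 g3 g5 ?_ ?_ ?_ ?_ ?_ ?_ <;>
        · intro heq
          obtain ⟨h6, h7⟩ := Prod.mk.inj heq
          simp at h6 h7
          try omega
      · have g4 := hza.mem_gaps_zeros hw.recur ha2 n010
        refine hw.not_four g1 g2 g3 g4 ?_ ?_ ?_ ?_ ?_ ?_ <;>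
        · intro heq
          obtain ⟨h6, h7⟩ := Prod.mk.inj heq
          omega
    subst hb4
    refine ⟨fun i ℓ h => ?_, fun h => ?_, f0110, hob.isFactor (by decide)⟩
    · rcases hones _ _ h with rfl | rfl <;> decide
    · have := hlong 6 (by omega) h
      omega

end

/-! ### Merging pairs of zeros -/

/-- The number of letters until the next letter `1` is even. -/
def EvenTail (w : ℕ → Fin 2) (p : ℕ) : Prop :=
  ∀ n ≥ p, w n = 1 → (∀ k, p ≤ k → k < n → w k = 0) → Even (n - p)

/-- The positions of the letters of `w` after merging pairs of zeros. -/
def mergePos (w : ℕ → Fin 2) : ℕ → ℕ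
  | 0 => 0
  | i + 1 => mergePos w i + if w (mergePos w i) = 0 then 2 else 1

/-- The word obtained by merging pairs of zeros. -/
def merge (w : ℕ → Fin 2) (i : ℕ) : Fin 2 := w (mergePos w i)

/-- The finite word obtained by doubling all zeros. -/
def double (l : List (Fin 2)) : List (Fin 2) := l.flatMap fun a => if a = 0 then [0, 0] else [1]

theorem letter_cases (a : Fin 2) : a = 0 ∨ a = 1 := by
  revert a; decide

theorem occursAt_cons {A : Type*} {w : ℕ → A} {a : A} {l : List A} {i : ℕ} :
    OccursAt w (a :: l) i ↔ w i = a ∧ OccursAt w l (i + 1) := by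
  rw [OccursAt, List.length_cons, add_comm l.length, wordAt_add]
  simp [wordAt, OccursAt]

theorem occursAt_nil {A : Type*} {w : ℕ → A} {i : ℕ} : OccursAt w [] i := rfl

/-- All maximal blocks of zeros have even length. -/
structure EvenWord (w : ℕ → Fin 2) : Prop where
  zero : EvenTail w 0
  succ : ∀ p, w p = 1 → EvenTail w (p + 1)

namespace EvenWord

variable {w : ℕ → Fin 2}

/-- The merged positions stay aligned with the pairs of zeros: none falls in the middle of a pair.
-/
theorem evenTail (h : EvenWord w) (i : ℕ) : EvenTail w (mergePos w i) := by
  induction i with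
  | zero => exact h.zero
  | succ i ih =>
    rw [mergePos]
    rcases letter_cases (w (mergePos w i)) with h1 | h1
    · rw [if_pos h1]
      intro n h2 h3 h4
      have h5 : w (mergePos w i + 1) = 0 := by
        rcases letter_cases (w (mergePos w i + 1)) with h6 | h6
        · exact h6
        · have := ih _ (Nat.le_add_right _ 1) h6 fun k h7 h8 => by
            rwa [show k = mergePos w i by omega]
          rw [Nat.add_sub_cancel_left] at this
          exact absurd this (by decide)
      have h6 := ih n (by omega) h3 fun k h7 h8 => by
        rcases Nat.lt_or_ge k (mergePos w i + 2) with h9 | h9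
        · rcases Nat.lt_or_ge k (mergePos w i + 1) with h10 | h10
          · rwa [show k = mergePos w i by omega]
          · rwa [show k = mergePos w i + 1 by omega]
        · exact h4 k h9 h8
      rw [show n - mergePos w i = n - (mergePos w i + 2) + 2 by omega] at h6
      exact (Nat.even_add.1 h6).2 (by decide)
    · rw [if_neg (by rw [h1]; decide)]
      exact h.succ _ h1

theorem zero_succ (h : EvenWord w) {i : ℕ} (h1 : w (mergePos w i) = 0) : w (mergePos w i + 1) = 0 := by
  rcases letter_cases (w (mergePos w i + 1)) with h6 | h6
  · exact h6
  · have := h.evenTail i _ (Nat.le_add_right _ 1) h6 fun k h7 h8 => by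
      rwa [show k = mergePos w i by omega]
    rw [Nat.add_sub_cancel_left] at this
    exact absurd this (by decide)

theorem mergePos_zero {i : ℕ} (h1 : merge w i = 0) : mergePos w (i + 1) = mergePos w i + 2 := by
  rw [mergePos, if_pos (show w (mergePos w i) = 0 from h1)]

theorem mergePos_one {i : ℕ} (h1 : merge w i = 1) : mergePos w (i + 1) = mergePos w i + 1 := by
  rw [mergePos, if_neg]
  rw [show w (mergePos w i) = 1 from h1]
  decide

theorem mergePos_strictMono : StrictMono (mergePos w) := by
  apply strictMono_nat_of_lt_succ
  intro i
  rw [mergePos]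
  split_ifs <;> omega

theorem height_mergePos (h : EvenWord w) (i : ℕ) : height w (mergePos w i) = height (merge w) i := by
  induction i with
  | zero => simp [mergePos, height_zero]
  | succ i ih =>
    rw [height_succ]
    rcases letter_cases (merge w i) with h1 | h1
    · have h2 := h.zero_succ h1
      rw [mergePos_zero h1, show mergePos w i + 2 = mergePos w i + 1 + 1 by rfl, height_succ,
        height_succ, ih, h2, h1,
        show w (mergePos w i) = 0 from h1]
      simp
    · rw [mergePos_one h1, height_succ, ih, h1, show w (mergePos w i) = 1 from h1]

theorem mergePos_eq (i : ℕ) : (mergePos w i : ℤ) = 2 * i - height (merge w) i := by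
  induction i with
  | zero => simp [mergePos, height_zero]
  | succ i ih =>
    rw [height_succ]
    rcases letter_cases (merge w i) with h1 | h1
    · rw [mergePos_zero h1, h1]
      push_cast
      simp
      linarith
    · rw [mergePos_one h1, h1]
      push_cast
      simp
      linarith

theorem exists_mergePos (n : ℕ) :
    ∃ k, n = mergePos w k ∨ (n = mergePos w k + 1 ∧ merge w k = 0) := by
  induction n with
  | zero => exact ⟨0, Or.inl rfl⟩
  | succ n ih =>
    obtain ⟨k, rfl | ⟨rfl, hk⟩⟩ := ih
    · rcases letter_cases (merge w k) with h1 | h1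
      · exact ⟨k, Or.inr ⟨rfl, h1⟩⟩
      · exact ⟨k + 1, Or.inl (mergePos_one h1).symm⟩
    · exact ⟨k + 1, Or.inl (mergePos_zero hk).symm⟩

theorem occursAt_double (h : EvenWord w) {l : List (Fin 2)} {i : ℕ} :
    OccursAt (merge w) l i ↔ OccursAt w (double l) (mergePos w i) := by
  induction l generalizing i with
  | nil => exact ⟨fun _ => occursAt_nil, fun _ => occursAt_nil⟩
  | cons a l ih =>
    rw [occursAt_cons, ih]
    rcases letter_cases a with rfl | rfl
    · have e : double (0 :: l) = 0 :: 0 :: double l := rfl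
      rw [e, occursAt_cons, occursAt_cons]
      constructor
      · rintro ⟨h1, h2⟩
        rw [mergePos_zero h1] at h2
        exact ⟨h1, h.zero_succ h1, h2⟩
      · rintro ⟨h1, h2, h3⟩
        refine ⟨h1, ?_⟩
        rwa [mergePos_zero h1]
    · have e : double (1 :: l) = 1 :: double l := rfl
      rw [e, occursAt_cons]
      refine and_congr_right fun h1 => ?_
      rw [mergePos_one h1]

/-- A letter `1` in `l` fixes the parity, so a doubled word occurs only in alignment with the pairs.
-/
theorem even_of_double {l : List (Fin 2)} (hl : (1 : Fin 2) ∈ l) {p j : ℕ} (hp : EvenTail w p)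
    (hpj : p ≤ j) (hz : ∀ k, p ≤ k → k < j → w k = 0) (hocc : OccursAt w (double l) j) :
    Even (j - p) := by
  induction l generalizing j with
  | nil => simp at hl
  | cons a l ih =>
    rcases letter_cases a with rfl | rfl
    · have e : double (0 :: l) = 0 :: 0 :: double l := rfl
      rw [e, occursAt_cons, occursAt_cons] at hocc
      obtain ⟨h1, h2, h3⟩ := hocc
      have h4 := ih (by simpa using hl) (by omega) (fun k h5 h6 => by
        rcases Nat.lt_or_ge k j with h7 | h7
        · exact hz k h5 h7
        · rcases Nat.lt_or_ge k (j + 1) with h8 | h8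
          · rwa [show k = j by omega]
          · rwa [show k = j + 1 by omega]) h3
      rw [show j + 1 + 1 - p = j - p + 2 by omega] at h4
      exact (Nat.even_add.1 h4).2 (by decide)
    · have e : double (1 :: l) = 1 :: double l := rfl
      rw [e, occursAt_cons] at hocc
      exact hp j hpj hocc.1 hz

theorem exists_of_double (h : EvenWord w) {l : List (Fin 2)} (hl : (1 : Fin 2) ∈ l) {j : ℕ}
    (hocc : OccursAt w (double l) j) : ∃ i, mergePos w i = j ∧ OccursAt (merge w) l i := by
  obtain ⟨k, rfl | ⟨rfl, hk⟩⟩ := exists_mergePos (w := w) j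
  · exact ⟨k, rfl, h.occursAt_double.2 hocc⟩
  · have := even_of_double hl (h.evenTail k) (Nat.le_add_right _ 1) (fun n h1 h2 => by
      rw [show n = mergePos w k by omega]
      exact hk) hocc
    rw [Nat.add_sub_cancel_left] at this
    exact absurd this (by decide)

theorem isFactor_double (h : EvenWord w) {l : List (Fin 2)} (hl : IsFactor (merge w) l) :
    IsFactor w (double l) := by
  obtain ⟨i, hi⟩ := hl
  exact ⟨_, h.occursAt_double.1 hi⟩

theorem isFactor_of_double (h : EvenWord w) {l : List (Fin 2)} (hl : (1 : Fin 2) ∈ l)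
    (hf : IsFactor w (double l)) : IsFactor (merge w) l := by
  obtain ⟨j, hj⟩ := hf
  obtain ⟨i, -, hi⟩ := h.exists_of_double hl hj
  exact ⟨i, hi⟩

theorem mergePos_le (i : ℕ) : mergePos w i ≤ 2 * i := by
  induction i with
  | zero => simp [mergePos]
  | succ i ih =>
    rw [mergePos]
    split_ifs <;> omega

theorem recur (h : EvenWord w) (hw : Recur w) (h1 : IsFactor w [1]) : Recur (merge w) := by
  intro i n X
  -- The block is prolonged up to a letter `1`, so that its late occurrences in `w` are aligned and
  -- come from the merged word.
  obtain ⟨m, hm, hm1⟩ := hw.frequently_of_factor h1 (2 * (i + n))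
  obtain ⟨k, rfl | ⟨rfl, hk⟩⟩ := exists_mergePos (w := w) m
  · have hik : i + n ≤ k := by
      have := mergePos_le (w := w) k
      omega
    have hocc : OccursAt (merge w) (wordAt (merge w) i (k + 1 - i)) i := by
      simp [OccursAt, length_wordAt]
    have hmem : (1 : Fin 2) ∈ wordAt (merge w) i (k + 1 - i) := by
      refine List.mem_map.2 ⟨k - i, List.mem_range.2 (by omega), ?_⟩
      rw [Nat.add_sub_cancel' (by omega)]
      exact hm1
    obtain ⟨j, hj, hocc'⟩ := hw.exists_occ ⟨_, h.occursAt_double.1 hocc⟩ (2 * X)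
    obtain ⟨i', rfl, hi'⟩ := h.exists_of_double hmem hocc'
    refine ⟨i', ?_, ?_⟩
    · have := mergePos_le (w := w) i'
      omega
    · rw [OccursAt, length_wordAt, wordAt_eq_iff] at hi'
      exact fun t ht => hi' t (by omega)
  · rw [h.zero_succ hk] at hm1
    exact absurd hm1 (by decide)

/-- `M = 2N - v` is the length of a block of `N` letters with `v` ones after its zeros are doubled.
-/
theorem mem_window_iff (h : EvenWord w) {N M : ℕ} {v : ℤ} (hM : (M : ℤ) = 2 * N - v) (i : ℕ) :
    mergePos w i ∈ window w M v ↔ i ∈ window (merge w) N v := by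
  simp only [window, Set.mem_ofPred_eq]
  have h1 := mergePos_eq (w := w) i
  have h2 := mergePos_eq (w := w) (i + N)
  have h3 := h.height_mergePos i
  have h4 := h.height_mergePos (i + N)
  constructor
  · intro h5
    obtain ⟨k, h6 | ⟨h6, h7⟩⟩ := exists_mergePos (w := w) (mergePos w i + M)
    · rw [h6, h.height_mergePos, h3] at h5
      have h8 := mergePos_eq (w := w) k
      have : k = i + N := by omega
      rw [← this, h5]
    · rw [h6, height_succ, show w (mergePos w k) = 0 from h7, h.height_mergePos, h3] at h5
      have h8 := mergePos_eq (w := w) k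
      simp at h5
      omega
  · intro h5
    have : mergePos w i + M = mergePos w (i + N) := by
      push_cast at h2
      omega
    rw [this, h4, h3, h5]

/-- An occurrence that starts in the middle of a pair of zeros must also end in the middle of a
pair. -/
theorem mem_window_mid (h : EvenWord w) {N M : ℕ} {v : ℤ} (hM : (M : ℤ) = 2 * N - v) {i : ℕ}
    (hi : merge w i = 0) :
    mergePos w i + 1 ∈ window w M v ↔ i ∈ window (merge w) N v ∧ merge w (i + N) = 0 := by
  simp only [window, Set.mem_ofPred_eq]
  have h1 := mergePos_eq (w := w) i
  have h2 := mergePos_eq (w := w) (i + N)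
  have h3 := h.height_mergePos i
  have h4 := h.height_mergePos (i + N)
  have h3' : height w (mergePos w i + 1) = height (merge w) i := by
    rw [height_succ, show w (mergePos w i) = 0 from hi, h3]
    simp
  rw [h3']
  constructor
  · intro h5
    obtain ⟨k, h6 | ⟨h6, h7⟩⟩ := exists_mergePos (w := w) (mergePos w i + 1 + M)
    · rw [h6, h.height_mergePos] at h5
      have h8 := mergePos_eq (w := w) k
      omega
    · rw [h6, height_succ, show w (mergePos w k) = 0 from h7, h.height_mergePos] at h5
      have h8 := mergePos_eq (w := w) k
      simp at h5
      have : k = i + N := by omega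
      rw [← this]
      exact ⟨h5, h7⟩
  · rintro ⟨h5, h6⟩
    have : mergePos w i + 1 + M = mergePos w (i + N) + 1 := by
      push_cast at h2
      omega
    rw [this, height_succ, show w (mergePos w (i + N)) = 0 from h6, h4, h5]
    simp

/-- Only a return consisting of a single `0` behaves differently: doubling splits it into two
returns `0`. Elsewhere an intermediate occurrence in the middle of a pair would imply occurrences on
both sides of that `0`. -/
theorem consec (h : EvenWord w) {N M : ℕ} {v : ℤ} (hM : (M : ℤ) = 2 * N - v) {k l : ℕ}
    (hkl : Consec (window (merge w) N v) k l) :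
    ((l = k + 1 ∧ merge w k = 0) ∧
      Consec (window w M v) (mergePos w k) (mergePos w k + 1) ∧
      Consec (window w M v) (mergePos w k + 1) (mergePos w k + 2)) ∨
    (¬ (l = k + 1 ∧ merge w k = 0) ∧ Consec (window w M v) (mergePos w k) (mergePos w l)) := by
  obtain ⟨hk, hl, hlt, hno⟩ := hkl
  by_cases hc : l = k + 1 ∧ merge w k = 0
  · obtain ⟨rfl, hc⟩ := hc
    have h1 : merge w (k + N) = 0 := by
      have h2 : height (merge w) (k + N) = height (merge w) k + v := hk
      have h3 : height (merge w) (k + 1 + N) = height (merge w) (k + 1) + v := hl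
      rw [show k + 1 + N = k + N + 1 by ring, height_succ, height_succ, hc] at h3
      exact letter_eq_of_val (by linarith)
    refine Or.inl ⟨⟨rfl, hc⟩, ⟨(h.mem_window_iff hM k).2 hk,
      (h.mem_window_mid hM hc).2 ⟨hk, h1⟩, by omega, fun _ _ _ => by omega⟩,
      ⟨(h.mem_window_mid hM hc).2 ⟨hk, h1⟩, ?_, by omega, fun _ _ _ => by omega⟩⟩
    rw [← mergePos_zero hc]
    exact (h.mem_window_iff hM _).2 hl
  · refine Or.inr ⟨hc, (h.mem_window_iff hM k).2 hk, (h.mem_window_iff hM l).2 hl,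
      mergePos_strictMono hlt, fun n h1 h2 h3 => ?_⟩
    obtain ⟨m, rfl | ⟨rfl, hm⟩⟩ := exists_mergePos (w := w) n
    · exact hno m (mergePos_strictMono.lt_iff_lt.1 h1) (mergePos_strictMono.lt_iff_lt.1 h2)
        ((h.mem_window_iff hM m).1 h3)
    · obtain ⟨h4, h5⟩ := (h.mem_window_mid hM hm).1 h3
      have h6 : m + 1 ∈ window (merge w) N v := by
        have h4' : height (merge w) (m + N) = height (merge w) m + v := h4
        show height (merge w) (m + 1 + N) = height (merge w) (m + 1) + v
        rw [show m + 1 + N = m + N + 1 by ring, height_succ, height_succ, h4', hm, h5]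
        ring
      have h7 : k ≤ m := by
        by_contra hcon
        have h8 : mergePos w (m + 1) ≤ mergePos w k :=
          mergePos_strictMono.monotone (by omega)
        rw [mergePos_zero hm] at h8
        omega
      have h8 : m < l := (mergePos_strictMono (w := w)).lt_iff_lt.1 (by omega)
      obtain rfl : m = k := by
        by_contra hcon
        exact hno m (by omega) h8 h4
      have h9 : l = m + 1 := by
        by_contra hcon
        exact hno (m + 1) (by omega) (by omega) h6
      exact hc ⟨h9, hm⟩

theorem height_bounds (w : ℕ → Fin 2) (i n : ℕ) :
    height w i ≤ height w (i + n) ∧ height w (i + n) ≤ height w i + n := by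
  refine ⟨height_mono w (Nat.le_add_right _ _), ?_⟩
  induction n with
  | zero => simp
  | succ n ih =>
    rw [← add_assoc, height_succ]
    have := letter_bounds (w (i + n))
    push_cast
    linarith

/-- Merging pairs of zeros induces a bijection of abelian returns. -/
theorem good (h : EvenWord w) (hw : Good w) (h1 : IsFactor w [1]) : Good (merge w) := by
  have hrec := h.recur hw.recur h1
  refine ⟨hrec, fun N v hne => ?_⟩
  obtain ⟨i₁, hi₁⟩ := hne
  obtain ⟨M, hM⟩ : ∃ M : ℕ, (M : ℤ) = 2 * N - v := by
    have h2 := height_bounds (merge w) i₁ N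
    have h3 : height (merge w) (i₁ + N) = height (merge w) i₁ + v := hi₁
    exact ⟨(2 * N - v).toNat, Int.toNat_of_nonneg (by linarith)⟩
  -- A return of `n` letters with `t` ones gets the length `2n - t`, except that a single `0` stays
  -- a single `0`.
  set T : ℕ × ℤ → ℕ × ℤ := fun p => if p = (1, 0) then p else ((2 * (p.1 : ℤ) - p.2).toNat, p.2)
    with hT
  have hzero : ∀ k, merge w k = 0 →
      (k + 1 - k, height (merge w) (k + 1) - height (merge w) k) = (1, (0 : ℤ)) := by
    intro k hk
    rw [height_succ, hk, Nat.add_sub_cancel_left]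
    simp
  have hother : ∀ k l, k < l → ¬ (l = k + 1 ∧ merge w k = 0) →
      T (l - k, height (merge w) l - height (merge w) k) =
        (mergePos w l - mergePos w k, height w (mergePos w l) - height w (mergePos w k)) := by
    intro k l hlt hc
    have hne : ((l - k, height (merge w) l - height (merge w) k) : ℕ × ℤ) ≠ (1, 0) := by
      intro heq
      obtain ⟨h2, h3⟩ := Prod.mk.inj heq
      obtain rfl : l = k + 1 := by omega
      rw [height_succ] at h3
      exact hc ⟨rfl, letter_eq_of_val (by simpa using h3)⟩
    rw [hT]
    simp only [if_neg hne]
    rw [h.height_mergePos, h.height_mergePos]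
    congr 1
    have h2 := mergePos_eq (w := w) k
    have h3 := mergePos_eq (w := w) l
    have h4 : mergePos w k < mergePos w l := mergePos_strictMono hlt
    omega
  have himage : gaps w M v = T '' gaps (merge w) N v := by
    ext p
    constructor
    · rintro ⟨i, j, hij, rfl⟩
      obtain ⟨k, rfl | ⟨rfl, hk⟩⟩ := exists_mergePos (w := w) i
      · obtain ⟨l, hkl⟩ := hrec.exists_consec ((h.mem_window_iff hM k).1 hij.1)
        refine ⟨_, hkl.mem_gaps, ?_⟩
        rcases h.consec hM hkl with ⟨⟨rfl, hk⟩, h2, -⟩ | ⟨hc, h2⟩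
        · obtain rfl := hij.unique h2
          rw [hzero k hk, height_succ, show w (mergePos w k) = 0 from hk, Nat.add_sub_cancel_left]
          simp [hT]
        · obtain rfl := hij.unique h2
          exact hother k l hkl.2.2.1 hc
      · obtain ⟨h2, h3⟩ := (h.mem_window_mid hM hk).1 hij.1
        have h6 : k + 1 ∈ window (merge w) N v := by
          have h4' : height (merge w) (k + N) = height (merge w) k + v := h2
          show height (merge w) (k + 1 + N) = height (merge w) (k + 1) + v
          rw [show k + 1 + N = k + N + 1 by ring, height_succ, height_succ, h4', hk, h3]
          ring
        have hkl : Consec (window (merge w) N v) k (k + 1) :=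
          ⟨h2, h6, by omega, fun _ _ _ => by omega⟩
        refine ⟨_, hkl.mem_gaps, ?_⟩
        rcases h.consec hM hkl with ⟨-, -, h4⟩ | ⟨hc, -⟩
        · obtain rfl := hij.unique h4
          have h5 := h.zero_succ hk
          rw [hzero k hk, show mergePos w k + 2 = mergePos w k + 1 + 1 by rfl,
            height_succ w (mergePos w k + 1), h5, Nat.add_sub_cancel_left]
          simp [hT]
        · exact absurd ⟨rfl, hk⟩ hc
    · rintro ⟨_, ⟨k, l, hkl, rfl⟩, rfl⟩
      rcases h.consec hM hkl with ⟨⟨rfl, hk⟩, h2, -⟩ | ⟨hc, h2⟩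
      · refine ⟨_, _, h2, ?_⟩
        rw [hzero k hk, height_succ, show w (mergePos w k) = 0 from hk, Nat.add_sub_cancel_left]
        simp [hT]
      · exact ⟨_, _, h2, hother k l hkl.2.2.1 hc⟩
  have hinj : Set.InjOn T (gaps (merge w) N v) := by
    have hpos : ∀ p ∈ gaps (merge w) N v, 0 ≤ 2 * (p.1 : ℤ) - p.2 := by
      rintro p ⟨i, j, hij, rfl⟩
      have h2 := height_bounds (merge w) i (j - i)
      rw [Nat.add_sub_cancel' hij.2.2.1.le] at h2
      simp only
      linarith
    rintro ⟨n, t⟩ hp ⟨n', t'⟩ hp' heq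
    have h2 := hpos _ hp
    have h3 := hpos _ hp'
    simp only [hT] at heq h2 h3
    -- The branches of `T` cannot collide, since `2n = 1` has no solution.
    split_ifs at heq with h4 h5 h5
    · exact heq
    · obtain ⟨h6, h7⟩ := Prod.mk.inj h4
      obtain ⟨h8, h9⟩ := Prod.mk.inj heq
      omega
    · obtain ⟨h6, h7⟩ := Prod.mk.inj h5
      obtain ⟨h8, h9⟩ := Prod.mk.inj heq
      omega
    · obtain ⟨h8, h9⟩ := Prod.mk.inj heq
      rw [Prod.mk.injEq]
      omega
  rw [← hinj.encard_image, ← himage]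
  exact hw.card M v ⟨_, (h.mem_window_iff hM i₁).2 hi₁⟩

theorem run (h : EvenWord w) {i ℓ : ℕ} (hr : Run (merge w) 1 i ℓ) : Run w 1 (mergePos w i + 1) ℓ := by
  have h0 : merge w i = 0 := (letter_cases _).resolve_right hr.left
  have hpos : ∀ k ≤ ℓ, mergePos w (i + 1 + k) = mergePos w i + 1 + 1 + k := by
    intro k hk
    induction k with
    | zero => exact mergePos_zero h0
    | succ k ih =>
      rw [← add_assoc, mergePos_one (hr.mem k (by omega)), ih (by omega)]
      ring
  refine ⟨hr.pos, ?_, fun k hk => ?_, ?_⟩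
  · rw [h.zero_succ h0]
    decide
  · rw [← hpos k hk.le]
    exact hr.mem k hk
  · rw [← hpos ℓ le_rfl]
    exact hr.right

end EvenWord

/-! ### Reduction to short runs: `00` and `11` do not both occur -/

theorem isFactor_shift {w : ℕ → Fin 2} (hw : Recur w) {s : ℕ} {l : List (Fin 2)} :
    IsFactor (fun j => w (s + j)) l ↔ IsFactor w l := by
  constructor
  · rintro ⟨i, hi⟩
    exact ⟨_, occursAt_shift.1 hi⟩
  · intro h
    obtain ⟨i, h1, h2⟩ := hw.exists_occ h s
    refine ⟨i - s, occursAt_shift.2 ?_⟩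
    rwa [Nat.add_sub_cancel' h1]

/-- The initial zeros need not be even in number, so the word is cut behind a letter `1`. -/
theorem Good.exists_evenWord {w : ℕ → Fin 2} (hw : Good w) (h1 : IsFactor w [1])
    (heven : ∀ i ℓ, Run w 0 i ℓ → Even ℓ) : ∃ s, EvenWord fun j => w (s + j) := by
  have key : ∀ p, w p = 1 → EvenTail w (p + 1) := by
    intro p hp n hn hn1 hz
    rcases Nat.eq_zero_or_pos (n - (p + 1)) with h2 | h2
    · rw [h2]
      decide
    · refine heven p _ ⟨h2, by rw [hp]; decide, fun k hk => hz _ (by omega) (by omega), ?_⟩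
      rw [show p + 1 + (n - (p + 1)) = n by omega, hn1]
      decide
  have hshift : ∀ s p, EvenTail w (s + p) → EvenTail (fun j => w (s + j)) p := by
    intro s p h n hn hn1 hz
    have := h (s + n) (by omega) hn1 fun k h2 h3 => by
      have := hz (k - s) (by omega) (by omega)
      simp only [Nat.add_sub_cancel' (show s ≤ k by omega)] at this
      exact this
    rwa [show s + n - (s + p) = n - p by omega] at this
  obtain ⟨p, -, hp⟩ := hw.recur.frequently_of_factor h1 0
  exact ⟨p + 1, hshift _ _ (key p hp), fun q hq => hshift _ _ (key _ hq)⟩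

/-- Words with zero runs of lengths two and four reduce to words with zero runs of lengths one and
two. -/
theorem Good.exists_shortType {w : ℕ → Fin 2} (hw : Good w) (hz : EvenType w 0 1) :
    ∃ w', Good w' ∧ ShortType w' 0 1 ∧ (ShortType w 1 0 → ShortType w' 1 0) ∧
      (EvenType w 1 0 → EvenType w' 1 0) := by
  have f1 : IsFactor w [1] := hz.two.sub (by decide)
  obtain ⟨s, hs⟩ := hw.exists_evenWord f1 hz.even
  have hf : ∀ {l}, IsFactor (fun j => w (s + j)) l ↔ IsFactor w l := isFactor_shift hw.recur
  have n101 : ¬ IsFactor w [1, 0, 1] := by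
    rintro ⟨i, hi⟩
    have h3 : w i = 1 ∧ w (i + 1) = 0 ∧ w (i + 2) = 1 := by
      simpa [OccursAt, wordAt, List.range_succ] using hi
    have h4 : Run w 0 i 1 := ⟨by omega, by rw [h3.1]; decide, fun k hk => by
      obtain rfl : k = 0 := by omega
      exact h3.2.1, by rw [show i + 1 + 1 = i + 2 by rfl, h3.2.2]; decide⟩
    exact absurd (hz.even _ _ h4) (by decide)
  have hdown : ∀ l, (1 : Fin 2) ∈ l → IsFactor w (double l) →
      IsFactor (merge fun j => w (s + j)) l := fun l hl h => hs.isFactor_of_double hl (hf.2 h)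
  have hup : ∀ l, IsFactor (merge fun j => w (s + j)) l → IsFactor w (double l) := fun l h =>
    hf.1 (hs.isFactor_double h)
  refine ⟨_, hs.good (hw.shift s) (hf.2 f1), ⟨fun h => hz.not_six (hup _ h),
    hdown _ (by decide) hz.two, (hdown [1, 0, 0, 1] (by decide) hz.four).sub (by decide)⟩,
    fun ho => ?_, fun ho => ?_⟩
  · refine ⟨fun h => ho.not_three (hup _ h), hdown _ (by decide) ?_,
      hdown _ (by decide) ho.two⟩
    exact hw.left_zero (ho.one.right_zero n101 (by decide)) n101 (by decide)
  · refine ⟨fun i ℓ hr => ?_, fun h => ho.not_six (hup _ h), hdown _ (by decide) ?_,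
      hdown _ (by decide) ?_⟩
    · have hr' := hs.run hr
      refine ho.even (s + (mergePos (fun j => w (s + j)) i + 1)) _ ⟨hr'.pos, hr'.left,
        fun k hk => ?_, ?_⟩
      · rw [← hr'.mem k hk, add_assoc s, add_assoc s]
      · rw [add_assoc s, add_assoc s]
        exact hr'.right
    · exact hw.left_zero (ho.two.right_zero n101 (by decide)) n101 (by decide)
    · exact hw.left_zero (ho.four.right_zero n101 (by decide)) n101 (by decide)

theorem Good.false_of_shortType {w : ℕ → Fin 2} (hw : Good w) (hz : ShortType w 0 1)
    (ho : ShortType w 1 0) : False :=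
  ShortRuns.false ⟨hw, hz.not_three, ho.not_three, ho.one, hz.one, hz.two, ho.two⟩

/-- Each letter has run lengths one and two, or two and four. Merging pairs halves the longer type,
for one letter and then, after exchanging letters, for the other; this ends at the case excluded by
`ShortRuns.false`. -/
theorem Good.not_both_letters {w : ℕ → Fin 2} (hw : Good w) (f00 : IsFactor w [0, 0])
    (f11 : IsFactor w [1, 1]) : False := by
  have ho := hw.ones_type f00 f11
  have hz : ShortType w 0 1 ∨ EvenType w 0 1 :=
    (hw.flip.ones_type (isFactor_flip.2 f11) (isFactor_flip.2 f00)).imp ShortType.flip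
      EvenType.flip
  obtain ⟨w', hw', hz', ho'⟩ : ∃ w', Good w' ∧ ShortType w' 0 1 ∧
      (ShortType w' 1 0 ∨ EvenType w' 1 0) := by
    rcases hz with hz | hz
    · exact ⟨w, hw, hz, ho⟩
    · obtain ⟨w', hw', hz', h1, h2⟩ := hw.exists_shortType hz
      exact ⟨w', hw', hz', ho.imp h1 h2⟩
  rcases ho' with ho' | ho'
  · exact hw'.false_of_shortType hz' ho'
  · rw [← flipLetters_flipLetters w'] at hz' ho'
    obtain ⟨w'', hw'', hz'', h1, -⟩ := hw'.flip.exists_shortType ho'.flip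
    exact hw''.false_of_shortType hz'' (h1 hz'.flip)

/-! ### Prefixes of coded words, factor counts and passage to longer blocks -/

section

variable {A B V : List (Fin 2)} {c d : Fin 2} {H : ℕ → ℕ} {w : ℕ → Fin 2}

theorem StdPair.eq_letters (hs : StdPair A B V c d) (hlen : A.length = B.length) :
    A = [c] ∧ B = [d] := by
  have h1 : A.length = 1 := by
    have := hs.coprime
    rw [← hlen, Nat.coprime_self] at this
    exact this
  obtain ⟨a, rfl⟩ := List.length_eq_one_iff.1 h1
  obtain ⟨b, rfl⟩ := List.length_eq_one_iff.1 (hlen ▸ h1)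
  have hV : V = [] := by
    have := hs.length
    simp at this
    exact this
  subst hV
  have := hs.hAB
  simp at this
  simp [this]

theorem Coded.isFactor_AA (h : Coded A B H w) {x : ℕ} (hx : H (x + 1) = H x) :
    IsFactor w (A ++ A) := by
  refine ⟨_, (h.occA x).append ?_⟩
  convert h.occA (x + 1) using 1
  rw [hx]
  ring

theorem Coded.isFactor_BB (h : Coded A B H w) {x : ℕ} (hx : H x + 2 ≤ H (x + 1)) :
    IsFactor w (B ++ B) := by
  refine ⟨_, (h.occB (x + 1) (H x) (Or.inr le_rfl) (by omega)).append ?_⟩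
  convert h.occB (x + 1) (H x + 1) (Or.inr (by simp)) (by omega) using 1
  ring

theorem Good.not_both_squares (hw : Good w) (hs : StdPair A B V c d) (h : Coded A B H w)
    (hH : ∀ M, ∃ x, M ≤ H x) (h0 : ∀ n, ∃ x ≥ n, H (x + 1) = H x)
    (h2 : ∀ n, ∃ x ≥ n, H x + 2 ≤ H (x + 1)) : False := by
  by_cases hab : A.length = B.length
  · obtain ⟨rfl, rfl⟩ := hs.eq_letters hab
    obtain ⟨x, -, hx⟩ := h0 0
    obtain ⟨y, -, hy⟩ := h2 0
    have h3 := h.isFactor_AA hx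
    have h4 := h.isFactor_BB hy
    have hne := hs.ne
    rcases letter_cases c with rfl | rfl <;> rcases letter_cases d with rfl | rfl
    · exact hne rfl
    · exact hw.not_both_letters h3 h4
    · exact hw.not_both_letters h4 h3
    · exact hne rfl
  · exact hw.not_both hs h hH hab h0 h2

theorem Coded.tail_at (h : Coded A B H w) {x y : ℕ} (h1 : x = 0 ∨ H (x - 1) ≤ y) (h2 : y ≤ H x) :
    Coded A B (fun x' => H (x + x') - y) (fun j => w (x * A.length + y * B.length + j)) := by
  refine ⟨fun z z' hz => Nat.sub_le_sub_right (h.mono (by omega)) _, fun z => ?_,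
    fun z z' h3 h4 => ?_⟩
  · rw [occursAt_shift]
    convert h.occA (x + z) using 1
    have : y ≤ H (x + z) := h2.trans (h.mono (by omega))
    obtain ⟨k, hk⟩ := Nat.exists_eq_add_of_le this
    rw [hk, Nat.add_sub_cancel_left]
    ring
  · rw [occursAt_shift]
    convert h.occB (x + z) (y + z') ?_ (by omega) using 1
    · ring
    · rcases Nat.eq_zero_or_pos z with rfl | hz
      · rcases h1 with h1 | h1
        · exact Or.inl (by simpa using h1)
        · exact Or.inr (by simp only [add_zero]; omega)
      · right
        rcases h3 with h3 | h3
        · omega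
        · rw [show x + z - 1 = x + (z - 1) by omega]
          omega

theorem Coded.height_prefix (hs : StdPair A B V c d) (h : Coded A B H w) {i : ℕ}
    (hi : i ≤ V.length) : height w i = powHeight A i := by
  have := Coded.height_eq hs i h
  rw [cells_eq_empty (by omega)] at this
  simpa using this

theorem Coded.prefix_eq {H' : ℕ → ℕ} {w' : ℕ → Fin 2} (hs : StdPair A B V c d)
    (h : Coded A B H w) (h' : Coded A B H' w') {i : ℕ} (hi : i < V.length) : w i = w' i := by
  have h1 := h.height_prefix hs (i := i) hi.le
  have h2 := h.height_prefix hs (i := i + 1) hi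
  have h3 := h'.height_prefix hs (i := i) hi.le
  have h4 := h'.height_prefix hs (i := i + 1) hi
  rw [height_succ] at h2 h4
  exact letter_eq_of_val (by linarith)

theorem cells_level {a b e : ℕ} (ha : 0 < a) (hb : 0 < b) :
    (H 0 = 0 → cells H a b e e = ∅) ∧ (0 < H 0 → cells H a b e e = {(0, 0)}) := by
  have key : ∀ x y, (x, y) ∈ cells H a b e e ↔ (x = 0 ∧ y = 0 ∧ 0 < H 0) := by
    intro x y
    simp only [cells, Set.mem_ofPred_eq]
    constructor
    · rintro ⟨h1, h2⟩
      have h3 : x * a = 0 := by omega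
      have h4 : y * b = 0 := by omega
      obtain rfl : x = 0 := (Nat.mul_eq_zero.1 h3).resolve_right (by omega)
      obtain rfl : y = 0 := (Nat.mul_eq_zero.1 h4).resolve_right (by omega)
      exact ⟨rfl, rfl, h1⟩
    · rintro ⟨rfl, rfl, h⟩
      exact ⟨h, by simp⟩
  constructor
  · intro h0
    ext ⟨x, y⟩
    rw [key]
    simp [h0]
  · intro h0
    ext ⟨x, y⟩
    rw [key]
    simp [h0]

/-- The level `|V| + 1` carries the cell `(0, 0)` exactly when the first block is `B`. Hence the
letter after the prefix `V` tells the two blocks apart. -/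
theorem Coded.prefix_ne {H' : ℕ → ℕ} {w' : ℕ → Fin 2} (hs : StdPair A B V c d)
    (h : Coded A B H w) (h' : Coded A B H' w') (h0 : H 0 = 0) (h0' : 0 < H' 0) :
    w V.length ≠ w' V.length := by
  intro heq
  have h1 := h.height_prefix hs le_rfl
  have h2 := h'.height_prefix hs le_rfl
  have h3 := Coded.height_eq hs (V.length + 1) h
  have h4 := Coded.height_eq hs (V.length + 1) h'
  rw [(cells_level hs.hA hs.hB).1 h0, height_succ] at h3
  rw [(cells_level hs.hA hs.hB).2 h0', height_succ] at h4
  have h5 := sq_eq_one_of_ne hs.ne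
  simp only [Set.ncard_empty, Set.ncard_singleton] at h3 h4
  rw [heq] at h3
  have h6 : ((d : ℕ) - (c : ℕ) : ℤ) = 0 := by
    push_cast at h3 h4
    linarith
  rw [h6] at h5
  exact absurd h5 (by decide)

theorem Coded.exists_block (hs : StdPair A B V c d) : ∀ (n : ℕ) {H : ℕ → ℕ} {w : ℕ → Fin 2},
    Coded A B H w → ∃ s r H', s + r = n ∧ Coded A B H' (fun j => w (s + j)) ∧
      (H' 0 = 0 ∧ r < A.length ∨ 0 < H' 0 ∧ r < B.length) := by
  intro n
  have hA := hs.hA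
  have hB := hs.hB
  induction n using Nat.strong_induction_on with
  | h n ih =>
    intro H w h
    have h0 : Coded A B H fun j => w (0 + j) := by simpa using h
    rcases Nat.eq_zero_or_pos (H 0) with hz | hz
    · rcases Nat.lt_or_ge n A.length with hn | hn
      · exact ⟨0, n, H, by simp, h0, Or.inl ⟨hz, hn⟩⟩
      · obtain ⟨s, r, H', h1, h2, h3⟩ := ih (n - A.length) (by omega) (h.shiftA hz)
        exact ⟨A.length + s, r, H', by omega, by simpa [add_assoc] using h2, h3⟩
    · rcases Nat.lt_or_ge n B.length with hn | hn
      · exact ⟨0, n, H, by simp, h0, Or.inr ⟨hz, hn⟩⟩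
      · obtain ⟨s, r, H', h1, h2, h3⟩ := ih (n - B.length) (by omega) (h.shiftB hz)
        exact ⟨B.length + s, r, H', by omega, by simpa [add_assoc] using h2, h3⟩

theorem OccursAt.getElem_eq {A : Type*} {w : ℕ → A} {l : List A} {i k : ℕ} (h : OccursAt w l i)
    (hk : k < l.length) : w (i + k) = l[k] := by
  have h1 : (wordAt w i l.length)[k]? = l[k]? := by rw [h]
  simpa [wordAt, hk] using h1

/-- Behind the block `A` there is again a coded word, whose first `|V|` letters are always those of
`V`. -/
theorem Coded.long_prefix_A {H' : ℕ → ℕ} {w' : ℕ → Fin 2} (hs : StdPair A B V c d)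
    (h : Coded A B H w) (h' : Coded A B H' w') (h0 : H 0 = 0) (h0' : H' 0 = 0) {i : ℕ}
    (hi : i < A.length + V.length) : w i = w' i := by
  rcases Nat.lt_or_ge i A.length with h1 | h1
  · have h2 := h.occA 0
    have h3 := h'.occA 0
    rw [h0] at h2
    rw [h0'] at h3
    have h4 := h2.getElem_eq h1
    have h5 := h3.getElem_eq h1
    simp only [zero_mul, zero_add] at h4 h5
    rw [h4, h5]
  · have h2 := (h.shiftA h0).prefix_eq hs (h'.shiftA h0') (i := i - A.length) (by omega)
    simpa [Nat.add_sub_cancel' h1] using h2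

theorem Coded.long_prefix_B {H' : ℕ → ℕ} {w' : ℕ → Fin 2} (hs : StdPair A B V c d)
    (h : Coded A B H w) (h' : Coded A B H' w') (h0 : 0 < H 0) (h0' : 0 < H' 0) {i : ℕ}
    (hi : i < B.length + V.length) : w i = w' i := by
  rcases Nat.lt_or_ge i B.length with h1 | h1
  · have h4 := (h.occB_zero h0).getElem_eq h1
    have h5 := (h'.occB_zero h0').getElem_eq h1
    simp only [zero_add] at h4 h5
    rw [h4, h5]
  · have h2 := (h.shiftB h0).prefix_eq hs (h'.shiftB h0') (i := i - B.length) (by omega)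
    simpa [Nat.add_sub_cancel' h1] using h2

/-- A coded word has at most `|V| + 2` factors of length `|V| + 1`. -/
theorem Coded.ncard_factors_le (hs : StdPair A B V c d) (h : Coded A B H w) :
    {u | IsFactor w u ∧ u.length = V.length + 1}.ncard ≤ V.length + 2 := by
  -- A factor is labelled by the offset of its start in a block `A`, or by `|A|` plus the offset in
  -- a block `B`. There are `|A| + |B| = |V| + 2` labels.
  have key : ∀ u ∈ {u | IsFactor w u ∧ u.length = V.length + 1}, ∃ t < V.length + 2,
      ∃ s r H', u = wordAt w (s + r) (V.length + 1) ∧ Coded A B H' (fun j => w (s + j)) ∧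
        (H' 0 = 0 ∧ r < A.length ∧ t = r ∨ 0 < H' 0 ∧ r < B.length ∧ t = A.length + r) := by
    rintro u ⟨⟨n, hn⟩, hlen⟩
    obtain ⟨s, r, H', h1, h2, h3⟩ := h.exists_block hs n
    have hl := hs.length
    rw [OccursAt, hlen] at hn
    rcases h3 with ⟨h3, h4⟩ | ⟨h3, h4⟩
    · exact ⟨r, by omega, s, r, H', by rw [h1, hn], h2, Or.inl ⟨h3, h4, rfl⟩⟩
    · exact ⟨A.length + r, by omega, s, r, H', by rw [h1, hn], h2, Or.inr ⟨h3, h4, rfl⟩⟩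
  choose! f hf using key
  have hle := Set.ncard_le_ncard_of_injOn (t := (Set.Iio (V.length + 2))) f
    (fun u hu => (hf u hu).1) ?_ (Set.finite_Iio _)
  · have h1 : (Set.Iio (V.length + 2)).ncard = V.length + 2 := by
      rw [← Finset.coe_Iio, Set.ncard_coe_finset, Nat.card_Iio]
    rwa [h1] at hle
  · intro u hu u' hu' heq
    obtain ⟨-, s, r, G, rfl, h2, h3⟩ := hf u hu
    obtain ⟨-, s', r', G', rfl, h2', h3'⟩ := hf u' hu'
    rw [heq] at h3
    rw [wordAt_eq_iff]
    intro k hk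
    rw [add_assoc, add_assoc]
    rcases h3 with ⟨h4, h5, h6⟩ | ⟨h4, h5, h6⟩ <;> rcases h3' with ⟨h4', h5', h6'⟩ | ⟨h4', h5', h6'⟩
    · obtain rfl : r = r' := by omega
      exact h2.long_prefix_A hs h2' h4 h4' (i := r + k) (by omega)
    · omega
    · omega
    · obtain rfl : r = r' := by omega
      exact h2.long_prefix_B hs h2' h4 h4' (i := r + k) (by omega)

theorem exists_step_of_unbounded (hm : Monotone H) (hH : ∀ M, ∃ x, M ≤ H x) (n : ℕ) :
    ∃ k ≥ n, H k < H (k + 1) := by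
  by_contra hcon
  push Not at hcon
  obtain ⟨x, hx⟩ := hH (H n + 1)
  have hnx : n ≤ x := by
    by_contra h1
    have := hm (not_le.1 h1).le
    omega
  have := const_of_no_step hm hnx fun t h1 h2 h3 => by
    have := hcon t h1
    omega
  omega

theorem exists_const_of_dual_jump (hm : Monotone H) (hH : ∀ M, ∃ x, M ≤ H x)
    (h2 : ∀ n, ∃ y ≥ n, dual H y + 2 ≤ dual H (y + 1)) (n : ℕ) :
    ∃ x ≥ n, H (x + 1) = H x := by
  obtain ⟨y₀, hy₀⟩ := dual_unbounded hm hH n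
  obtain ⟨y, hy, h3⟩ := h2 y₀
  refine ⟨dual H y, hy₀.trans (dual_mono hm hH hy), ?_⟩
  have h4 : y < H (dual H y) := (dual_le_iff hm hH).1 le_rfl
  have h5 : H (dual H y + 1) ≤ y + 1 := (lt_dual_iff hm hH).1 (by omega)
  have := hm (Nat.le_add_right (dual H y) 1)
  omega

/-- If no two blocks `B` are adjacent, the word is coded by the blocks `A` and `AB`. -/
theorem Coded.exists_coded_append (h : Coded A B H w) (h0 : H 0 = 0)
    (hstep : ∀ x, H (x + 1) ≤ H x + 1) (hH : ∀ M, ∃ x, M ≤ H x)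
    (hAA : ∀ n, ∃ x ≥ n, H (x + 1) = H x) :
    ∃ H', Coded A (A ++ B) H' w ∧ ∀ M, ∃ x, M ≤ H' x := by
  have hadd : ∀ x n, H (x + n) ≤ H x + n := by
    intro x n
    induction n with
    | zero => simp
    | succ n ih =>
      have := hstep (x + n)
      rw [← add_assoc]
      omega
  have hsub : Monotone fun n => n - H n := by
    apply monotone_nat_of_le_succ
    intro n
    have := hstep n
    omega
  have hsub' := unbounded_of_steps hsub fun n => (hAA n).imp fun x hx => ⟨hx.1, by
    have := hadd 0 x
    rw [zero_add, h0] at this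
    have := hx.2
    omega⟩
  -- Among the first `x + y + 1` blocks `A`, exactly `x + y + 1 - H (x + y + 1)` are not followed by
  -- `B`. The least `y` making this at least `x + 1` counts the blocks `AB` before the single `A`
  -- with index `x`.
  have hex : ∀ x, ∃ y, H (x + y + 1) ≤ y := by
    intro x
    obtain ⟨n, hn⟩ := hsub' (x + 1)
    have := hadd 0 n
    refine ⟨n - x - 1, ?_⟩
    rw [show x + (n - x - 1) + 1 = n by omega]
    omega
  classical
  have hspec : ∀ x, H (x + Nat.find (hex x) + 1) ≤ Nat.find (hex x) := fun x =>
    Nat.find_spec (hex x)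
  have hmin : ∀ x y, y < Nat.find (hex x) → y + 1 ≤ H (x + y + 1) := by
    intro x y hy
    have := Nat.find_min (hex x) hy
    omega
  refine ⟨fun x => Nat.find (hex x), ⟨monotone_nat_of_le_succ fun x => ?_, fun x => ?_,
    fun x y h1 h2 => ?_⟩, fun M => ?_⟩
  · by_contra hcon
    have h1 := hmin x _ (not_le.1 hcon)
    have h2 := hspec (x + 1)
    have := h.mono (show x + Nat.find (hex (x + 1)) + 1 ≤ x + 1 + Nat.find (hex (x + 1)) + 1
      by omega)
    omega
  · have h1 := hspec x
    have h2 : H (x + Nat.find (hex x)) = Nat.find (hex x) := by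
      have h3 := h.mono (Nat.le_add_right (x + Nat.find (hex x)) 1)
      rcases Nat.eq_zero_or_pos (Nat.find (hex x)) with h4 | h4
      · omega
      · have h5 := hmin x (Nat.find (hex x) - 1) (by omega)
        rw [show x + (Nat.find (hex x) - 1) + 1 = x + Nat.find (hex x) by omega] at h5
        omega
    convert h.occA (x + Nat.find (hex x)) using 1
    rw [h2, List.length_append]
    ring
  · have h3 := hmin x y h2
    have h4 : H (x + y) ≤ y := by
      rcases Nat.eq_zero_or_pos x with rfl | hx
      · have := hadd 0 y
        omega
      · rcases h1 with h1 | h1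
        · omega
        · have h5 := hspec (x - 1)
          rw [show x - 1 + Nat.find (hex (x - 1)) + 1 = x + Nat.find (hex (x - 1)) by omega] at h5
          have h6 := hadd (x + Nat.find (hex (x - 1))) (y - Nat.find (hex (x - 1)))
          rw [show x + Nat.find (hex (x - 1)) + (y - Nat.find (hex (x - 1))) = x + y by omega] at h6
          omega
    have h5 := hstep (x + y)
    have h6 : H (x + y) = y := by omega
    have h7 := h.occA (x + y)
    rw [h6] at h7
    have h8 := h.occB (x + y + 1) y (Or.inr (by simpa using h4)) (by omega)
    convert h7.append (l' := B) ?_ using 1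
    · rw [List.length_append]
      ring
    · convert h8 using 1
      ring
  · obtain ⟨x, hx⟩ := hH M
    refine ⟨x, ?_⟩
    by_contra hcon
    simp only at hcon
    have h1 := hspec x
    have h2 := h.mono (show x ≤ x + Nat.find (hex x) + 1 by omega)
    omega

theorem StdPair.append (hs : StdPair A B V c d) : StdPair A (A ++ B) (A ++ V) c d := by
  refine ⟨by rw [hs.hAB, List.append_assoc], by rw [List.append_assoc, hs.hBA, List.append_assoc],
    hs.ne, hs.hA, ?_, ?_⟩
  · rw [List.length_append]
    have := hs.hA
    omega
  · rw [List.length_append, Nat.coprime_self_add_right]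
    exact hs.coprime

/-- If late jumps are at most one, each late `B` can be attached to the `A` before it, and `V`
becomes `AV`. The square `AA` recurs, since otherwise the word would end in a power of `AB`. -/
theorem Good.exists_longer_of_step (hw : Good w) (hs : StdPair A B V c d) (h : Coded A B H w)
    (hH : ∀ M, ∃ x, M ≤ H x) {n₀ : ℕ} (hstep : ∀ x ≥ n₀, H (x + 1) ≤ H x + 1) :
    ∃ s A' B' V' c' d' H', StdPair A' B' V' c' d' ∧ Coded A' B' H' (fun j => w (s + j)) ∧
      (∀ M, ∃ x, M ≤ H' x) ∧ V.length < V'.length := by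
  have h' := h.tail n₀
  have hH' : ∀ M, ∃ x, M ≤ H (n₀ + x) - H n₀ := by
    intro M
    obtain ⟨x, hx⟩ := hH (M + H n₀)
    refine ⟨x, ?_⟩
    have := h.mono (Nat.le_add_left x n₀)
    omega
  have hAA : ∀ n, ∃ x ≥ n, H (n₀ + (x + 1)) - H n₀ = H (n₀ + x) - H n₀ := by
    by_contra hcon
    push Not at hcon
    obtain ⟨n, hn⟩ := hcon
    have hone : ∀ x ≥ n, H (n₀ + (x + 1)) = H (n₀ + x) + 1 := by
      intro x hx
      have h1 := hn x hx
      have h2 := hstep (n₀ + x) (by omega)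
      have h3 := h.mono (Nat.le_add_right (n₀ + x) 1)
      rw [← add_assoc] at h1 ⊢
      have h4 : H (n₀ + x + 1) ≠ H (n₀ + x) := fun h5 => h1 (by rw [h5])
      omega
    have h2 := h.tail (n₀ + n)
    have hval : ∀ x, H (n₀ + n + x) = H (n₀ + n) + x := by
      intro x
      induction x with
      | zero => rfl
      | succ x ih =>
        have := hone (n + x) (by omega)
        rw [show n₀ + n + (x + 1) = n₀ + (n + x + 1) by ring, this,
          show n₀ + (n + x) = n₀ + n + x by ring, ih]
        ring
    have e : (fun x' => H (n₀ + n + x') - H (n₀ + n)) = fun x => id (x / 1) := by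
      funext x
      rw [hval, Nat.add_sub_cancel_left, Nat.div_one]
      rfl
    rw [e] at h2
    -- Groups of size one with constant step one.
    exact (hw.shift _).not_const_blocks hs h2 strictMono_id one_pos 1 0 fun j _ => rfl
  obtain ⟨H', h1, h2⟩ := h'.exists_coded_append (by simp) (fun x => by
    have h1 := hstep (n₀ + x) (by omega)
    have h3 := h.mono (Nat.le_add_right n₀ x)
    rw [← add_assoc]
    omega) hH' hAA
  refine ⟨_, A, A ++ B, A ++ V, c, d, H', hs.append, h1, h2, ?_⟩
  rw [List.length_append]
  have := hs.hA
  omega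

/-- As the two squares do not both recur, the jumps of `H` or those of its dual are eventually at
most one. -/
theorem Good.exists_longer (hw : Good w) (hs : StdPair A B V c d) (h : Coded A B H w)
    (hH : ∀ M, ∃ x, M ≤ H x) :
    ∃ s A' B' V' c' d' H', StdPair A' B' V' c' d' ∧ Coded A' B' H' (fun j => w (s + j)) ∧
      (∀ M, ∃ x, M ≤ H' x) ∧ V.length < V'.length := by
  by_cases h2 : ∀ n, ∃ x ≥ n, H x + 2 ≤ H (x + 1)
  · have hK : ¬ ∀ n, ∃ y ≥ n, dual H y + 2 ≤ dual H (y + 1) := fun h3 =>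
      hw.not_both_squares hs h hH (exists_const_of_dual_jump h.mono hH h3) h2
    push Not at hK
    obtain ⟨n, hn⟩ := hK
    exact hw.exists_longer_of_step hs.symm (h.dual hH) (dual_unbounded h.mono hH) (n₀ := n)
      fun x hx => by
        have := hn x hx
        omega
  · push Not at h2
    obtain ⟨n, hn⟩ := h2
    exact hw.exists_longer_of_step hs h hH (n₀ := n) fun x hx => by
      have := hn x hx
      omega

end

/-! ### Good words are Sturmian -/

/-- Otherwise the word is constant and the empty word has a single return. -/
theorem Good.isFactor_letter {w : ℕ → Fin 2} (hw : Good w) (a : Fin 2) : IsFactor w [a] := by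
  by_contra hcon
  have hne : ∀ i, w i ≠ a := fun i hi => hcon ⟨i, by simp [OccursAt, wordAt, hi]⟩
  have hmem : ∀ i, i ∈ window w 0 0 := fun i => by simp [window]
  refine hw.not_one (N := 0) (v := 0) (i₀ := 0) ⟨0, hmem 0⟩ (1, 1 - ((a : ℕ) : ℤ))
    fun i j _ hij => ?_
  obtain rfl : j = i + 1 := by
    by_contra h1
    exact hij.2.2.2 (i + 1) (by omega) (by have := hij.2.2.1; omega) (hmem _)
  rw [height_succ, val_eq_of_ne (hne i), Nat.add_sub_cancel_left, add_sub_cancel_left]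

theorem Good.exists_level {w : ℕ → Fin 2} (hw : Good w) (n : ℕ) :
    ∃ s A B V c d H, StdPair A B V c d ∧ Coded A B H (fun j => w (s + j)) ∧
      (∀ M, ∃ x, M ≤ H x) ∧ n ≤ V.length := by
  induction n with
  | zero =>
    have hf := fun a => hw.recur.frequently_of_factor (hw.isFactor_letter a)
    obtain ⟨H, h⟩ := exists_coded (x := 0) (y := 1) (by decide) (hf 0)
    exact ⟨0, [0], [1], [], 0, 1, H, stdPair_letters (by decide), by simpa using h,
      unbounded_of_steps h.mono (h.exists_step (by decide) (hf 1)), Nat.zero_le _⟩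
  | succ n ih =>
    obtain ⟨s, A, B, V, c, d, H, hs, h, hH, hn⟩ := ih
    obtain ⟨s', A', B', V', c', d', H', hs', h', hH', hn'⟩ := (hw.shift s).exists_longer hs h hH
    exact ⟨s + s', A', B', V', c', d', H', hs', by simpa only [add_assoc] using h', hH', by omega⟩

theorem finite_factors (w : ℕ → Fin 2) (n : ℕ) : {u | IsFactor w u ∧ u.length = n}.Finite :=
  (List.finite_length_eq (Fin 2) n).subset fun _ hu => hu.2

theorem image_dropLast_factors (w : ℕ → Fin 2) (n : ℕ) :
    {u | IsFactor w u ∧ u.length = n} =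
      List.dropLast '' {u | IsFactor w u ∧ u.length = n + 1} := by
  ext u
  constructor
  · rintro ⟨⟨i, hi⟩, rfl⟩
    refine ⟨wordAt w i (u.length + 1), ⟨⟨i, ?_⟩, length_wordAt _ _ _⟩, ?_⟩
    · rw [OccursAt, length_wordAt]
    · rw [wordAt_succ, List.dropLast_concat]
      exact hi
  · rintro ⟨v, ⟨⟨i, hi⟩, hv⟩, rfl⟩
    rw [OccursAt, hv, wordAt_succ] at hi
    refine ⟨⟨i, ?_⟩, by simp [hv]⟩
    rw [← hi, List.dropLast_concat, OccursAt, length_wordAt]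

theorem ncard_factors_zero (w : ℕ → Fin 2) : {u | IsFactor w u ∧ u.length = 0}.ncard = 1 := by
  rw [Set.ncard_eq_one]
  refine ⟨[], ?_⟩
  ext u
  simp only [Set.mem_ofPred_eq, List.length_eq_zero_iff, Set.mem_singleton_iff, and_iff_right_iff_imp]
  rintro rfl
  exact ⟨0, rfl⟩

/-- Deleting the last letter maps factors of length `n + 1` onto those of length `n`, and identifies
the two extensions of a right special factor. -/
theorem ncard_factors_lt {w : ℕ → Fin 2} {n i i' : ℕ} (h : ∀ k < n, w (i + k) = w (i' + k))
    (hne : w (i + n) ≠ w (i' + n)) : {u | IsFactor w u ∧ u.length = n}.ncard <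
      {u | IsFactor w u ∧ u.length = n + 1}.ncard := by
  have hmem : ∀ i, wordAt w i (n + 1) ∈ {u | IsFactor w u ∧ u.length = n + 1} := fun i =>
    ⟨⟨i, by rw [OccursAt, length_wordAt]⟩, length_wordAt _ _ _⟩
  have hdrop : (wordAt w i (n + 1)).dropLast = (wordAt w i' (n + 1)).dropLast := by
    rw [wordAt_succ, wordAt_succ, List.dropLast_concat, List.dropLast_concat]
    exact wordAt_eq_iff.2 h
  have hneq : wordAt w i (n + 1) ≠ wordAt w i' (n + 1) := fun heq =>
    hne (wordAt_eq_iff.1 heq n (Nat.lt_succ_self n))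
  have hfin := finite_factors w (n + 1)
  have h1 : {u | IsFactor w u ∧ u.length = n} = List.dropLast ''
      ({u | IsFactor w u ∧ u.length = n + 1} \ {wordAt w i (n + 1)}) := by
    rw [image_dropLast_factors]
    apply Set.Subset.antisymm
    · rintro _ ⟨v, hv, rfl⟩
      by_cases hvi : v = wordAt w i (n + 1)
      · rw [hvi, hdrop]
        exact ⟨_, ⟨hmem i', fun h => hneq h.symm⟩, rfl⟩
      · exact ⟨v, ⟨hv, hvi⟩, rfl⟩
    · exact Set.image_mono Set.sdiff_subset
  rw [h1]
  exact (Set.ncard_image_le hfin.sdiff).trans_lt (Set.ncard_sdiff_singleton_lt_of_mem (hmem i) hfin)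

/-- Recurrent words with two or three abelian returns to each factor are Sturmian. -/
theorem Good.sturmian {w : ℕ → Fin 2} (hw : Good w) : Sturmian w := by
  set p : ℕ → ℕ := fun n => {u | IsFactor w u ∧ u.length = n}.ncard with hp
  have hstep : ∀ n, p n + 1 ≤ p (n + 1) := by
    intro n
    obtain ⟨s, A, B, V, c, d, H, hs, h, hH, hn⟩ := hw.exists_level n
    obtain ⟨x, -, hx⟩ := exists_step_of_unbounded h.mono hH 0
    -- At a step of the path the coded word can be read from the `A` with index `x` or from the `B`
    -- behind it. Both readings begin with `V` and then differ, so the suffix of length `n` of `V`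
    -- is right special.
    have h1 := h.tail x
    have h2 := h.tail_at (x := x + 1) (y := H x) (Or.inr (by simp)) hx.le
    have h3 := h1.prefix_ne hs h2 (by simp) (by simpa using hx)
    refine ncard_factors_lt (i := s + (x * A.length + H x * B.length) + (V.length - n))
      (i' := s + ((x + 1) * A.length + H x * B.length) + (V.length - n)) (fun k hk => ?_) ?_
    · have := h1.prefix_eq hs h2 (i := V.length - n + k) (by omega)
      simpa only [add_assoc] using this
    · rw [add_assoc, add_assoc _ _ n, Nat.sub_add_cancel hn]
      simpa only [add_assoc] using h3
  have hbound : ∀ n, ∃ m ≥ n, p m ≤ m + 1 := by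
    intro n
    obtain ⟨s, A, B, V, c, d, H, hs, h, hH, hn⟩ := hw.exists_level n
    have h1 := h.ncard_factors_le hs
    simp only [isFactor_shift hw.recur] at h1
    exact ⟨V.length + 1, by omega, h1⟩
  have hlow : ∀ n k, p n + k ≤ p (n + k) := by
    intro n k
    induction k with
    | zero => rfl
    | succ k ih =>
      have := hstep (n + k)
      rw [← add_assoc n]
      omega
  intro n
  -- `p` starts at 1, grows by at least one at each step, and satisfies `p m ≤ m + 1` for
  -- arbitrarily large `m`, which leaves no slack.
  have h1 : p n = n + 1 := by
    have h2 : p 0 = 1 := ncard_factors_zero w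
    have h3 := hlow 0 n
    rw [zero_add] at h3
    obtain ⟨m, hm, h4⟩ := hbound n
    have h5 := hlow n (m - n)
    rw [Nat.add_sub_cancel' hm] at h5
    omega
  rw [factorComplexity, ← (finite_factors w n).cast_ncard_eq]
  exact_mod_cast h1

/-! ### Right special factors and balance of Sturmian words -/

theorem Sturmian.ncard {w : ℕ → Fin 2} (hs : Sturmian w) (n : ℕ) :
    {u | IsFactor w u ∧ u.length = n}.ncard = n + 1 := by
  have h := hs n
  rw [factorComplexity, ← (finite_factors w n).cast_ncard_eq] at h
  exact_mod_cast h

/-- A Sturmian word has at most one right special factor of each length. -/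
theorem Sturmian.right_special_unique {w : ℕ → Fin 2} (hs : Sturmian w) {n i i' j j' : ℕ}
    (hi : ∀ k < n, w (i + k) = w (i' + k)) (hine : w (i + n) ≠ w (i' + n))
    (hj : ∀ k < n, w (j + k) = w (j' + k)) (hjne : w (j + n) ≠ w (j' + n)) :
    ∀ k < n, w (i + k) = w (j + k) := by
  by_contra hcon
  rw [← wordAt_eq_iff] at hcon hi hj
  have hmem : ∀ i, wordAt w i (n + 1) ∈ {u | IsFactor w u ∧ u.length = n + 1} := fun i =>
    ⟨⟨i, by rw [OccursAt, length_wordAt]⟩, length_wordAt _ _ _⟩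
  have hdrop : ∀ i, (wordAt w i (n + 1)).dropLast = wordAt w i n := fun i => by
    rw [wordAt_succ, List.dropLast_concat]
  have hne : ∀ {i i'}, w (i + n) ≠ w (i' + n) → wordAt w i (n + 1) ≠ wordAt w i' (n + 1) :=
    fun h heq => h (wordAt_eq_iff.1 heq n (Nat.lt_succ_self n))
  have hneq : ∀ {i j}, wordAt w i n ≠ wordAt w j n → wordAt w i (n + 1) ≠ wordAt w j (n + 1) :=
    fun h heq => h (by rw [← hdrop, heq, hdrop])
  have hfin := finite_factors w (n + 1)
  set S := {u | IsFactor w u ∧ u.length = n + 1} with hS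
  -- Each of the two words has a twin with the same first `n` letters, so `dropLast` stays onto
  -- without them; but then only `n` words remain for `n + 1` images.
  have h1 : {u | IsFactor w u ∧ u.length = n} ⊆ List.dropLast ''
      (S \ {wordAt w i (n + 1), wordAt w j (n + 1)}) := by
    rw [image_dropLast_factors]
    rintro _ ⟨v, hv, rfl⟩
    by_cases hvi : v = wordAt w i (n + 1)
    · refine ⟨wordAt w i' (n + 1), ⟨hmem i', ?_⟩, by rw [hvi, hdrop, hdrop, hi]⟩
      rintro (h | h)
      · exact hne hine h.symm
      · exact hneq (hi ▸ hcon) h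
    · by_cases hvj : v = wordAt w j (n + 1)
      · refine ⟨wordAt w j' (n + 1), ⟨hmem j', ?_⟩, by rw [hvj, hdrop, hdrop, hj]⟩
        rintro (h | h)
        · exact hneq (fun h' => hcon (h'.symm.trans hj.symm)) h
        · exact hne hjne h.symm
      · exact ⟨v, ⟨hv, by simp [hvi, hvj]⟩, rfl⟩
  have h2 := Set.ncard_le_ncard h1 (hfin.sdiff.image _)
  have h3 := Set.ncard_image_le (f := List.dropLast)
    (hfin.sdiff (t := {wordAt w i (n + 1), wordAt w j (n + 1)}))
  have h4 : ({wordAt w i (n + 1), wordAt w j (n + 1)} : Set (List (Fin 2))) ⊆ S := by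
    rintro u (rfl | rfl) <;> exact hmem _
  have h5 := Set.ncard_sdiff_add_ncard_of_subset h4 hfin
  rw [Set.ncard_pair (hneq hcon)] at h5
  have h6 := hs.ncard n
  have h7 : S.ncard = n + 1 + 1 := hs.ncard (n + 1)
  omega

theorem Sturmian.exists_right_special {w : ℕ → Fin 2} (hs : Sturmian w) (n : ℕ) :
    ∃ i i', (∀ k < n, w (i + k) = w (i' + k)) ∧ w (i + n) ≠ w (i' + n) := by
  by_contra hcon
  push Not at hcon
  have hinj : Set.InjOn List.dropLast {u | IsFactor w u ∧ u.length = n + 1} := by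
    rintro u ⟨⟨i, hi⟩, hu⟩ v ⟨⟨j, hj⟩, hv⟩ heq
    rw [OccursAt, hu] at hi
    rw [OccursAt, hv] at hj
    rw [← hi, ← hj, wordAt_succ, wordAt_succ, List.dropLast_concat, List.dropLast_concat] at heq
    rw [← hi, ← hj, wordAt_succ, wordAt_succ, heq, hcon i j (wordAt_eq_iff.1 heq)]
  have h1 := hinj.ncard_image
  rw [← image_dropLast_factors, hs.ncard, hs.ncard] at h1
  omega

/-- The numbers of ones of two blocks of equal length differ by at most one. -/
def BalancedWord (w : ℕ → Fin 2) : Prop :=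
  ∀ i j n, height w (i + n) - height w i ≤ height w (j + n) - height w j + 1

theorem letter_eq_of_diff {a b : Fin 2} (h : ((b : ℕ) : ℤ) + 1 ≤ ((a : ℕ) : ℤ)) :
    a = 1 ∧ b = 0 := by
  revert h; revert a b; decide

/-- A shortest unbalanced pair of factors has a common palindromic interior, between zeros in one
factor and between ones in the other. -/
theorem exists_palindrome_of_not_balanced {w : ℕ → Fin 2} (h : ¬ BalancedWord w) :
    ∃ m i j, w i = 1 ∧ w j = 0 ∧ w (i + (m + 1)) = 1 ∧ w (j + (m + 1)) = 0 ∧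
      (∀ k, 1 ≤ k → k ≤ m → w (i + k) = w (j + k)) ∧
      ∀ k, 1 ≤ k → k ≤ m → w (i + k) = w (i + (m + 1 - k)) := by
  classical
  have hex : ∃ n i j, height w (j + n) - height w j + 1 < height w (i + n) - height w i := by
    unfold BalancedWord at h
    push Not at h
    obtain ⟨i, j, n, h⟩ := h
    exact ⟨n, i, j, h⟩
  obtain ⟨i, j, hij⟩ := Nat.find_spec hex
  have hmin : ∀ n < Nat.find hex, ∀ i j,
      height w (i + n) - height w i ≤ height w (j + n) - height w j + 1 := by
    intro n hn i j
    have := Nat.find_min hex hn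
    push Not at this
    exact this i j
  generalize Nat.find hex = n at hij hmin
  have hn2 : 2 ≤ n := by
    by_contra hcon
    interval_cases n
    · simp at hij
    · rw [height_succ, height_succ] at hij
      have := letter_bounds (w i)
      have := letter_bounds (w j)
      omega
  obtain ⟨m, rfl⟩ : ∃ m, n = m + 2 := ⟨n - 2, by omega⟩
  -- The surplus of ones is at least two in total and, by minimality, at most one on either side of
  -- a cut; hence it is exactly one on each.
  have hmid : ∀ k, 1 ≤ k → k ≤ m + 1 →
      height w (i + k) - height w i = height w (j + k) - height w j + 1 := by
    intro k h1 h2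
    have h3 := hmin k (by omega) i j
    have h4 := hmin (m + 2 - k) (by omega) (i + k) (j + k)
    rw [show i + k + (m + 2 - k) = i + (m + 2) by omega,
      show j + k + (m + 2 - k) = j + (m + 2) by omega] at h4
    omega
  have hs1 := hmid 1 le_rfl (by omega)
  rw [height_succ, height_succ] at hs1
  obtain ⟨hi1, hj0⟩ := letter_eq_of_diff (a := w i) (b := w j) (by omega)
  have hlast := hmid (m + 1) (by omega) le_rfl
  rw [show i + (m + 2) = i + (m + 1) + 1 by ring, show j + (m + 2) = j + (m + 1) + 1 by ring,
    height_succ w (i + (m + 1)), height_succ w (j + (m + 1))] at hij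
  obtain ⟨hi2, hj2⟩ := letter_eq_of_diff (a := w (i + (m + 1))) (b := w (j + (m + 1))) (by omega)
  -- Minimality, applied to a prefix of one block against a suffix of the other, shows that prefix
  -- and suffix of equal length contain equally many ones.
  have hpal : ∀ k ≤ m, height w (i + (k + 1)) - height w i =
      height w (i + (m + 1) + 1) - height w (i + (m + 1 - k)) := by
    intro k hk
    have h1 := hmin (k + 1) (by omega) (i + (m + 1 - k)) j
    have h2 := hmin (k + 1) (by omega) i (j + (m + 1 - k))
    rw [show i + (m + 1 - k) + (k + 1) = i + (m + 1) + 1 by omega] at h1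
    rw [show j + (m + 1 - k) + (k + 1) = j + (m + 1) + 1 by omega] at h2
    have h3 := hmid (k + 1) (by omega) (by omega)
    have h4 := hmid (m + 1 - k) (by omega) (by omega)
    rw [height_succ] at h1 h2 ⊢
    rw [hi2] at h1 ⊢
    rw [hj2] at h2
    simp only [Fin.val_one, Fin.val_zero, Nat.cast_one, Nat.cast_zero] at h1 h2 ⊢
    omega
  refine ⟨m, i, j, hi1, hj0, hi2, hj2, fun k h1 h2 => ?_, fun k h1 h2 => ?_⟩
  · have h3 := hmid k h1 (by omega)
    have h4 := hmid (k + 1) (by omega) (by omega)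
    rw [← add_assoc, ← add_assoc, height_succ, height_succ] at h4
    exact letter_eq_of_val (by omega)
  · have h3 := hpal k h2
    have h4 := hpal (k - 1) (by omega)
    rw [Nat.sub_add_cancel h1, show m + 1 - (k - 1) = m + 1 - k + 1 by omega,
      ← add_assoc i (m + 1 - k) 1, height_succ w (i + (m + 1 - k))] at h4
    rw [← add_assoc, height_succ] at h3
    exact letter_eq_of_val (by omega)

/-- A shortest unbalanced pair has the form `0v0`, `1v1` with a palindrome `v`. This `v` is right
special, so the right special factor of length `|v| + 1` is `av` for a letter `a`. Let `b` be the
other letter. As `v` is a palindrome, `av` starts at none of the positions of `bvb`. Two of the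
factors of length `|v| + 1` there agree, and factors other than `av` determine their successors. So
from then on the word is periodic and avoids `av`, against recurrence. -/
theorem Sturmian.balanced {w : ℕ → Fin 2} (hs : Sturmian w) (hw : Recur w) : BalancedWord w := by
  by_contra hcon
  obtain ⟨m, i, j, hi, hj, hi', hj', hij, hpal⟩ := exists_palindrome_of_not_balanced hcon
  obtain ⟨x, y, hxy, hxyne⟩ := hs.exists_right_special (m + 1)
  have hv : ∀ k < m, w (x + 1 + k) = w (i + 1 + k) := by
    refine hs.right_special_unique (i' := y + 1) (j' := j + 1) (fun k hk => ?_) ?_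
      (fun k hk => ?_) ?_
    · have := hxy (1 + k) (by omega)
      rwa [← add_assoc, ← add_assoc] at this
    · rwa [show x + 1 + m = x + (m + 1) by ring, show y + 1 + m = y + (m + 1) by ring]
    · have := hij (1 + k) (by omega) (by omega)
      rwa [← add_assoc, ← add_assoc] at this
    · rw [show i + 1 + m = i + (m + 1) by ring, show j + 1 + m = j + (m + 1) by ring, hi', hj']
      decide
  obtain ⟨p, hp, hp', hpv⟩ : ∃ p, w p ≠ w x ∧ w (p + (m + 1)) ≠ w x ∧
      ∀ k, 1 ≤ k → k ≤ m → w (p + k) = w (i + k) := by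
    rcases letter_cases (w x) with h | h
    · exact ⟨i, by rw [hi, h]; decide, by rw [hi', h]; decide, fun _ _ _ => rfl⟩
    · exact ⟨j, by rw [hj, h]; decide, by rw [hj', h]; decide, fun k h1 h2 => (hij k h1 h2).symm⟩
  have hno : ∀ k ≤ m + 1, wordAt w (p + k) (m + 1) ≠ wordAt w x (m + 1) := by
    intro k hk heq
    rw [wordAt_eq_iff] at heq
    have h0 := heq 0 (by omega)
    simp only [add_zero] at h0
    rcases Nat.eq_zero_or_pos k with rfl | hk0
    · exact hp h0
    · rcases Nat.lt_or_ge m k with hkm | hkm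
      · rw [show k = m + 1 by omega] at h0
        exact hp' h0
      -- Here `v` has the letter `a` at place `k`, hence by symmetry at place `m + 1 - k`; so the
      -- final `b` of `bvb` would equal `a`.
      · have h1 := heq (m + 1 - k) (by omega)
        rw [show p + k + (m + 1 - k) = p + (m + 1) by omega] at h1
        have h2 := hv (m - k) (by omega)
        rw [show x + 1 + (m - k) = x + (m + 1 - k) by omega,
          show i + 1 + (m - k) = i + (m + 1 - k) by omega, ← hpal k hk0 hkm, ← hpv k hk0 hkm,
          h0] at h2
        exact hp' (h1.trans h2)
  have hdet : ∀ a b, wordAt w a (m + 1) = wordAt w b (m + 1) →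
      wordAt w a (m + 1) ≠ wordAt w x (m + 1) →
      wordAt w (a + 1) (m + 1) = wordAt w (b + 1) (m + 1) := by
    intro a b hab hax
    rw [wordAt_eq_iff] at hab ⊢
    intro k hk
    rcases Nat.lt_or_ge k m with h1 | h1
    · have := hab (1 + k) (by omega)
      rwa [← add_assoc, ← add_assoc] at this
    · obtain rfl : k = m := by omega
      by_contra hne
      rw [show a + 1 + k = a + (k + 1) by ring, show b + 1 + k = b + (k + 1) by ring] at hne
      exact hax (wordAt_eq_iff.2 (hs.right_special_unique hab hne hxy hxyne))
  obtain ⟨a, ha, b, hb, hab, heq⟩ : ∃ a ≤ m + 1, ∃ b ≤ m + 1, a < b ∧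
      wordAt w (p + a) (m + 1) = wordAt w (p + b) (m + 1) := by
    have hmem : ∀ i, wordAt w i (m + 1) ∈ {u | IsFactor w u ∧ u.length = m + 1} := fun i =>
      ⟨⟨i, by rw [OccursAt, length_wordAt]⟩, length_wordAt _ _ _⟩
    -- There are `m + 2` positions but only `m + 1` factors of length `m + 1` other than the right
    -- special one.
    have hcard : ((finite_factors w (m + 1)).toFinset.erase (wordAt w x (m + 1))).card <
        (Finset.range (m + 2)).card := by
      rw [Finset.card_erase_of_mem ((Set.Finite.mem_toFinset _).2 (hmem x)), Finset.card_range,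
        ← Set.ncard_eq_toFinset_card _ (finite_factors w (m + 1)), hs.ncard]
      omega
    obtain ⟨a, ha, b, hb, hne, heq⟩ := Finset.exists_ne_map_eq_of_card_lt_of_maps_to hcard
      (f := fun k => wordAt w (p + k) (m + 1)) (fun k hk => by
        have hk' : k < m + 2 := by simpa using hk
        exact Finset.mem_coe.2 (Finset.mem_erase.2 ⟨hno k (by omega),
          (Set.Finite.mem_toFinset _).2 (hmem _)⟩))
    rw [Finset.mem_range] at ha hb
    rcases lt_or_gt_of_ne hne with h | h
    · exact ⟨a, by omega, b, by omega, h, heq⟩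
    · exact ⟨b, by omega, a, by omega, h, heq.symm⟩
  have key : ∀ t, wordAt w (p + a + t) (m + 1) = wordAt w (p + b + t) (m + 1) ∧
      ∀ k, a ≤ k → k ≤ b + t → wordAt w (p + k) (m + 1) ≠ wordAt w x (m + 1) := by
    intro t
    induction t with
    | zero => exact ⟨heq, fun k h1 h2 => hno k (by omega)⟩
    | succ t ih =>
      obtain ⟨ih1, ih2⟩ := ih
      have h1 := hdet _ _ ih1 (by
        rw [add_assoc]
        exact ih2 (a + t) (by omega) (by omega))
      refine ⟨h1, fun k h2 h3 => ?_⟩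
      rcases Nat.lt_or_ge (b + t) k with h4 | h4
      · have h5 := ih2 (a + (t + 1)) (by omega) (by omega)
        rw [show p + k = p + b + t + 1 by omega, ← h1]
        rwa [← add_assoc, ← add_assoc] at h5
      · exact ih2 k h2 h4
  obtain ⟨z, hz, hzx⟩ := hw x (m + 1) (p + a)
  refine (key (z - (p + a))).2 (z - p) (by omega) (by omega) ?_
  rw [Nat.add_sub_cancel' (by omega), wordAt_eq_iff]
  exact hzx

/-! ### Slope of a balanced word and its irrationality -/

/-- Each of the `k` successive blocks differs from the reference block by at most one. -/
theorem BalancedWord.abs_height_mul_sub_le {w : ℕ → Fin 2} (hb : BalancedWord w) (i n k : ℕ) :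
    |height w (k * n) - k * (height w (i + n) - height w i)| ≤ k := by
  induction k with
  | zero => simp [height_zero]
  | succ k ih =>
    have h1 := hb (k * n) i n
    have h2 := hb i (k * n) n
    rw [Nat.succ_mul, abs_le] at *
    push_cast
    constructor <;> linarith [ih.1, ih.2]

/-- A balanced word has a slope. -/
theorem BalancedWord.exists_slope {w : ℕ → Fin 2} (hb : BalancedWord w) :
    ∃ α : ℝ, ∀ i n, |(height w (i + n) : ℝ) - height w i - n * α| ≤ 1 := by
  -- Both quotients are compared with the height of the prefix of length `n * k`.
  have key : ∀ i j n k : ℕ, 1 ≤ n → 1 ≤ k →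
      ((height w (i + n) : ℝ) - height w i - 1) / n ≤ (height w (j + k) - height w j + 1) / k := by
    intro i j n k hn hk
    have h1 := abs_le.1 (hb.abs_height_mul_sub_le i n k)
    have h2 := abs_le.1 (hb.abs_height_mul_sub_le j k n)
    rw [mul_comm n k] at h2
    have h3 : (k : ℤ) * (height w (i + n) - height w i - 1) ≤
        n * (height w (j + k) - height w j + 1) := by linarith [h1.1, h1.2, h2.1, h2.2]
    have h4 : (k : ℝ) * (height w (i + n) - height w i - 1) ≤
        n * (height w (j + k) - height w j + 1) := by exact_mod_cast h3
    have hn' : (0 : ℝ) < n := by exact_mod_cast hn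
    have hk' : (0 : ℝ) < k := by exact_mod_cast hk
    rw [div_le_div_iff₀ hn' hk']
    linarith
  set S : Set ℝ := {x | ∃ i n : ℕ, 1 ≤ n ∧ x = ((height w (i + n) : ℝ) - height w i - 1) / n}
    with hS
  have hne : S.Nonempty := ⟨_, 0, 1, le_rfl, rfl⟩
  have hub : ∀ j k : ℕ, 1 ≤ k →
      ((height w (j + k) : ℝ) - height w j + 1) / k ∈ upperBounds S := by
    rintro j k hk _ ⟨i, n, hn, rfl⟩
    exact key i j n k hn hk
  refine ⟨sSup S, fun i n => ?_⟩
  rcases Nat.eq_zero_or_pos n with rfl | hn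
  · simp
  · have h1 := le_csSup ⟨_, hub 0 1 le_rfl⟩ (show _ ∈ S from ⟨i, n, hn, rfl⟩)
    have h2 := csSup_le hne (hub i n hn)
    have hn' : (0 : ℝ) < n := by exact_mod_cast hn
    rw [div_le_iff₀ hn'] at h1
    rw [le_div_iff₀ hn'] at h2
    rw [abs_le]
    constructor <;> linarith

/-- A word of period `n` has at most `n` factors of length `n`. -/
theorem Sturmian.not_periodic {w : ℕ → Fin 2} (hs : Sturmian w) {n : ℕ}
    (hn : 0 < n) (h : ∀ i, w (i + n) = w i) : False := by
  have hmod : ∀ k i, w (i + n * k) = w i := by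
    intro k
    induction k with
    | zero => simp
    | succ k ih => intro i; rw [Nat.mul_succ, ← add_assoc, h, ih]
  have hsub : {u | IsFactor w u ∧ u.length = n} ⊆
      (fun i => wordAt w i n) '' (Finset.range n : Set ℕ) := by
    rintro u ⟨⟨i, hi⟩, hu⟩
    refine ⟨i % n, by simpa using Nat.mod_lt i hn, ?_⟩
    rw [OccursAt, hu] at hi
    rw [← hi]
    refine wordAt_eq_iff.2 fun k _ => ?_
    conv_rhs => rw [← Nat.mod_add_div i n]
    rw [show i % n + n * (i / n) + k = i % n + k + n * (i / n) by ring, hmod]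
  have h1 := Set.ncard_le_ncard hsub ((Finset.finite_toSet _).image _)
  have h2 := Set.ncard_image_le (f := fun i => wordAt w i n) (Finset.finite_toSet (Finset.range n))
  rw [Set.ncard_coe_finset, Finset.card_range] at h2
  rw [hs.ncard] at h1
  omega

/-- In an aperiodic balanced word the deviation from the slope is never attained exactly. -/
theorem Sturmian.slope_irrational {w : ℕ → Fin 2} (hs : Sturmian w) (hw : Recur w)
    (hb : BalancedWord w) {α : ℝ}
    (hα : ∀ i n, |(height w (i + n) : ℝ) - height w i - n * α| ≤ 1) {n : ℕ} (hn : 0 < n) (q : ℤ) :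
    (n : ℝ) * α ≠ q := by
  intro hq
  by_cases hper : ∀ i, height w (i + n) - height w i = q
  · refine hs.not_periodic hn fun i => ?_
    have h1 := hper i
    have h2 := hper (i + 1)
    rw [add_right_comm, height_succ, height_succ] at h2
    exact letter_eq_of_val (by omega)
  push Not at hper
  obtain ⟨i₀, hi₀⟩ := hper
  -- By balance, all blocks of length `n` deviate from `q` ones to the same side.
  obtain ⟨σ, hσ, hσ0, hσi⟩ : ∃ σ : ℤ, (σ = 1 ∨ σ = -1) ∧
      1 ≤ σ * (height w (i₀ + n) - height w i₀ - q) ∧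
      ∀ i, 0 ≤ σ * (height w (i + n) - height w i - q) := by
    rcases lt_or_gt_of_ne hi₀ with h | h
    · refine ⟨-1, Or.inr rfl, by omega, fun i => ?_⟩
      have := hb i i₀ n
      omega
    · refine ⟨1, Or.inl rfl, by omega, fun i => ?_⟩
      have := hb i₀ i n
      omega
  -- A sum of `n` successive heights without its drift, which grows at each step by the deviation of
  -- the block at `i`. Recurrence of the block at `i₀` makes it unbounded, while the slope bounds it
  -- by `Ψ 0 + n`.
  set Ψ : ℕ → ℤ := fun i => σ * (∑ r ∈ Finset.range n, height w (i + r) - q * i) with hΨ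
  have hstep : ∀ i, Ψ (i + 1) = Ψ i + σ * (height w (i + n) - height w i - q) := by
    intro i
    have h1 : ∑ r ∈ Finset.range n, height w (i + 1 + r) + height w i =
        ∑ r ∈ Finset.range n, height w (i + r) + height w (i + n) := by
      rw [← Finset.sum_range_succ (fun r => height w (i + r)) n, Finset.sum_range_succ']
      simp only [add_zero, add_assoc, add_comm 1]
    simp only [hΨ]
    push_cast
    linear_combination σ * h1
  have hmono : Monotone Ψ := monotone_nat_of_le_succ fun i => by
    rw [hstep]
    linarith [hσi i]
  have hgrow : ∀ M : ℕ, ∃ k, Ψ 0 + M ≤ Ψ k := by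
    intro M
    induction M with
    | zero => exact ⟨0, by simp⟩
    | succ M ih =>
      obtain ⟨k, hk⟩ := ih
      obtain ⟨k', h1, h2⟩ := hw i₀ n k
      refine ⟨k' + 1, ?_⟩
      rw [hstep, height_congr h2]
      have := hmono h1
      push_cast
      linarith
  have hbound : ∀ i, Ψ i ≤ Ψ 0 + n := by
    intro i
    have h1 : ∀ r, (height w (i + r) : ℝ) - height w r - i * α ≤ 1 ∧
        -1 ≤ (height w (i + r) : ℝ) - height w r - i * α := fun r => by
      have := abs_le.1 (hα r i)
      rw [add_comm r i] at this
      exact ⟨this.2, this.1⟩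
    have h2 : (Ψ i : ℝ) - Ψ 0 =
        ∑ r ∈ Finset.range n, σ * ((height w (i + r) : ℝ) - height w r - i * α) := by
      rw [← Finset.mul_sum, Finset.sum_sub_distrib, Finset.sum_sub_distrib, Finset.sum_const,
        Finset.card_range, nsmul_eq_mul]
      simp only [hΨ]
      push_cast
      simp only [zero_add]
      linear_combination ((σ : ℝ) * i) * hq
    have h3 : (Ψ i : ℝ) - Ψ 0 ≤ ∑ r ∈ Finset.range n, (1 : ℝ) := by
      rw [h2]
      refine Finset.sum_le_sum fun r _ => ?_
      rcases hσ with rfl | rfl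
      · push_cast; linarith [h1 r]
      · push_cast; linarith [h1 r]
    rw [Finset.sum_const, Finset.card_range, nsmul_eq_mul, mul_one] at h3
    have h4 : (Ψ i : ℝ) ≤ ((Ψ 0 + n : ℤ) : ℝ) := by push_cast; linarith
    exact_mod_cast h4
  obtain ⟨k, hk⟩ := hgrow (n + 1)
  have := hbound k
  push_cast at hk
  omega

/-! ### Deviations from the slope and the three-distance argument -/

/-- Equality in the slope bound would make a positive multiple of the slope an integer. -/
theorem Sturmian.dev_lt {w : ℕ → Fin 2} (hs : Sturmian w) (hw : Recur w)
    (hb : BalancedWord w) {α : ℝ}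
    (hα : ∀ i n, |(height w (i + n) : ℝ) - height w i - n * α| ≤ 1) (i j : ℕ) :
    ((height w j : ℝ) - j * α) - (height w i - i * α) < 1 ∧
    ((height w i : ℝ) - i * α) - (height w j - j * α) < 1 := by
  wlog hij : i ≤ j generalizing i j
  · exact (this j i (by omega)).symm
  obtain ⟨n, rfl⟩ := Nat.exists_eq_add_of_le hij
  have h1 := abs_le.1 (hα i n)
  rcases Nat.eq_zero_or_pos n with rfl | hn
  · simp
  have h2 := hs.slope_irrational hw hb hα hn (height w (i + n) - height w i - 1)
  have h3 := hs.slope_irrational hw hb hα hn (height w (i + n) - height w i + 1)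
  push_cast at h2 h3 ⊢
  constructor
  · refine lt_of_le_of_ne (by linarith) fun h => h2 (by linarith)
  · refine lt_of_le_of_ne (by linarith) fun h => h3 (by linarith)

theorem Sturmian.dev_injective {w : ℕ → Fin 2} (hs : Sturmian w) (hw : Recur w)
    (hb : BalancedWord w) {α : ℝ}
    (hα : ∀ i n, |(height w (i + n) : ℝ) - height w i - n * α| ≤ 1) {i j : ℕ} (hij : i < j) :
    (height w j : ℝ) - j * α ≠ height w i - i * α := by
  obtain ⟨n, rfl⟩ := Nat.exists_eq_add_of_le hij.le
  intro h
  refine hs.slope_irrational hw hb hα (n := n) (by omega) (height w (i + n) - height w i) ?_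
  push_cast at h ⊢
  linarith

theorem eq_of_abs_sub_lt_one {a b : ℤ} (h1 : (a : ℝ) < b + 1) (h2 : (b : ℝ) < a + 1) : a = b := by
  have h1' : a < b + 1 := by exact_mod_cast h1
  have h2' : b < a + 1 := by exact_mod_cast h2
  omega

/-- Windows are convex for the deviation `y`, and displacements that stay between
deviations of a window are realised. -/
theorem window_transport {w : ℕ → Fin 2} {α : ℝ}
    (hy : ∀ i j, ((height w j : ℝ) - j * α) - (height w i - i * α) < 1)
    {N : ℕ} {v : ℤ} {i b c t : ℕ} {q : ℤ} (hb : b ∈ window w N v) (hc : c ∈ window w N v)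
    (h1 : (height w b : ℝ) - b * α ≤ height w i - i * α + (q - t * α))
    (h2 : height w i - i * α + (q - t * α) ≤ height w c - c * α) :
    i + t ∈ window w N v ∧ height w (i + t) = height w i + q := by
  have h3 : height w (i + t) = height w i + q := by
    have h4 := hy b (i + t)
    have h5 := hy (i + t) c
    push_cast at h4 h5
    refine eq_of_abs_sub_lt_one ?_ ?_ <;> push_cast <;> linarith
  refine ⟨?_, h3⟩
  have hb' : height w (b + N) = height w b + v := hb
  have hc' : height w (c + N) = height w c + v := hc
  show height w (i + t + N) = height w (i + t) + v
  have h4 := hy (b + N) (i + t + N)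
  have h5 := hy (i + t + N) (c + N)
  rw [hb'] at h4
  rw [hc'] at h5
  rw [h3] at *
  push_cast at h4 h5
  refine eq_of_abs_sub_lt_one ?_ ?_ <;> push_cast <;> linarith

/-- Classification of the first returns that increase the deviation `h i - i β`, given the
shortest increasing displacement `(r, p)` and the shortest decreasing displacement `(s, q)`. -/
theorem increasing_return {W : Set ℕ} {h : ℕ → ℤ} {β : ℝ}
    (hy : ∀ i j, ((h j : ℝ) - j * β) - (h i - i * β) < 1)
    (hT : ∀ i b c t : ℕ, ∀ q : ℤ, b ∈ W → c ∈ W →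
      (h b : ℝ) - b * β ≤ h i - i * β + (q - t * β) →
      h i - i * β + (q - t * β) ≤ h c - c * β → i + t ∈ W ∧ h (i + t) = h i + q)
    {r s a a' : ℕ} {p q : ℤ} (ha : a ∈ W) (har : a + r ∈ W) (hr : h (a + r) = h a + p)
    (hr0 : 0 < p - r * β) (hs1 : 0 < s)
    (hrmin : ∀ b t : ℕ, b ∈ W → b + t ∈ W →
      (h b : ℝ) - b * β < h (b + t) - (b + t : ℕ) * β → r ≤ t)
    (ha' : a' ∈ W) (has : a' + s ∈ W) (hs : h (a' + s) = h a' + q) (hs0 : q - s * β < 0)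
    (hsmin : ∀ b t : ℕ, b ∈ W → b + t ∈ W →
      (h (b + t) : ℝ) - (b + t : ℕ) * β < h b - b * β → s ≤ t)
    {i t : ℕ} (hi : i ∈ W) (hit : i + t ∈ W) (hno : ∀ k, 0 < k → k < t → i + k ∉ W)
    (hr1 : 0 < r) (hinc : (h i : ℝ) - i * β < h (i + t) - (i + t : ℕ) * β) :
    (t, h (i + t) - h i) = (r, p) ∨ (t, h (i + t) - h i) = (r + s, p + q) := by
  have hrt := hrmin i t hi hit hinc
  rcases hrt.eq_or_lt with rfl | hlt
  · left
    have h1 := hy i (i + r)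
    have h2 := hy a (a + r)
    rw [hr] at h2
    push_cast at h1 h2 hinc
    rw [Prod.mk.injEq]
    refine ⟨rfl, eq_of_abs_sub_lt_one ?_ ?_⟩ <;> push_cast <;> linarith
  · right
    -- Otherwise the displacement `(r, p)` would lead from `i` back to `W` before time `t`.
    have hup : ∀ b ∈ W, (h b : ℝ) - b * β < h i - i * β + (p - r * β) := by
      intro b hb
      by_contra! hcon
      exact hno r hr1 hlt (hT i i b r p hi hb (by linarith) hcon).1
    -- Applied at `a`, the displacement of the return ends in `W` below the deviation of `a + r`.
    -- The descent from `a + r` then takes at least `s` letters.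
    have hat := hT a a (a + r) t (h (i + t) - h i) ha har
      (by push_cast at hinc ⊢; linarith)
      (by have := hup _ hit; rw [hr]; push_cast at this ⊢; linarith)
    have hst : s ≤ t - r := by
      refine hsmin (a + r) (t - r) har ?_ ?_
      · rw [show a + r + (t - r) = a + t by omega]
        exact hat.1
      · rw [show a + r + (t - r) = a + t by omega, hat.2, hr]
        have := hup _ hit
        push_cast at this ⊢
        linarith
    have hlow : ∀ b ∈ W, (h i : ℝ) - i * β + (q - s * β) < h b - b * β := by
      intro b hb
      by_contra! hcon
      exact hno s hs1 (by omega) (hT i b i s q hb hi hcon (by linarith)).1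
    -- As `(r, p)` leads above all deviations of `W` and `(s, q)` below all of them, their sum
    -- applied at `i` lands between those of `a' + s` and `a + r`.
    have hrs := hT i (a' + s) (a + r) (r + s) (p + q) has har
      (by have := hup _ ha'; rw [hs]; push_cast; linarith)
      (by have := hlow _ ha; rw [hr]; push_cast; linarith)
    obtain rfl : t = r + s := by
      by_contra hne
      exact hno (r + s) (by omega) (by omega) hrs.1
    rw [hrs.2, add_sub_cancel_left]

theorem antitone_of_consec {S : Set ℕ} {f : ℕ → ℝ} (h : ∀ i j, Consec S i j → f j ≤ f i)
    {a : ℕ} (ha : a ∈ S) : ∀ b, a ≤ b → b ∈ S → f b ≤ f a := by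
  intro b
  induction b using Nat.strong_induction_on with
  | _ b ih =>
    intro hab hb
    rcases hab.eq_or_lt with rfl | hlt
    · exact le_rfl
    · obtain ⟨q, h1, h2, h3, h4⟩ := exists_last ha (Nat.le_sub_one_of_lt hlt)
      exact (h q b ⟨h3, hb, by omega, fun k h5 h6 => h4 k h5 (by omega)⟩).trans
        (ih q (by omega) h1 h3)

/-- If all returns went the same way, the infinitely many repetitions of one of them would make the
deviation unbounded. -/
theorem Recur.exists_increasing_consec {w : ℕ → Fin 2} (hw : Recur w) {α : ℝ}
    (hy : ∀ i j, ((height w j : ℝ) - j * α) - (height w i - i * α) < 1)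
    (hinj : ∀ i j, i < j → (height w j : ℝ) - j * α ≠ height w i - i * α)
    {N : ℕ} {v : ℤ} (hne : (window w N v).Nonempty) {σ : ℝ} (hσ : σ = 1 ∨ σ = -1) :
    ∃ i j, Consec (window w N v) i j ∧
      σ * ((height w i : ℝ) - i * α) < σ * (height w j - j * α) := by
  by_contra! hcon
  obtain ⟨i, hi⟩ := hne
  obtain ⟨j, hij⟩ := hw.exists_consec hi
  have hδ : 0 < σ * ((height w i : ℝ) - i * α) - σ * (height w j - j * α) := by
    refine sub_pos.2 (lt_of_le_of_ne (hcon i j hij) fun h => hinj i j hij.2.2.1 ?_)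
    rcases hσ with rfl | rfl <;> linarith
  set δ := σ * ((height w i : ℝ) - i * α) - σ * (height w j - j * α) with hδ'
  have hfar : ∀ M : ℕ, ∃ k ∈ window w N v,
      σ * ((height w k : ℝ) - k * α) ≤ σ * (height w i - i * α) - M * δ := by
    intro M
    induction M with
    | zero => exact ⟨i, hi, by simp⟩
    | succ M ih =>
      obtain ⟨k, hk, hkM⟩ := ih
      obtain ⟨i', h1, h2, h3⟩ := hw.exists_consec_late hij k
      refine ⟨_, h2.2.1, ?_⟩
      have h4 := antitone_of_consec (f := fun x => σ * ((height w x : ℝ) - x * α)) hcon hk i' h1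
        h2.1
      have h5 : (height w (i' + (j - i)) : ℝ) = height w i' + (height w j - height w i) := by
        have : height w (i' + (j - i)) = height w i' + (height w j - height w i) := by linarith
        exact_mod_cast this
      rw [h5, Nat.cast_add, Nat.cast_sub hij.2.2.1.le]
      push_cast
      linarith
  obtain ⟨M, hM⟩ := exists_nat_gt (1 / δ)
  rw [div_lt_iff₀ hδ] at hM
  obtain ⟨k, -, hk⟩ := hfar M
  have h1 := hy i k
  have h2 := hy k i
  rcases hσ with rfl | rfl <;> linarith

/-- In a Sturmian word every abelian class has two or three returns. -/
theorem Sturmian.gaps_encard {w : ℕ → Fin 2} (hs : Sturmian w) (hw : Recur w) {N : ℕ} {v : ℤ}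
    (hne : (window w N v).Nonempty) : (gaps w N v).encard = 2 ∨ (gaps w N v).encard = 3 := by
  classical
  have hb := hs.balanced hw
  obtain ⟨α, hα⟩ := hb.exists_slope
  have hy : ∀ i j, ((height w j : ℝ) - j * α) - (height w i - i * α) < 1 := fun i j =>
    (hs.dev_lt hw hb hα i j).1
  have hinj : ∀ i j, i < j → (height w j : ℝ) - j * α ≠ height w i - i * α := fun i j h =>
    hs.dev_injective hw hb hα h
  obtain ⟨i₁, j₁, hc₁, hlt₁⟩ := hw.exists_increasing_consec hy hinj hne (Or.inl rfl)
  obtain ⟨i₂, j₂, hc₂, hlt₂⟩ := hw.exists_increasing_consec hy hinj hne (Or.inr rfl)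
  have hex₁ : ∃ r a, a ∈ window w N v ∧ a + r ∈ window w N v ∧
      (height w a : ℝ) - a * α < height w (a + r) - (a + r : ℕ) * α :=
    ⟨j₁ - i₁, i₁, hc₁.1, by
      rw [Nat.add_sub_cancel' hc₁.2.2.1.le]
      exact ⟨hc₁.2.1, by linarith⟩⟩
  have hex₂ : ∃ s a, a ∈ window w N v ∧ a + s ∈ window w N v ∧
      (height w (a + s) : ℝ) - (a + s : ℕ) * α < height w a - a * α :=
    ⟨j₂ - i₂, i₂, hc₂.1, by
      rw [Nat.add_sub_cancel' hc₂.2.2.1.le]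
      exact ⟨hc₂.2.1, by linarith⟩⟩
  obtain ⟨a, ha, har, hlta⟩ := Nat.find_spec hex₁
  obtain ⟨a', ha', has, hlta'⟩ := Nat.find_spec hex₂
  have hrmin : ∀ b t : ℕ, b ∈ window w N v → b + t ∈ window w N v →
      (height w b : ℝ) - b * α < height w (b + t) - (b + t : ℕ) * α → Nat.find hex₁ ≤ t :=
    fun b t h1 h2 h3 => Nat.find_min' hex₁ ⟨b, h1, h2, h3⟩
  have hsmin : ∀ b t : ℕ, b ∈ window w N v → b + t ∈ window w N v →
      (height w (b + t) : ℝ) - (b + t : ℕ) * α < height w b - b * α → Nat.find hex₂ ≤ t :=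
    fun b t h1 h2 h3 => Nat.find_min' hex₂ ⟨b, h1, h2, h3⟩
  generalize Nat.find hex₁ = r at *
  generalize Nat.find hex₂ = s at *
  have hr0 : 0 < r := Nat.pos_of_ne_zero fun h => by subst h; simp at hlta
  have hs0 : 0 < s := Nat.pos_of_ne_zero fun h => by subst h; simp at hlta'
  obtain ⟨p, hp⟩ : ∃ p, height w (a + r) = height w a + p :=
    ⟨height w (a + r) - height w a, by ring⟩
  obtain ⟨q, hq⟩ : ∃ q, height w (a' + s) = height w a' + q :=
    ⟨height w (a' + s) - height w a', by ring⟩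
  have hp0 : (0 : ℝ) < p - r * α := by
    rw [hp] at hlta
    push_cast at hlta
    linarith
  have hq0 : (q : ℝ) - s * α < 0 := by
    rw [hq] at hlta'
    push_cast at hlta'
    linarith
  have hsub : gaps w N v ⊆ {(r, p), (s, q), (r + s, p + q)} := by
    rintro _ ⟨i, j, ⟨hi, hj, hij, hno⟩, rfl⟩
    obtain ⟨t, rfl⟩ := Nat.exists_eq_add_of_le hij.le
    have hno' : ∀ k, 0 < k → k < t → i + k ∉ window w N v := fun k h1 h2 =>
      hno _ (by omega) (by omega)
    rw [Nat.add_sub_cancel_left]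
    rcases lt_or_gt_of_ne (hinj _ _ hij) with hlt | hlt
    -- Negating heights and slope turns decreasing returns into increasing ones and exchanges the
    -- two shortest displacements.
    · have := increasing_return (W := window w N v) (h := fun i => - height w i) (β := -α)
        (fun i j => by have := hy j i; push_cast; linarith)
        (fun i b c t q hb hc h1 h2 => by
          push_cast at h1 h2
          have := window_transport hy (i := i) (t := t) (q := -q) hc hb
            (by push_cast; linarith) (by push_cast; linarith)
          exact ⟨this.1, by linarith [this.2]⟩)
        (p := -q) (q := -p) ha' has (by linarith) (by push_cast; linarith) hr0
        (fun b t h1 h2 h3 => hsmin b t h1 h2 (by push_cast at h3 ⊢; linarith))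
        ha har (by linarith) (by push_cast; linarith)
        (fun b t h1 h2 h3 => hrmin b t h1 h2 (by push_cast at h3 ⊢; linarith))
        hi hj hno' hs0 (by push_cast at hlt ⊢; linarith)
      simp only [Prod.mk.injEq] at this
      simp only [Set.mem_insert_iff, Set.mem_singleton_iff, Prod.mk.injEq]
      omega
    · have := increasing_return hy (fun i b c t q hb hc h1 h2 => window_transport hy hb hc h1 h2)
        ha har hp hp0 hs0 hrmin ha' has hq hq0 hsmin hi hj hno' hr0 hlt
      rcases this with h | h <;> rw [h] <;> simp
  have h3 : (gaps w N v).encard ≤ 3 := by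
    refine (Set.encard_le_encard hsub).trans ?_
    refine (Set.encard_insert_le _ _).trans ?_
    refine (add_le_add_left (Set.encard_insert_le _ _) 1).trans ?_
    rw [Set.encard_singleton]
    decide
  have h2 : 2 ≤ (gaps w N v).encard := by
    -- Equal pairs would change the deviation equally, but one of these returns increases it and the
    -- other decreases it.
    have hne' : (j₁ - i₁, height w j₁ - height w i₁) ≠ (j₂ - i₂, height w j₂ - height w i₂) := by
      rw [Ne, Prod.mk.injEq]
      rintro ⟨h4, h5⟩
      have h6 : ((j₁ - i₁ : ℕ) : ℝ) = ((j₂ - i₂ : ℕ) : ℝ) := by rw [h4]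
      have h7 : ((height w j₁ - height w i₁ : ℤ) : ℝ) = ((height w j₂ - height w i₂ : ℤ) : ℝ) := by
        rw [h5]
      rw [Nat.cast_sub hc₁.2.2.1.le, Nat.cast_sub hc₂.2.2.1.le] at h6
      push_cast at h7
      have h8 : ((j₁ : ℝ) - i₁) * α = (j₂ - i₂) * α := by rw [h6]
      linarith
    rw [← Set.encard_pair hne']
    refine Set.encard_le_encard ?_
    rintro _ (rfl | rfl)
    · exact hc₁.mem_gaps
    · exact hc₂.mem_gaps
  generalize (gaps w N v).encard = e at h2 h3
  lift e to ℕ using ne_top_of_le_ne_top (by decide) h3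
  norm_cast at h2 h3 ⊢
  omega

theorem theorem2 (w : ℕ → Fin 2) (hw : Recurrent w) :
    Sturmian w ↔
      ∀ u : List (Fin 2), IsFactor w u →
        (abelianReturns w u).encard = 2 ∨ (abelianReturns w u).encard = 3 := by
  refine ⟨fun hs u hu => ?_, fun h => (good_of_returns hw h).sturmian⟩
  rw [encard_abelianReturns]
  obtain ⟨i, hi⟩ := hu
  refine hs.gaps_encard (recur_of_recurrent hw) ⟨i, ?_⟩
  have h := count_wordAt w i u.length
  rw [OccursAt] at hi
  rw [hi] at h
  show height w (i + u.length) = height w i + _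
  linarith
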